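/- Let $d\ge 1$ and let $f:X\to S^{d+1}\subset\mathbb R^{d+2}$ be a smooth isoparametric hypersurface of the unit sphere with four principal curvatures. That is, $X$ is a compact connected smooth $d$-dimensional manifold, $f$ is a smooth immersion with a smooth unit normal field $\nu:X\to\mathbb R^{d+2}$ (so $|\nu|=1$, $\nu\perp f$ and $\nu\perp df(TX)$), and there is a set $K\subset\mathbb R$ with exactly four elements which at every point of $X$ is the set of eigenvalues of the shape operator $A$, defined by $d\nu(v)=-df(Av)$. Let $M\subset S^{d+1}$ be a focal submanifold of this hypersurface, that is, $$M=\{\cos\theta\, f(p)+\sin\theta\,\nu(p)\;:\;p\in X\}$$ for some $\theta\in\mathbb R$ with $\sin\theta\neq 0$ and $\cot\theta\in K$. (If $n=\dim M$ and $m+1$ is the codimension of $M$ in the sphere, then $d=n+m$.) Let $$U\mathcal N=\{(x,\mathbf n)\in\mathbb R^{d+2}\times\mathbb R^{d+2}\;:\;x\in M,\ |\mathbf n|=1,\ \mathbf n\perp x,\ \mathbf n\perp T_xM\}$$ be the unit normal bundle of $M$ in the sphere. Then the swap map $T(p,q)=(q,p)$ on $\mathbb R^{d+2}\times\mathbb R^{d+2}$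 leaves $U\mathcal N$ invariant: $T(U\mathcal N)=U\mathcal N$. In particular $(x,\mathbf n)\in U\mathcal N$ implies $(\mathbf n,x)\in U\mathcal N$. -/

import Mathlib

open scoped Manifold ContDiff

noncomputable section

/-- The differential at `p` of a map `f` from a `d`-dimensional manifold into the vector space
`ℝ^N`, as a linear map with values in `ℝ^N`. -/
def differential (d : ℕ) {N : ℕ} {X : Type*} [TopologicalSpace X]
    [ChartedSpace (EuclideanSpace ℝ (Fin d)) X]
    (f : X → EuclideanSpace ℝ (Fin N)) (p : X) :
    TangentSpace (𝓡 d) p →L[ℝ] EuclideanSpace ℝ (Fin N) :=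
  mfderiv (𝓡 d) 𝓘(ℝ, EuclideanSpace ℝ (Fin N)) f p

/-- `f : X → S^{d+1} ⊆ ℝ^{d+2}` is a smooth immersed hypersurface of the unit sphere and
`ν` is a smooth field of unit vectors that are tangent to the sphere and normal to `f`. -/
structure IsOrientedHypersurface {d : ℕ} {X : Type*} [TopologicalSpace X]
    [ChartedSpace (EuclideanSpace ℝ (Fin d)) X]
    (f ν : X → EuclideanSpace ℝ (Fin (d + 2))) : Prop where
  smooth : ContMDiff (𝓡 d) 𝓘(ℝ, EuclideanSpace ℝ (Fin (d + 2))) ∞ f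
  smooth_normal : ContMDiff (𝓡 d) 𝓘(ℝ, EuclideanSpace ℝ (Fin (d + 2))) ∞ ν
  immersion : ∀ p : X, Function.Injective (differential d f p)
  norm_eq_one : ∀ p : X, ‖f p‖ = 1
  norm_normal : ∀ p : X, ‖ν p‖ = 1
  normal_perp_position : ∀ p : X, inner ℝ (ν p) (f p) = 0
  normal_perp_tangent : ∀ (p : X) (v : TangentSpace (𝓡 d) p),
    inner ℝ (ν p) (differential d f p v) = 0

/-- `κ` is a principal curvature of `(f, ν)` at `p`: an eigenvalue of the shape operator `A`,
which is given by `dν(v) = -df(A v)`. -/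
def IsPrincipalCurvature {d : ℕ} {X : Type*} [TopologicalSpace X]
    [ChartedSpace (EuclideanSpace ℝ (Fin d)) X]
    (f ν : X → EuclideanSpace ℝ (Fin (d + 2))) (p : X) (κ : ℝ) : Prop :=
  ∃ v : TangentSpace (𝓡 d) p, v ≠ 0 ∧ differential d ν p v = -(κ • differential d f p v)

/-- The oriented hypersurface `(f, ν)` is isoparametric, with `K` as its set of distinct
(constant) principal curvatures. -/
structure IsIsoparametric {d : ℕ} {X : Type*} [TopologicalSpace X]
    [ChartedSpace (EuclideanSpace ℝ (Fin d)) X]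
    (f ν : X → EuclideanSpace ℝ (Fin (d + 2))) (K : Finset ℝ) : Prop where
  hypersurface : IsOrientedHypersurface f ν
  curvatures : ∀ (p : X) (κ : ℝ), IsPrincipalCurvature f ν p κ ↔ κ ∈ K

/-- The parallel map at oriented distance `θ`: follow the normal geodesic of the sphere that
starts at `f p` in the direction `ν p` for time `θ`. -/
def parallelMap {d : ℕ} {X : Type*} (f ν : X → EuclideanSpace ℝ (Fin (d + 2))) (θ : ℝ) (p : X) :
    EuclideanSpace ℝ (Fin (d + 2)) :=
  Real.cos θ • f p + Real.sin θ • ν p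

/-- `M` is a focal submanifold of the isoparametric hypersurface `(f, ν)` with principal
curvatures `K`: the image of the parallel map at an oriented distance `θ` with `cot θ ∈ K`. -/
def IsFocalSubmanifold {d : ℕ} {X : Type*} (f ν : X → EuclideanSpace ℝ (Fin (d + 2)))
    (K : Finset ℝ) (M : Set (EuclideanSpace ℝ (Fin (d + 2)))) : Prop :=
  ∃ θ : ℝ, (∃ κ ∈ K, Real.cos θ = κ * Real.sin θ) ∧ M = Set.range (parallelMap f ν θ)

/-- The unit normal bundle, in the unit sphere, of a submanifold `M` of the unit sphere of `ℝ^N`.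
The tangent space of the submanifold `M` at `x` is its tangent cone. -/
def unitNormalBundle {N : ℕ} (M : Set (EuclideanSpace ℝ (Fin N))) :
    Set (EuclideanSpace ℝ (Fin N) × EuclideanSpace ℝ (Fin N)) :=
  {u | u.1 ∈ M ∧ ‖u.2‖ = 1 ∧ inner ℝ u.2 u.1 = 0 ∧
    ∀ v ∈ tangentConeAt ℝ M u.1, inner ℝ u.2 v = 0}

end

/-! On each normal circle `cos t • f p + sin t • ν p` put `F = cos (4 * (t - θ))`, and extend `F`
homogeneously of degree four. The main fact is Münzner's theorem (`IsIsoparametric.exists_quartic`):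
all these functions come from one quartic form. It is carried by a symmetric trilinear map `Θ` for
which `Θ x x x` is the gradient of `F`, and it satisfies the eikonal identity `|Θ x x x|² = 16
|x|⁶`. At a point `x` of `M` the gradient is `4x`; the operator `Θ x x` is `4/3` on tangent vectors
and `-4` on normal ones.

Given such a form, the exchange of `x` and `n` is algebra. The eikonal identity at `x + n` and `x -
n`, with equality forced in two Cauchy-Schwarz estimates, gives `Θ n n n = 4n` and `Θ n n x = -4x`
(`swap_of_eikonal`). Once `n ∈ M` is known, `x` is normal to `M` at `n`, because tangent vectors
there belong to the different eigenvalue `4/3`.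

That `n ∈ M` is geometric. Every unit normal vector of a focal submanifold is the velocity of a
normal geodesic of the hypersurface (`exists_normalVelocity_eq`), by an open-closed argument on the
unit sphere of the normal space. Follow the geodesic from `x` in the direction `n`: after `π/4` it
meets the other focal submanifold, whose quartic is `-Θ`. The reversed velocity there is again a
unit normal, so it too comes from a point of the hypersurface. This shows that the point after
another `π/4`, which is `n`, lies in `M`.

Münzner's theorem needs the Laplacian of `F` to be a constant times `r²`. This rests on the angles
being spaced by `π/4` and on opposite multiplicities being equal, both consequences of
`focal_symmetry`: the shape operators of `M` are linear in the normal vector and locally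
isospectral, hence by analytic continuation along a half circle the spectrum is symmetric.
Subtracting a multiple of `r⁴` makes `F` harmonic, and iterating Bochner's formula on `|∇G|² = α r⁶
+ β r² G` kills all fifth derivatives (`fifth_partialDeriv_eq_zero`). -/

noncomputable section

set_option linter.unusedSectionVars false

/-! ### Spectral projections as polynomials in the operator -/

section EigenProjections

variable {E : Type*} [NormedAddCommGroup E] [NormedSpace ℝ E]

/-- The Lagrange projection of `A` onto its `κ`-eigenspace, relative to the set `K` of nodes. -/
def eigenProj (K : Finset ℝ) (A : E →L[ℝ] E) (κ : ℝ) : E →L[ℝ] E :=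
  Polynomial.aeval A (Lagrange.basis K id κ)

/-- The multiplicity of `κ` as an eigenvalue of `A`, as the trace of the eigenprojection. -/
def eigenMult (K : Finset ℝ) (A : E →L[ℝ] E) (κ : ℝ) : ℝ :=
  LinearMap.trace ℝ E (eigenProj K A κ : E →ₗ[ℝ] E)

theorem aeval_apply_of_eigenvector {A : E →L[ℝ] E} {κ : ℝ} {v : E} (hv : A v = κ • v)
    (p : Polynomial ℝ) : (Polynomial.aeval A p) v = p.eval κ • v := by
  induction p using Polynomial.induction_on with
  | C a => simp [Algebra.algebraMap_eq_smul_one]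
  | add p q hp hq => simp [hp, hq, add_smul]
  | monomial n a h =>
    have h' : (Polynomial.aeval A (Polynomial.C a * Polynomial.X ^ n)) v
        = (a * κ ^ n) • v := by simpa using h
    have e : (Polynomial.C a * Polynomial.X ^ (n + 1) : Polynomial ℝ)
        = (Polynomial.C a * Polynomial.X ^ n) * Polynomial.X := by ring
    rw [e, map_mul, Polynomial.aeval_X, mul_apply_eq_comp, hv, map_smul, h', smul_smul]
    congr 1
    simp
    ring

theorem sum_eigenProj {K : Finset ℝ} (hK : K.Nonempty) (A : E →L[ℝ] E) :
    ∑ κ ∈ K, eigenProj K A κ = 1 := by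
  simp only [eigenProj]
  rw [← map_sum, Lagrange.sum_basis (Set.injOn_id _) hK, map_one]

theorem sum_eigenProj_apply {K : Finset ℝ} (hK : K.Nonempty) (A : E →L[ℝ] E) (v : E) :
    ∑ κ ∈ K, eigenProj K A κ v = v := by
  have := congrArg (fun B : E →L[ℝ] E => B v) (sum_eigenProj hK A)
  simpa using this

/-- The product of `X - κ` with the Lagrange basis polynomial at `κ` is a scalar multiple of the
nodal polynomial, which annihilates `A`. -/
theorem apply_eigenProj {K : Finset ℝ} {A : E →L[ℝ] E}
    (h : Polynomial.aeval A (Lagrange.nodal K id) = 0) {κ : ℝ} (hκ : κ ∈ K) (v : E) :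
    A (eigenProj K A κ v) = κ • eigenProj K A κ v := by
  have h1 : (Polynomial.X - Polynomial.C κ) * Lagrange.basis K id κ
      = Polynomial.C (Lagrange.nodalWeight K id κ) * Lagrange.nodal K id := by
    obtain ⟨q, hq⟩ := Lagrange.X_sub_C_dvd_nodal (R := ℝ) id hκ
    rw [Lagrange.basis_eq_prod_sub_inv_mul_nodal_div (F := ℝ) (s := K) (v := id) hκ, hq, id,
      mul_div_cancel_left₀ _ (Polynomial.X_sub_C_ne_zero κ)]
    ring
  have h2 := congrArg (fun p => (Polynomial.aeval A p) v) h1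
  simp only [map_mul, h, mul_zero, map_sub, Polynomial.aeval_X, Polynomial.aeval_C,
    mul_apply_eq_comp, sub_apply,
    Algebra.algebraMap_eq_smul_one, smul_apply,
    one_apply_eq_self, zero_apply] at h2
  exact sub_eq_zero.mp h2

theorem eigenProj_of_eigenvector {K : Finset ℝ} {A : E →L[ℝ] E} {κ : ℝ} (hκ : κ ∈ K) {v : E}
    (hv : A v = κ • v) : eigenProj K A κ v = v := by
  have h := Lagrange.eval_basis_self (F := ℝ) (s := K) (v := id) (i := κ) (Set.injOn_id _) hκ
  rw [id] at h
  rw [eigenProj, aeval_apply_of_eigenvector hv, h, one_smul]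

theorem eigenProj_of_eigenvector_ne {K : Finset ℝ} {A : E →L[ℝ] E} {κ μ : ℝ} (hκ : κ ∈ K)
    (hne : μ ≠ κ) {v : E} (hv : A v = κ • v) : eigenProj K A μ v = 0 := by
  have h := Lagrange.eval_basis_of_ne (F := ℝ) (s := K) (v := id) hne hκ
  rw [id] at h
  rw [eigenProj, aeval_apply_of_eigenvector hv, h, zero_smul]

/-- The trace of a projection is its rank, so this real number is an integer. -/
theorem eigenMult_eq_finrank [FiniteDimensional ℝ E] {K : Finset ℝ} {A : E →L[ℝ] E}
    (h : Polynomial.aeval A (Lagrange.nodal K id) = 0) {κ : ℝ} (hκ : κ ∈ K) :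
    eigenMult K A κ =
      Module.finrank ℝ (LinearMap.ker ((A : E →ₗ[ℝ] E) - κ • LinearMap.id)) := by
  rw [eigenMult]
  apply LinearMap.IsProj.trace
  constructor
  · intro v
    simp [apply_eigenProj h hκ]
  · intro v hv
    apply eigenProj_of_eigenvector hκ
    simpa [sub_eq_zero] using hv

/-- The nodes do not move, so the projection is a fixed polynomial in `A`. Together with
integrality, continuity makes multiplicities locally constant. -/
theorem continuous_eigenMult [FiniteDimensional ℝ E] (K : Finset ℝ) (κ : ℝ) :
    Continuous fun A : E →L[ℝ] E => eigenMult K A κ := by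
  have h1 : Continuous fun A : E →L[ℝ] E => eigenProj K A κ :=
    Polynomial.continuous_aeval _
  let l : (E →L[ℝ] E) →ₗ[ℝ] ℝ :=
    (LinearMap.trace ℝ E).comp (ContinuousLinearMap.coeLM (S := ℝ) (R := ℝ) (M := E) (N₃ := E))
  have h2 : Continuous l := LinearMap.continuous_of_finiteDimensional l
  exact h2.comp h1

/-- The trace of `∑ x κ • eigenProj κ`. -/
theorem trace_sum_smul_eigenProj (K : Finset ℝ) (A : E →L[ℝ] E) (x : ℝ → ℝ) :
    LinearMap.trace ℝ E ((∑ κ ∈ K, x κ • eigenProj K A κ : E →L[ℝ] E) : E →ₗ[ℝ] E)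
      = ∑ κ ∈ K, x κ * eigenMult K A κ := by
  have : ((∑ κ ∈ K, x κ • eigenProj K A κ : E →L[ℝ] E) : E →ₗ[ℝ] E)
      = ∑ κ ∈ K, x κ • (eigenProj K A κ : E →ₗ[ℝ] E) := by
    ext v; simp
  rw [this, map_sum]
  simp [eigenMult]

end EigenProjections

/-! ### Shape operator and spectral theory on a parametrized patch -/

section Patches

variable {E V : Type*} [NormedAddCommGroup E] [InnerProductSpace ℝ E] [FiniteDimensional ℝ E]
  [NormedAddCommGroup V] [InnerProductSpace ℝ V] [FiniteDimensional ℝ V]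

/-- A parametrized piece of an isoparametric hypersurface of the unit sphere of `V`: the immersion
`f` with unit normal `ν` is defined on the open subset `O` of `E`. -/
structure IsoparametricPatch (O : Set E) (f ν : E → V) (K : Finset ℝ) : Prop where
  finrank_eq : Module.finrank ℝ V = Module.finrank ℝ E + 2
  isOpen : IsOpen O
  smooth : ContDiffOn ℝ ∞ f O
  smooth_normal : ContDiffOn ℝ ∞ ν O
  immersion : ∀ u ∈ O, Function.Injective (fderiv ℝ f u)
  norm_eq_one : ∀ u ∈ O, ‖f u‖ = 1
  norm_normal : ∀ u ∈ O, ‖ν u‖ = 1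
  normal_perp_position : ∀ u ∈ O, inner ℝ (ν u) (f u) = 0
  normal_perp_tangent : ∀ u ∈ O, ∀ v, inner ℝ (ν u) (fderiv ℝ f u v) = 0
  curvatures : ∀ u ∈ O, ∀ κ : ℝ,
    (∃ v, v ≠ 0 ∧ fderiv ℝ ν u v = -(κ • fderiv ℝ f u v)) ↔ κ ∈ K
  nonempty : K.Nonempty

theorem isSymmSndFDerivAt_of_smooth {E V : Type*} [NormedAddCommGroup E] [NormedSpace ℝ E]
    [NormedAddCommGroup V] [NormedSpace ℝ V] {f : E → V} {u : E} (h : ContDiffAt ℝ ∞ f u) :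
    IsSymmSndFDerivAt ℝ f u := by
  apply h.isSymmSndFDerivAt
  rw [minSmoothness_of_isRCLikeNormedField]
  exact WithTop.coe_le_coe.mpr (le_top : (2 : ℕ∞) ≤ ⊤)

/-- The pseudoinverse `(B†B)⁻¹B†` of `B`. -/
def leftPseudoinverse (B : E →L[ℝ] V) : V →L[ℝ] E :=
  (Ring.inverse (B.adjoint.comp B)).comp B.adjoint

theorem isUnit_adjoint_comp_self {B : E →L[ℝ] V} (hB : Function.Injective B) :
    IsUnit (B.adjoint.comp B) := by
  have hinj : Function.Injective (B.adjoint.comp B) := by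
    rw [injective_iff_map_eq_zero]
    intro v hv
    have h : inner ℝ (B v) (B v) = 0 := by
      rw [← ContinuousLinearMap.adjoint_inner_left]
      have : B.adjoint (B v) = 0 := hv
      rw [this, inner_zero_left]
    exact (injective_iff_map_eq_zero B).mp hB v (inner_self_eq_zero.mp h)
  have hk : LinearMap.ker ((B.adjoint.comp B : E →L[ℝ] E) : E →ₗ[ℝ] E) = ⊥ :=
    LinearMap.ker_eq_bot.mpr hinj
  have hr : LinearMap.range ((B.adjoint.comp B : E →L[ℝ] E) : E →ₗ[ℝ] E) = ⊤ :=
    LinearMap.range_eq_top.mpr (LinearMap.injective_iff_surjective.mp hinj)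
  let e := ContinuousLinearEquiv.ofBijective (B.adjoint.comp B) hk hr
  refine ⟨⟨e, e.symm, ?_, ?_⟩, ?_⟩
  · ext v; exact e.apply_symm_apply v
  · ext v; exact e.symm_apply_apply v
  · ext v; rfl

theorem leftPseudoinverse_apply {B : E →L[ℝ] V} (hB : Function.Injective B) (v : E) :
    leftPseudoinverse B (B v) = v := by
  have := Ring.inverse_mul_cancel _ (isUnit_adjoint_comp_self hB)
  exact congrArg (fun C : E →L[ℝ] E => C v) this

theorem leftPseudoinverse_eq_zero {B : E →L[ℝ] V} {y : V} (hy : ∀ v, inner ℝ y (B v) = 0) :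
    leftPseudoinverse B y = 0 := by
  have : B.adjoint y = 0 := by
    apply ext_inner_right ℝ
    intro v
    rw [ContinuousLinearMap.adjoint_inner_left, hy, inner_zero_left]
  simp [leftPseudoinverse, this]

theorem continuousAt_leftPseudoinverse {T : Type*} [TopologicalSpace T] {B : T → E →L[ℝ] V} {t : T}
    (hB : ContinuousAt B t) (h : Function.Injective (B t)) :
    ContinuousAt (fun s => leftPseudoinverse (B s)) t := by
  have h1 : ContinuousAt (fun s => (B s).adjoint) t :=
    (ContinuousLinearMap.adjoint (𝕜 := ℝ) (E := E) (F := V)).continuous.continuousAt.comp hB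
  have h2 : ContinuousAt (fun s => (B s).adjoint.comp (B s)) t := h1.clm_comp hB
  obtain ⟨w, hw⟩ := isUnit_adjoint_comp_self h
  have h3 : ContinuousAt (Ring.inverse (M₀ := E →L[ℝ] E)) ((B t).adjoint.comp (B t)) := by
    rw [← hw]; exact NormedRing.inverse_continuousAt w
  exact (h3.comp (f := fun s => (B s).adjoint.comp (B s)) h2).clm_comp h1

/-- The shape operator in the parameter domain. -/
def shapeOperator (f ν : E → V) (u : E) : E →L[ℝ] E :=
  -((leftPseudoinverse (fderiv ℝ f u)).comp (fderiv ℝ ν u))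

namespace IsoparametricPatch

variable {O : Set E} {f ν : E → V} {K : Finset ℝ} (h : IsoparametricPatch O f ν K) {u : E}
include h

theorem mem_nhds (hu : u ∈ O) : O ∈ nhds u := h.isOpen.mem_nhds hu

theorem contDiffAt (hu : u ∈ O) : ContDiffAt ℝ ∞ f u := h.smooth.contDiffAt (h.mem_nhds hu)

theorem contDiffAt_normal (hu : u ∈ O) : ContDiffAt ℝ ∞ ν u :=
  h.smooth_normal.contDiffAt (h.mem_nhds hu)

theorem hasFDerivAt (hu : u ∈ O) : HasFDerivAt f (fderiv ℝ f u) u :=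
  ((h.contDiffAt hu).differentiableAt (by simp)).hasFDerivAt

theorem hasFDerivAt_normal (hu : u ∈ O) : HasFDerivAt ν (fderiv ℝ ν u) u :=
  ((h.contDiffAt_normal hu).differentiableAt (by simp)).hasFDerivAt

theorem inner_self (hu : u ∈ O) : inner ℝ (f u) (f u) = 1 := by
  rw [real_inner_self_eq_norm_sq, h.norm_eq_one u hu]; norm_num

theorem inner_normal_self (hu : u ∈ O) : inner ℝ (ν u) (ν u) = 1 := by
  rw [real_inner_self_eq_norm_sq, h.norm_normal u hu]; norm_num

theorem inner_position_fderiv (hu : u ∈ O) (v : E) : inner ℝ (f u) (fderiv ℝ f u v) = 0 := by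
  have h1 := (h.hasFDerivAt hu).inner ℝ (h.hasFDerivAt hu)
  have h2 : (fun t => inner ℝ (f t) (f t)) =ᶠ[nhds u] fun _ => (1 : ℝ) :=
    Filter.eventually_of_mem (h.mem_nhds hu) fun t ht => h.inner_self ht
  have h3 := h1.unique ((hasFDerivAt_const (1 : ℝ) u).congr_of_eventuallyEq h2)
  have h4 := congrArg (fun B : E →L[ℝ] ℝ => B v) h3
  simp [real_inner_comm] at h4
  linarith [real_inner_comm (f u) (fderiv ℝ f u v)]

theorem inner_normal_fderiv_normal (hu : u ∈ O) (v : E) :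
    inner ℝ (ν u) (fderiv ℝ ν u v) = 0 := by
  have h1 := (h.hasFDerivAt_normal hu).inner ℝ (h.hasFDerivAt_normal hu)
  have h2 : (fun t => inner ℝ (ν t) (ν t)) =ᶠ[nhds u] fun _ => (1 : ℝ) :=
    Filter.eventually_of_mem (h.mem_nhds hu) fun t ht => h.inner_normal_self ht
  have h3 := h1.unique ((hasFDerivAt_const (1 : ℝ) u).congr_of_eventuallyEq h2)
  have h4 := congrArg (fun B : E →L[ℝ] ℝ => B v) h3
  simp [real_inner_comm] at h4
  linarith [real_inner_comm (ν u) (fderiv ℝ ν u v)]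

theorem inner_position_fderiv_normal (hu : u ∈ O) (v : E) :
    inner ℝ (f u) (fderiv ℝ ν u v) = 0 := by
  have h1 := (h.hasFDerivAt_normal hu).inner ℝ (h.hasFDerivAt hu)
  have h2 : (fun t => inner ℝ (ν t) (f t)) =ᶠ[nhds u] fun _ => (0 : ℝ) :=
    Filter.eventually_of_mem (h.mem_nhds hu) fun t ht => h.normal_perp_position t ht
  have h3 := h1.unique ((hasFDerivAt_const (0 : ℝ) u).congr_of_eventuallyEq h2)
  have h4 := congrArg (fun B : E →L[ℝ] ℝ => B v) h3
  simp [h.normal_perp_tangent u hu v] at h4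
  rw [real_inner_comm]; exact h4

/-- The moving frame `(v, a, b) ↦ df v + a f + b ν`. -/
theorem exists_frame_decomposition (hu : u ∈ O) (y : V) :
    ∃ (v : E) (a b : ℝ), y = fderiv ℝ f u v + a • f u + b • ν u := by
  let L : (E × ℝ × ℝ) →ₗ[ℝ] V :=
    (fderiv ℝ f u : E →ₗ[ℝ] V).coprod
      ((LinearMap.toSpanSingleton ℝ V (f u)).coprod (LinearMap.toSpanSingleton ℝ V (ν u)))
  have hL : ∀ x, L x = fderiv ℝ f u x.1 + (x.2.1 • f u + x.2.2 • ν u) := fun x => by simp [L]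
  have hinj : Function.Injective L := by
    rw [injective_iff_map_eq_zero]
    rintro ⟨v, a, b⟩ hx
    rw [hL] at hx
    simp only at hx
    have h1 := congrArg (fun z => inner ℝ (f u) z) hx
    have h2 := congrArg (fun z => inner ℝ (ν u) z) hx
    have h3 : inner ℝ (f u) (ν u) = 0 := by
      rw [real_inner_comm]; exact h.normal_perp_position u hu
    simp only [inner_add_right, inner_smul_right, h.inner_position_fderiv hu, h.inner_self hu, h3,
      h.normal_perp_tangent u hu, h.normal_perp_position u hu, h.inner_normal_self hu,
      inner_zero_right] at h1 h2
    have ha : a = 0 := by linarith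
    have hb : b = 0 := by linarith
    subst ha hb
    have h5 : fderiv ℝ f u v = 0 := by simpa using hx
    have := (injective_iff_map_eq_zero _).mp (h.immersion u hu) v h5
    simp [this]
  -- The codimension is exactly two, so the injective frame map is also surjective.
  have hfr : Module.finrank ℝ (E × ℝ × ℝ) = Module.finrank ℝ V := by
    rw [h.finrank_eq]; simp
  obtain ⟨⟨v, a, b⟩, hx⟩ :=
    (LinearMap.injective_iff_surjective_of_finrank_eq_finrank hfr).mp hinj y
  exact ⟨v, a, b, by rw [← hx, hL]; simp [add_assoc]⟩

theorem exists_fderiv_eq (hu : u ∈ O) {y : V} (h1 : inner ℝ (f u) y = 0)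
    (h2 : inner ℝ (ν u) y = 0) : ∃ v, y = fderiv ℝ f u v := by
  obtain ⟨v, a, b, hy⟩ := h.exists_frame_decomposition hu y
  have h3 : inner ℝ (f u) (ν u) = 0 := by
    rw [real_inner_comm]; exact h.normal_perp_position u hu
  rw [hy] at h1 h2
  simp only [inner_add_right, inner_smul_right, h.inner_position_fderiv hu, h.inner_self hu, h3,
    h.normal_perp_tangent u hu, h.normal_perp_position u hu, h.inner_normal_self hu] at h1 h2
  have ha : a = 0 := by linarith
  have hb : b = 0 := by linarith
  exact ⟨v, by rw [hy, ha, hb]; simp⟩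

theorem exists_eq_of_perp_tangent (hu : u ∈ O) {y : V}
    (hy : ∀ v, inner ℝ y (fderiv ℝ f u v) = 0) : ∃ a b : ℝ, y = a • f u + b • ν u := by
  obtain ⟨v, a, b, hy'⟩ := h.exists_frame_decomposition hu y
  have h1 := hy v
  rw [hy'] at h1
  simp only [inner_add_left, inner_smul_left, h.inner_position_fderiv hu,
    h.normal_perp_tangent u hu] at h1
  have : fderiv ℝ f u v = 0 := by
    apply (inner_self_eq_zero (𝕜 := ℝ)).mp; simpa using h1
  exact ⟨a, b, by rw [hy', this, zero_add]⟩

/-- The vector `dν v` is orthogonal to both `f` and `ν`, hence tangent, so the pseudoinverse loses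
nothing. -/
theorem fderiv_shapeOperator (hu : u ∈ O) (v : E) :
    fderiv ℝ f u (shapeOperator f ν u v) = -fderiv ℝ ν u v := by
  obtain ⟨w, hw⟩ := h.exists_fderiv_eq hu (h.inner_position_fderiv_normal hu v)
    (h.inner_normal_fderiv_normal hu v)
  simp [shapeOperator, hw, leftPseudoinverse_apply (h.immersion u hu)]

theorem continuousAt_fderiv (hu : u ∈ O) : ContinuousAt (fderiv ℝ f) u :=
  ((h.contDiffAt hu).fderiv_right (m := ∞) (by simp)).continuousAt

theorem continuousAt_fderiv_normal (hu : u ∈ O) : ContinuousAt (fderiv ℝ ν) u :=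
  ((h.contDiffAt_normal hu).fderiv_right (m := ∞) (by simp)).continuousAt

theorem continuousAt_shapeOperator (hu : u ∈ O) : ContinuousAt (shapeOperator f ν) u :=
  ((continuousAt_leftPseudoinverse (h.continuousAt_fderiv hu) (h.immersion u hu)).clm_comp
    (h.continuousAt_fderiv_normal hu)).neg

/-- Differentiating `⟪ν, df w⟫ = 0` turns either side into minus the second fundamental form, which
inherits the symmetry of the second derivative of `f`. -/
theorem inner_fderiv_normal_comm (hu : u ∈ O) (v w : E) :
    inner ℝ (fderiv ℝ ν u v) (fderiv ℝ f u w) = inner ℝ (fderiv ℝ ν u w) (fderiv ℝ f u v) := by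
  have key : ∀ v w, inner ℝ (fderiv ℝ ν u v) (fderiv ℝ f u w)
      = - inner ℝ (ν u) (fderiv ℝ (fderiv ℝ f) u v w) := by
    intro v w
    have hd : HasFDerivAt (fderiv ℝ f) (fderiv ℝ (fderiv ℝ f) u) u :=
      (((h.contDiffAt hu).fderiv_right (m := ∞) (by simp)).differentiableAt (by simp)).hasFDerivAt
    have hd' := hd.clm_apply (hasFDerivAt_const w u)
    have h1 := (h.hasFDerivAt_normal hu).inner ℝ hd'
    have h2 : (fun t => inner ℝ (ν t) (fderiv ℝ f t w)) =ᶠ[nhds u] fun _ => (0 : ℝ) :=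
      Filter.eventually_of_mem (h.mem_nhds hu) fun t ht => h.normal_perp_tangent t ht w
    have h3 := h1.unique ((hasFDerivAt_const (0 : ℝ) u).congr_of_eventuallyEq h2)
    have h4 := congrArg (fun B : E →L[ℝ] ℝ => B v) h3
    simp at h4
    linarith
  rw [key, key, (isSymmSndFDerivAt_of_smooth (h.contDiffAt hu)).eq v w]

theorem inner_fderiv_shapeOperator_comm (hu : u ∈ O) (v w : E) :
    inner ℝ (fderiv ℝ f u (shapeOperator f ν u v)) (fderiv ℝ f u w)
      = inner ℝ (fderiv ℝ f u v) (fderiv ℝ f u (shapeOperator f ν u w)) := by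
  rw [h.fderiv_shapeOperator hu, h.fderiv_shapeOperator hu, inner_neg_left, inner_neg_right,
    h.inner_fderiv_normal_comm hu, real_inner_comm]

theorem eigenvalue_mem (hu : u ∈ O) {κ : ℝ} {v : E} (hv : v ≠ 0)
    (hA : shapeOperator f ν u v = κ • v) : κ ∈ K := by
  rw [← h.curvatures u hu]
  refine ⟨v, hv, ?_⟩
  rw [← map_smul, ← hA, h.fderiv_shapeOperator hu, neg_neg]

theorem exists_eigenvector (hu : u ∈ O) {κ : ℝ} (hκ : κ ∈ K) :
    ∃ v, v ≠ 0 ∧ shapeOperator f ν u v = κ • v := by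
  obtain ⟨v, hv, h1⟩ := (h.curvatures u hu κ).mpr hκ
  refine ⟨v, hv, h.immersion u hu ?_⟩
  rw [h.fderiv_shapeOperator hu, h1, map_smul, neg_neg]

/-- The shape operator is diagonalizable. -/
theorem aeval_shapeOperator (hu : u ∈ O) :
    Polynomial.aeval (shapeOperator f ν u) (Lagrange.nodal K id) = 0 := by
  set A := shapeOperator f ν u with hA
  set B := fderiv ℝ f u with hB
  set ρ := leftPseudoinverse B with hρ
  have hρB : ∀ v, ρ (B v) = v := leftPseudoinverse_apply (h.immersion u hu)
  -- The operator `A` is self-adjoint for the metric induced by `f`, not for the given inner product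
  -- of `E`. Transported to `V` and extended by zero on the normal plane it is symmetric there, so
  -- the spectral theorem applies. The map `ρ` brings its eigenvectors back to eigenvectors of `A`
  -- or to zero.
  let S : V →L[ℝ] V := (B.comp A).comp ρ
  have hdec : ∀ y : V, ∃ v z, y = B v + z ∧ ρ y = v ∧ ∀ w, inner ℝ z (B w) = 0 := by
    intro y
    obtain ⟨v, a, b, hy⟩ := h.exists_frame_decomposition hu y
    have hz : ∀ w, inner ℝ (a • f u + b • ν u) (B w) = 0 := by
      intro w
      simp [inner_add_left, inner_smul_left, hB, h.inner_position_fderiv hu,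
        h.normal_perp_tangent u hu]
    refine ⟨v, a • f u + b • ν u, by rw [hy, add_assoc], ?_, hz⟩
    rw [hy, add_assoc, map_add, hρ, leftPseudoinverse_eq_zero hz, ← hρ, hρB, add_zero]
  have hS : (S : V →ₗ[ℝ] V).IsSymmetric := by
    intro x y
    obtain ⟨v, z, hx, hxv, hz⟩ := hdec x
    obtain ⟨w, z', hy, hyw, hz'⟩ := hdec y
    have e1 : (S : V →ₗ[ℝ] V) x = B (A v) := by simp [S, hxv]
    have e2 : (S : V →ₗ[ℝ] V) y = B (A w) := by simp [S, hyw]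
    rw [e1, e2, hx, hy, inner_add_left, inner_add_right, hz, real_inner_comm z' (B (A v)), hz',
      add_zero, add_zero]
    exact h.inner_fderiv_shapeOperator_comm hu v w
  have htop : (⨆ μ, Module.End.eigenspace (S : V →ₗ[ℝ] V) μ) = ⊤ :=
    Submodule.orthogonal_eq_bot_iff.mp hS.orthogonalComplement_iSup_eigenspaces_eq_bot
  have key : ∀ y : V, Polynomial.aeval A (Lagrange.nodal K id) (ρ y) = 0 := by
    intro y
    have hy : y ∈ ⨆ μ, Module.End.eigenspace (S : V →ₗ[ℝ] V) μ := by rw [htop]; trivial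
    refine Submodule.iSup_induction _
      (motive := fun y => Polynomial.aeval A (Lagrange.nodal K id) (ρ y) = 0) hy ?_ ?_ ?_
    · intro μ x hx
      have hx' : S x = μ • x := Module.End.mem_eigenspace_iff.mp hx
      have hAx : A (ρ x) = μ • ρ x := by
        rw [← map_smul, ← hx']; simp [S, hρB]
      by_cases h0 : ρ x = 0
      · rw [h0, map_zero]
      · have hμ := h.eigenvalue_mem hu h0 hAx
        rw [aeval_apply_of_eigenvector hAx]
        have := Lagrange.eval_nodal_at_node (R := ℝ) (v := id) hμ
        rw [id] at this
        rw [this, zero_smul]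
    · simp
    · intro x y hx hy
      rw [map_add, map_add, hx, hy, add_zero]
  ext v
  rw [← hρB v, key]; rfl

theorem shapeOperator_eigenProj (hu : u ∈ O) {κ : ℝ} (hκ : κ ∈ K) (v : E) :
    shapeOperator f ν u (eigenProj K (shapeOperator f ν u) κ v)
      = κ • eigenProj K (shapeOperator f ν u) κ v :=
  apply_eigenProj (h.aeval_shapeOperator hu) hκ v

theorem fderiv_normal_eigenvector (hu : u ∈ O) {κ : ℝ} {v : E}
    (hv : shapeOperator f ν u v = κ • v) : fderiv ℝ ν u v = -(κ • fderiv ℝ f u v) := by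
  rw [← map_smul, ← hv, h.fderiv_shapeOperator hu, neg_neg]

theorem inner_eigenvectors (hu : u ∈ O) {κ μ : ℝ} (hne : κ ≠ μ) {v w : E}
    (hv : shapeOperator f ν u v = κ • v) (hw : shapeOperator f ν u w = μ • w) :
    inner ℝ (fderiv ℝ f u v) (fderiv ℝ f u w) = 0 := by
  have := h.inner_fderiv_shapeOperator_comm hu v w
  rw [hv, hw, map_smul, map_smul, inner_smul_left, inner_smul_right] at this
  have h2 : (κ - μ) * inner ℝ (fderiv ℝ f u v) (fderiv ℝ f u w) = 0 := by
    simp only [conj_trivial] at this; linarith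
  exact (mul_eq_zero.mp h2).resolve_left (sub_ne_zero.mpr hne)

/-- Multiplicities are locally constant. -/
theorem eventually_eigenMult_eq (hu : u ∈ O) {κ : ℝ} (hκ : κ ∈ K) :
    ∀ᶠ t in nhds u, eigenMult K (shapeOperator f ν t) κ = eigenMult K (shapeOperator f ν u) κ := by
  have hc : ContinuousAt (fun t => eigenMult K (shapeOperator f ν t) κ) u :=
    (continuous_eigenMult K κ).continuousAt.comp (h.continuousAt_shapeOperator hu)
  have h1 := hc.eventually (Metric.ball_mem_nhds _ one_pos)
  filter_upwards [h1, h.mem_nhds hu] with t ht htO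
  rw [eigenMult_eq_finrank (h.aeval_shapeOperator htO) hκ,
    eigenMult_eq_finrank (h.aeval_shapeOperator hu) hκ] at *
  -- Both multiplicities are now natural numbers at distance less than one.
  rw [Real.dist_eq, abs_lt] at ht
  obtain ⟨h2, h3⟩ := ht
  generalize Module.finrank ℝ (LinearMap.ker ((shapeOperator f ν t : E →ₗ[ℝ] E) -
    κ • LinearMap.id)) = a at *
  generalize Module.finrank ℝ (LinearMap.ker ((shapeOperator f ν u : E →ₗ[ℝ] E) -
    κ • LinearMap.id)) = b at *
  have h4 : a < b + 1 := by exact_mod_cast (by linarith : (a : ℝ) < b + 1)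
  have h5 : b < a + 1 := by exact_mod_cast (by linarith : (b : ℝ) < a + 1)
  norm_cast
  omega

end IsoparametricPatch

end Patches

/-! ### Great circles normal to the hypersurface -/

section NormalGeodesics

variable {X V : Type*} [AddCommGroup V] [Module ℝ V]

/-- The great circle through `f p` in the normal direction `ν p`. -/
def normalGeodesic (f ν : X → V) (t : ℝ) (p : X) : V := Real.cos t • f p + Real.sin t • ν p

/-- The velocity of `normalGeodesic`. -/
def normalVelocity (f ν : X → V) (t : ℝ) (p : X) : V := -(Real.sin t • f p) + Real.cos t • ν p

theorem position_eq (f ν : X → V) (t : ℝ) (p : X) :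
    f p = Real.cos t • normalGeodesic f ν t p - Real.sin t • normalVelocity f ν t p := by
  have := Real.sin_sq_add_cos_sq t
  simp only [normalGeodesic, normalVelocity]
  match_scalars
  · linear_combination -this
  · ring

theorem normal_eq (f ν : X → V) (t : ℝ) (p : X) :
    ν p = Real.sin t • normalGeodesic f ν t p + Real.cos t • normalVelocity f ν t p := by
  have := Real.sin_sq_add_cos_sq t
  simp only [normalGeodesic, normalVelocity]
  match_scalars
  · linear_combination -this
  · ring

end NormalGeodesics

/-! ### Differential and normal space of the focal map -/

section Patches

variable {E V : Type*} [NormedAddCommGroup E] [InnerProductSpace ℝ E] [FiniteDimensional ℝ E]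
  [NormedAddCommGroup V] [InnerProductSpace ℝ V] [FiniteDimensional ℝ V]

theorem inner_normalGeodesic_self {X : Type*} {f ν : X → V} {p : X} (hf : inner ℝ (f p) (f p) = 1)
    (hν : inner ℝ (ν p) (ν p) = 1) (hfν : inner ℝ (ν p) (f p) = 0) (t : ℝ) :
    inner ℝ (normalGeodesic f ν t p) (normalGeodesic f ν t p) = 1 := by
  have hfν' : inner ℝ (f p) (ν p) = 0 := by rw [real_inner_comm]; exact hfν
  simp only [normalGeodesic, inner_add_left, inner_add_right, inner_smul_left, inner_smul_right,
    hf, hν, hfν, hfν', conj_trivial]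
  linarith [Real.sin_sq_add_cos_sq t]

theorem inner_normalVelocity_self {X : Type*} {f ν : X → V} {p : X} (hf : inner ℝ (f p) (f p) = 1)
    (hν : inner ℝ (ν p) (ν p) = 1) (hfν : inner ℝ (ν p) (f p) = 0) (t : ℝ) :
    inner ℝ (normalVelocity f ν t p) (normalVelocity f ν t p) = 1 := by
  have hfν' : inner ℝ (f p) (ν p) = 0 := by rw [real_inner_comm]; exact hfν
  simp only [normalVelocity, inner_add_left, inner_add_right, inner_smul_left, inner_smul_right,
    hf, hν, hfν, hfν', conj_trivial, inner_neg_left, inner_neg_right]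
  linarith [Real.sin_sq_add_cos_sq t]

theorem inner_normalVelocity_normalGeodesic {X : Type*} {f ν : X → V} {p : X}
    (hf : inner ℝ (f p) (f p) = 1)
    (hν : inner ℝ (ν p) (ν p) = 1) (hfν : inner ℝ (ν p) (f p) = 0) (t : ℝ) :
    inner ℝ (normalVelocity f ν t p) (normalGeodesic f ν t p) = 0 := by
  have hfν' : inner ℝ (f p) (ν p) = 0 := by rw [real_inner_comm]; exact hfν
  simp only [normalVelocity, normalGeodesic, inner_add_left, inner_add_right, inner_smul_left,
    inner_smul_right, hf, hν, hfν, hfν', conj_trivial, inner_neg_left]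
  ring

namespace IsoparametricPatch

variable {O : Set E} {f ν : E → V} {K : Finset ℝ} (h : IsoparametricPatch O f ν K) {u : E}
include h

theorem contDiffAt_normalGeodesic (hu : u ∈ O) (t : ℝ) :
    ContDiffAt ℝ ∞ (normalGeodesic f ν t) u :=
  ((h.contDiffAt hu).const_smul _).add ((h.contDiffAt_normal hu).const_smul _)

theorem contDiffAt_normalVelocity (hu : u ∈ O) (t : ℝ) :
    ContDiffAt ℝ ∞ (normalVelocity f ν t) u :=
  ((h.contDiffAt hu).const_smul _).neg.add ((h.contDiffAt_normal hu).const_smul _)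

theorem fderiv_normalGeodesic (hu : u ∈ O) (t : ℝ) (v : E) :
    fderiv ℝ (normalGeodesic f ν t) u v
      = fderiv ℝ f u (Real.cos t • v - Real.sin t • shapeOperator f ν u v) := by
  have := ((h.hasFDerivAt hu).const_smul (Real.cos t)).add
    ((h.hasFDerivAt_normal hu).const_smul (Real.sin t))
  have e : fderiv ℝ (normalGeodesic f ν t) u = _ := this.fderiv
  rw [e, map_sub, map_smul, map_smul, h.fderiv_shapeOperator hu]
  simp

theorem fderiv_normalVelocity (hu : u ∈ O) (t : ℝ) (v : E) :
    fderiv ℝ (normalVelocity f ν t) u v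
      = -fderiv ℝ f u (Real.sin t • v + Real.cos t • shapeOperator f ν u v) := by
  have := ((h.hasFDerivAt hu).const_smul (Real.sin t)).neg.add
    ((h.hasFDerivAt_normal hu).const_smul (Real.cos t))
  have e : fderiv ℝ (normalVelocity f ν t) u = _ := this.fderiv
  rw [e, map_add, map_smul, map_smul, h.fderiv_shapeOperator hu]
  simp [add_comm]

/-- The factor `cos t - κ sin t` is the Jacobi field along the normal geodesic; it vanishes exactly
at the focal distances of `κ`. -/
theorem fderiv_normalGeodesic_eigenvector (hu : u ∈ O) (t : ℝ) {κ : ℝ} {v : E}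
    (hv : shapeOperator f ν u v = κ • v) :
    fderiv ℝ (normalGeodesic f ν t) u v
      = (Real.cos t - κ * Real.sin t) • fderiv ℝ f u v := by
  rw [h.fderiv_normalGeodesic hu, hv, ← map_smul]
  congr 1
  module

theorem fderiv_normalVelocity_eigenvector (hu : u ∈ O) (t : ℝ) {κ : ℝ} {v : E}
    (hv : shapeOperator f ν u v = κ • v) :
    fderiv ℝ (normalVelocity f ν t) u v
      = -((Real.sin t + κ * Real.cos t) • fderiv ℝ f u v) := by
  rw [h.fderiv_normalVelocity hu, hv, ← map_smul]
  congr 2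
  module

theorem inner_normalVelocity_fderiv (hu : u ∈ O) (t : ℝ) (v : E) :
    inner ℝ (normalVelocity f ν t u) (fderiv ℝ f u v) = 0 := by
  simp [normalVelocity, inner_add_left, inner_smul_left, h.inner_position_fderiv hu,
    h.normal_perp_tangent u hu]

theorem inner_normalGeodesic_fderiv (hu : u ∈ O) (t : ℝ) (v : E) :
    inner ℝ (normalGeodesic f ν t u) (fderiv ℝ f u v) = 0 := by
  simp [normalGeodesic, inner_add_left, inner_smul_left, h.inner_position_fderiv hu,
    h.normal_perp_tangent u hu]

theorem inner_normalGeodesic_self (hu : u ∈ O) (t : ℝ) :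
    inner ℝ (normalGeodesic f ν t u) (normalGeodesic f ν t u) = 1 :=
  _root_.inner_normalGeodesic_self (h.inner_self hu) (h.inner_normal_self hu)
    (h.normal_perp_position u hu) t

theorem inner_normalVelocity_self (hu : u ∈ O) (t : ℝ) :
    inner ℝ (normalVelocity f ν t u) (normalVelocity f ν t u) = 1 :=
  _root_.inner_normalVelocity_self (h.inner_self hu) (h.inner_normal_self hu)
    (h.normal_perp_position u hu) t

theorem inner_normalVelocity_normalGeodesic (hu : u ∈ O) (t : ℝ) :
    inner ℝ (normalVelocity f ν t u) (normalGeodesic f ν t u) = 0 :=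
  _root_.inner_normalVelocity_normalGeodesic (h.inner_self hu) (h.inner_normal_self hu)
    (h.normal_perp_position u hu) t

section Focal

variable {κ₀ θ : ℝ}

/-- At the focal distance the differential is `sin θ • df ∘ (κ₀ - A)`, and `df` is injective. -/
theorem focal_eigenvalue_iff (hu : u ∈ O) (hθ : Real.cos θ = κ₀ * Real.sin θ)
    (hs : Real.sin θ ≠ 0) (v : E) :
    fderiv ℝ (normalGeodesic f ν θ) u v = 0 ↔ shapeOperator f ν u v = κ₀ • v := by
  rw [h.fderiv_normalGeodesic hu, hθ]
  have e : (κ₀ * Real.sin θ) • v - Real.sin θ • shapeOperator f ν u v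
      = Real.sin θ • (κ₀ • v - shapeOperator f ν u v) := by module
  rw [e, map_smul, smul_eq_zero_iff_right hs,
    map_eq_zero_iff _ (h.immersion u hu), sub_eq_zero, eq_comm]

/-- Tangent vectors along the focal leaf are orthogonal to the focal submanifold. -/
theorem inner_leaf_focal (hu : u ∈ O) (hθ : Real.cos θ = κ₀ * Real.sin θ) {e : E}
    (he : shapeOperator f ν u e = κ₀ • e) (v : E) :
    inner ℝ (fderiv ℝ f u e) (fderiv ℝ (normalGeodesic f ν θ) u v) = 0 := by
  rw [h.fderiv_normalGeodesic hu, map_sub, map_smul, map_smul, inner_sub_right, inner_smul_right,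
    inner_smul_right, ← h.inner_fderiv_shapeOperator_comm hu, he, map_smul, inner_smul_left, hθ]
  simp only [conj_trivial]
  ring

/-- The normal space of the focal submanifold is spanned by the normal direction and the
tangent space of the leaf. -/
theorem exists_eq_of_perp_focal (hu : u ∈ O) (hκ : κ₀ ∈ K) (hθ : Real.cos θ = κ₀ * Real.sin θ)
    (hs : Real.sin θ ≠ 0) {y : V} (hy : inner ℝ y (normalGeodesic f ν θ u) = 0)
    (hy' : ∀ v, inner ℝ y (fderiv ℝ (normalGeodesic f ν θ) u v) = 0) :
    ∃ (ρ : ℝ) (e : E), shapeOperator f ν u e = κ₀ • e ∧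
      y = ρ • normalVelocity f ν θ u + fderiv ℝ f u e := by
  obtain ⟨v, a, b, hdec⟩ := h.exists_frame_decomposition hu y
  set A := shapeOperator f ν u with hA
  have hyf : ∀ w, inner ℝ y (fderiv ℝ f u w) = inner ℝ (fderiv ℝ f u v) (fderiv ℝ f u w) := by
    intro w
    rw [hdec]
    simp [inner_add_left, inner_smul_left, h.inner_position_fderiv hu, h.normal_perp_tangent u hu]
  -- Test `y` against the focal image of the `κ`-component of `v`. The focal map multiplies that
  -- component by a nonzero scalar, and the eigenspaces are orthogonal under `df`, so what remains
  -- is the square norm of the component.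
  have hz : ∀ κ ∈ K, κ ≠ κ₀ → eigenProj K A κ v = 0 := by
    intro κ hκK hne
    have hAv := h.shapeOperator_eigenProj hu hκK v
    have hne' : Real.cos θ - κ * Real.sin θ ≠ 0 := by
      rw [hθ, ← sub_mul]; exact mul_ne_zero (sub_ne_zero.mpr hne.symm) hs
    have h1 := hy' (eigenProj K A κ v)
    rw [h.fderiv_normalGeodesic_eigenvector hu θ hAv, inner_smul_right] at h1
    have h2 := (mul_eq_zero.mp h1).resolve_left hne'
    rw [hyf] at h2
    have h3 : inner ℝ (fderiv ℝ f u v) (fderiv ℝ f u (eigenProj K A κ v))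
        = inner ℝ (fderiv ℝ f u (eigenProj K A κ v)) (fderiv ℝ f u (eigenProj K A κ v)) := by
      conv_lhs => rw [← sum_eigenProj_apply h.nonempty A v]
      rw [map_sum, sum_inner, Finset.sum_eq_single κ]
      · rw [sum_eigenProj_apply h.nonempty A v]
      · intro μ hμ hμκ
        exact h.inner_eigenvectors hu hμκ (h.shapeOperator_eigenProj hu hμ _)
          (by rw [sum_eigenProj_apply h.nonempty A v]; exact hAv)
      · intro hn; exact absurd hκK hn
    rw [h3, inner_self_eq_zero] at h2
    exact (injective_iff_map_eq_zero _).mp (h.immersion u hu) _ h2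
  have hv : eigenProj K A κ₀ v = v := by
    have := sum_eigenProj_apply h.nonempty A v
    rw [Finset.sum_eq_single κ₀ (fun κ hκK hne => hz κ hκK hne) (fun hn => absurd hκ hn)] at this
    exact this
  have hAv : A v = κ₀ • v := by
    have := h.shapeOperator_eigenProj hu hκ v
    rwa [← hA, hv] at this
  have hab : a • f u + b • ν u
      = (a * Real.cos θ + b * Real.sin θ) • normalGeodesic f ν θ u
        + (b * Real.cos θ - a * Real.sin θ) • normalVelocity f ν θ u := by
    conv_lhs => rw [position_eq f ν θ u, normal_eq f ν θ u]
    module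
  have h0 : a * Real.cos θ + b * Real.sin θ = 0 := by
    rw [hdec, add_assoc, hab, inner_add_left, inner_add_left, inner_smul_left, inner_smul_left,
      h.inner_normalGeodesic_self hu, h.inner_normalVelocity_normalGeodesic hu,
      real_inner_comm, h.inner_normalGeodesic_fderiv hu] at hy
    simpa using hy
  refine ⟨b * Real.cos θ - a * Real.sin θ, v, hAv, ?_⟩
  rw [hdec, add_assoc, hab, h0, zero_smul, zero_add, add_comm]

end Focal

end IsoparametricPatch

end Patches

/-! ### Trace of an induced operator -/

section LinearAlgebra

/-- With a linear section `s` of `π` one has `T = π C s` and `C s π = C`, so this is cyclicity of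
the trace. -/
theorem trace_eq_of_semiconj {E R : Type*} [AddCommGroup E] [Module ℝ E] [FiniteDimensional ℝ E]
    [AddCommGroup R] [Module ℝ R] [FiniteDimensional ℝ R] {π : E →ₗ[ℝ] R}
    (hπ : Function.Surjective π) {T : R →ₗ[ℝ] R} {C : E →ₗ[ℝ] E} (hT : ∀ v, T (π v) = π (C v))
    (hC : ∀ v, π v = 0 → C v = 0) : LinearMap.trace ℝ R T = LinearMap.trace ℝ E C := by
  obtain ⟨s, hs⟩ := π.exists_rightInverse_of_surjective (LinearMap.range_eq_top.mpr hπ)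
  have hs' : ∀ r, π (s r) = r := fun r => congrArg (fun B : R →ₗ[ℝ] R => B r) hs
  have h1 : T = π ∘ₗ (C ∘ₗ s) := by
    ext r
    simp only [LinearMap.comp_apply]
    rw [← hT, hs']
  have h2 : (C ∘ₗ s) ∘ₗ π = C := by
    ext v
    have := hC (s (π v) - v) (by rw [map_sub, hs', sub_self])
    rw [map_sub] at this
    exact sub_eq_zero.mp this
  rw [h1, LinearMap.trace_comp_comm', h2]

end LinearAlgebra

/-! ### The constant rank theorem -/

section ConstantRank

variable {E V : Type*} [NormedAddCommGroup E] [InnerProductSpace ℝ E] [FiniteDimensional ℝ E]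
  [NormedAddCommGroup V] [InnerProductSpace ℝ V] [FiniteDimensional ℝ V]

/-- The constant rank theorem: near a point where the rank of `φ` is locally constant, there is a
parametrization `Ψ` in which `φ` depends on the first coordinate only. -/
theorem exists_constantRank_parametrization {φ : E → V} {u₀ : E} (hs : ∀ᶠ u in nhds u₀, ContDiffAt ℝ ∞ φ u)
    (hrank : ∀ᶠ u in nhds u₀, Module.finrank ℝ (LinearMap.range (fderiv ℝ φ u : E →ₗ[ℝ] V))
      = Module.finrank ℝ (LinearMap.range (fderiv ℝ φ u₀ : E →ₗ[ℝ] V)))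
    (R₀ : Submodule ℝ V) (hR₀ : R₀ = LinearMap.range (fderiv ℝ φ u₀ : E →ₗ[ℝ] V))
    (K₀ : Submodule ℝ E) (hK₀ : K₀ = LinearMap.ker (fderiv ℝ φ u₀ : E →ₗ[ℝ] V)) :
    ∃ (Ψ : R₀ × K₀ → E) (z₀ : R₀ × K₀), Ψ z₀ = u₀ ∧ ∀ᶠ z in nhds z₀,
      ContDiffAt ℝ ∞ Ψ z ∧ Function.Surjective (fderiv ℝ Ψ z) ∧
      (∀ᶠ z' in nhds z, R₀.orthogonalProjectionOnto (φ (Ψ z')) = z'.1) ∧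
      ∀ w, fderiv ℝ φ (Ψ z) (fderiv ℝ Ψ z (0, w)) = 0 := by
  have hφ := hs.self_of_nhds
  set pr := R₀.orthogonalProjectionOnto with hpr
  -- The first coordinate sees the range of the differential and the second its kernel. Hence `χ`
  -- has invertible derivative at `u₀`, and `Ψ` is its local inverse.
  let χ : E → R₀ × K₀ := fun u => (pr (φ u), K₀.orthogonalProjectionOnto u)
  have hχ : ∀ u, ContDiffAt ℝ ∞ φ u → ContDiffAt ℝ ∞ χ u := fun u hu =>
    (pr.contDiff.contDiffAt.comp u hu).prodMk
      K₀.orthogonalProjectionOnto.contDiff.contDiffAt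
  let χ' : E → (E →L[ℝ] R₀ × K₀) := fun u =>
    (pr.comp (fderiv ℝ φ u)).prod K₀.orthogonalProjectionOnto
  have hχ' : ∀ u, ContDiffAt ℝ ∞ φ u → HasFDerivAt χ (χ' u) u := fun u hu =>
    (pr.hasFDerivAt.comp u (hu.differentiableAt (by simp)).hasFDerivAt).prodMk
      K₀.orthogonalProjectionOnto.hasFDerivAt
  have hinj : Function.Injective (χ' u₀) := by
    rw [injective_iff_map_eq_zero]
    intro v hv
    have h1 : pr (fderiv ℝ φ u₀ v) = 0 := congrArg Prod.fst hv
    have h2 : K₀.orthogonalProjectionOnto v = 0 := congrArg Prod.snd hv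
    have h3 : fderiv ℝ φ u₀ v ∈ R₀ := by rw [hR₀]; exact ⟨v, rfl⟩
    have h4 := Submodule.orthogonalProjectionOnto_mem_subspace_eq_self (K := R₀)
      ⟨fderiv ℝ φ u₀ v, h3⟩
    have h5 : fderiv ℝ φ u₀ v = 0 := by
      have := h4.symm.trans h1
      exact congrArg Subtype.val this
    have h6 : v ∈ K₀ := by rw [hK₀]; exact h5
    have h7 := Submodule.orthogonalProjectionOnto_mem_subspace_eq_self (K := K₀) ⟨v, h6⟩
    exact congrArg Subtype.val (h7.symm.trans h2)
  have hfr : Module.finrank ℝ E = Module.finrank ℝ (R₀ × K₀) := by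
    rw [Module.finrank_prod, hR₀, hK₀, LinearMap.finrank_range_add_finrank_ker]
  have hbij : Function.Bijective (χ' u₀) :=
    ⟨hinj, (LinearMap.injective_iff_surjective_of_finrank_eq_finrank
      (f := (χ' u₀ : E →ₗ[ℝ] R₀ × K₀)) hfr).mp hinj⟩
  let e : E ≃L[ℝ] R₀ × K₀ := ContinuousLinearEquiv.ofBijective (χ' u₀)
    (LinearMap.ker_eq_bot.mpr hbij.1) (LinearMap.range_eq_top.mpr hbij.2)
  have he : (e : E →L[ℝ] R₀ × K₀) = χ' u₀ := by ext v <;> rfl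
  have hd : HasFDerivAt χ (e : E →L[ℝ] R₀ × K₀) u₀ := by rw [he]; exact hχ' u₀ hφ
  let H := (hχ u₀ hφ).toOpenPartialHomeomorph χ hd (by simp)
  have hHc : (H : E → R₀ × K₀) = χ := rfl
  have hu₀ : u₀ ∈ H.source := (hχ u₀ hφ).mem_toOpenPartialHomeomorph_source hd (by simp)
  have hz₀ : χ u₀ ∈ H.target := H.map_source hu₀
  have hsymm : H.symm (χ u₀) = u₀ := H.left_inv hu₀
  have hcont : ContinuousAt χ' u₀ := by
    have h1 : ContinuousAt (fderiv ℝ φ) u₀ :=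
      (hφ.fderiv_right (m := ∞) (by simp)).continuousAt
    have h2 : ContinuousAt (fun u => pr.comp (fderiv ℝ φ u)) u₀ := continuousAt_const.clm_comp h1
    exact (ContinuousLinearMap.prodₗᵢ (𝕜 := ℝ) (E := E) (F := R₀) (G := K₀)
      ℝ).continuous.continuousAt.comp (h2.prodMk continuousAt_const)
  have hequiv : ∀ᶠ u in nhds u₀, ∃ e' : E ≃L[ℝ] R₀ × K₀, (e' : E →L[ℝ] R₀ × K₀) = χ' u := by
    have h1 : Set.range ContinuousLinearEquiv.toContinuousLinearMap ∈ nhds (χ' u₀) := by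
      rw [← he]; exact e.nhds
    exact hcont.eventually h1
  have hgood : ∀ᶠ u in nhds u₀, ContDiffAt ℝ ∞ φ u ∧
      (∃ e' : E ≃L[ℝ] R₀ × K₀, (e' : E →L[ℝ] R₀ × K₀) = χ' u) ∧
      Module.finrank ℝ (LinearMap.range (fderiv ℝ φ u : E →ₗ[ℝ] V)) = Module.finrank ℝ R₀ := by
    rw [← hR₀] at hrank
    filter_upwards [hs, hequiv, hrank] with u h1 h2 h3 using ⟨h1, h2, h3⟩
  refine ⟨H.symm, χ u₀, hsymm, ?_⟩
  have hpull : ∀ᶠ z in nhds (χ u₀), ContDiffAt ℝ ∞ φ (H.symm z) ∧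
      (∃ e' : E ≃L[ℝ] R₀ × K₀, (e' : E →L[ℝ] R₀ × K₀) = χ' (H.symm z)) ∧
      Module.finrank ℝ (LinearMap.range (fderiv ℝ φ (H.symm z) : E →ₗ[ℝ] V))
        = Module.finrank ℝ R₀ := by
    have hc : ContinuousAt H.symm (χ u₀) := H.continuousAt_symm hz₀
    exact hc.eventually (by rw [hsymm]; exact hgood)
  filter_upwards [hpull, H.open_target.mem_nhds hz₀] with z hz hzt
  obtain ⟨hz1, ⟨e', he'⟩, hz3⟩ := hz
  have hd' : HasFDerivAt H (e' : E →L[ℝ] R₀ × K₀) (H.symm z) := by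
    rw [he', hHc]; exact hχ' _ hz1
  have hHz : H (H.symm z) = z := H.right_inv hzt
  have hdsymm : HasFDerivAt H.symm (e'.symm : R₀ × K₀ →L[ℝ] E) z := H.hasFDerivAt_symm hzt hd'
  refine ⟨H.contDiffAt_symm hzt hd' (hχ _ hz1), ?_, ?_, ?_⟩
  · rw [hdsymm.fderiv]; exact e'.symm.surjective
  · filter_upwards [H.open_target.mem_nhds hzt] with z' hz'
    exact congrArg Prod.fst (H.right_inv hz' : χ (H.symm z') = z')
  · intro w
    rw [hdsymm.fderiv]
    set v := e'.symm (0, w) with hv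
    have h1 : χ' (H.symm z) v = (0, w) := by rw [← he']; exact e'.apply_symm_apply _
    have h2 : pr (fderiv ℝ φ (H.symm z) v) = 0 := congrArg Prod.fst h1
    -- This is where constancy of the rank enters: `D` surjects onto `R₀` and has the same
    -- dimension, so the projection is injective on `D`.
    let D := LinearMap.range (fderiv ℝ φ (H.symm z) : E →ₗ[ℝ] V)
    let q : D →ₗ[ℝ] R₀ := (pr : V →ₗ[ℝ] R₀) ∘ₗ D.subtype
    have hq : Function.Surjective q := by
      intro a
      refine ⟨⟨fderiv ℝ φ (H.symm z) (e'.symm (a, 0)), ⟨_, rfl⟩⟩, ?_⟩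
      have : χ' (H.symm z) (e'.symm (a, 0)) = (a, 0) := by
        rw [← he']; exact e'.apply_symm_apply _
      exact congrArg Prod.fst this
    have hq' : Function.Injective q :=
      (LinearMap.injective_iff_surjective_of_finrank_eq_finrank hz3).mpr hq
    have := (injective_iff_map_eq_zero q).mp hq' ⟨fderiv ℝ φ (H.symm z) v, ⟨_, rfl⟩⟩ h2
    exact congrArg Subtype.val this

/-- The constant rank theorem, in the form: `φ (Ψ (a, w)) = σ a` near the base point, where `σ`
parametrizes the image as a graph over its tangent space `R₀`. -/
theorem exists_constantRank_normalForm {φ : E → V} {u₀ : E}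
    (hs : ∀ᶠ u in nhds u₀, ContDiffAt ℝ ∞ φ u)
    (hrank : ∀ᶠ u in nhds u₀, Module.finrank ℝ (LinearMap.range (fderiv ℝ φ u : E →ₗ[ℝ] V))
      = Module.finrank ℝ (LinearMap.range (fderiv ℝ φ u₀ : E →ₗ[ℝ] V)))
    (R₀ : Submodule ℝ V) (hR₀ : R₀ = LinearMap.range (fderiv ℝ φ u₀ : E →ₗ[ℝ] V))
    (K₀ : Submodule ℝ E) (hK₀ : K₀ = LinearMap.ker (fderiv ℝ φ u₀ : E →ₗ[ℝ] V))
    {P : E → Prop} (hP : ∀ᶠ u in nhds u₀, P u) :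
    ∃ (Ψ : R₀ × K₀ → E) (a₁ : R₀) (w₁ : K₀) (ε : ℝ) (σ : R₀ → V), 0 < ε ∧ Ψ (a₁, w₁) = u₀ ∧
      ContDiffAt ℝ ∞ σ a₁ ∧ (∀ a : R₀, fderiv ℝ σ a₁ a = (a : V)) ∧
      ∀ a ∈ Metric.ball a₁ ε, ∀ w ∈ Metric.ball w₁ ε, P (Ψ (a, w)) ∧ ContDiffAt ℝ ∞ Ψ (a, w) ∧
        Function.Surjective (fderiv ℝ Ψ (a, w)) ∧ φ (Ψ (a, w)) = σ a ∧
        (∀ w', fderiv ℝ φ (Ψ (a, w)) (fderiv ℝ Ψ (a, w) (0, w')) = 0) ∧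
        ∀ b, fderiv ℝ σ a b = fderiv ℝ φ (Ψ (a, w)) (fderiv ℝ Ψ (a, w) (b, 0)) := by
  have hR₀mem : ∀ v, fderiv ℝ φ u₀ v ∈ R₀ := fun v => by rw [hR₀]; exact ⟨v, rfl⟩
  obtain ⟨Ψ, ⟨a₁, w₁⟩, hΨ₀, hΨ⟩ := exists_constantRank_parametrization hs hrank R₀ hR₀ K₀ hK₀
  have hΨc : ContinuousAt Ψ (a₁, w₁) := hΨ.self_of_nhds.1.continuousAt
  have hP' : ∀ᶠ z in nhds (a₁, w₁), P (Ψ z) ∧ ContDiffAt ℝ ∞ φ (Ψ z) :=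
    hΨc.eventually (by rw [hΨ₀]; exact hP.and hs)
  obtain ⟨ε, hε, hball⟩ := Metric.eventually_nhds_iff_ball.mp (hΨ.and hP')
  have hB : ∀ a ∈ Metric.ball a₁ ε, ∀ w ∈ Metric.ball w₁ ε, _ := fun a ha w hw =>
    hball (a, w) (by rw [← ball_prod_same]; exact ⟨ha, hw⟩)
  have ha₁ : a₁ ∈ Metric.ball a₁ ε := Metric.mem_ball_self hε
  have hw₁ : w₁ ∈ Metric.ball w₁ ε := Metric.mem_ball_self hε
  have hφd : ∀ a ∈ Metric.ball a₁ ε, ∀ w ∈ Metric.ball w₁ ε,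
      HasFDerivAt φ (fderiv ℝ φ (Ψ (a, w))) (Ψ (a, w)) := fun a ha w hw =>
    ((hB a ha w hw).2.2.differentiableAt (by simp)).hasFDerivAt
  have hΨd : ∀ a ∈ Metric.ball a₁ ε, ∀ w ∈ Metric.ball w₁ ε,
      HasFDerivAt Ψ (fderiv ℝ Ψ (a, w)) (a, w) := fun a ha w hw =>
    ((hB a ha w hw).1.1.differentiableAt (by simp)).hasFDerivAt
  have hleft : ∀ a ∈ Metric.ball a₁ ε, ∀ w ∈ Metric.ball w₁ ε,
      HasFDerivAt (fun a => φ (Ψ (a, w))) ((fderiv ℝ φ (Ψ (a, w))).comp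
        ((fderiv ℝ Ψ (a, w)).comp (ContinuousLinearMap.inl ℝ R₀ K₀))) a := fun a ha w hw =>
    HasFDerivAt.comp (f := fun a => Ψ (a, w)) a (hφd a ha w hw)
      (HasFDerivAt.comp (f := fun a => (a, w)) a (hΨd a ha w hw) (hasFDerivAt_prodMk_left a w))
  have hright : ∀ a ∈ Metric.ball a₁ ε, ∀ w ∈ Metric.ball w₁ ε,
      HasFDerivAt (fun w => φ (Ψ (a, w))) ((fderiv ℝ φ (Ψ (a, w))).comp
        ((fderiv ℝ Ψ (a, w)).comp (ContinuousLinearMap.inr ℝ R₀ K₀))) w := fun a ha w hw =>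
    HasFDerivAt.comp (f := fun w => Ψ (a, w)) w (hφd a ha w hw)
      (HasFDerivAt.comp (f := fun w => (a, w)) w (hΨd a ha w hw) (hasFDerivAt_prodMk_right a w))
  have hconst : ∀ a ∈ Metric.ball a₁ ε, ∀ w ∈ Metric.ball w₁ ε,
      φ (Ψ (a, w)) = φ (Ψ (a, w₁)) := by
    intro a ha w hw
    refine Metric.isOpen_ball.is_const_of_fderiv_eq_zero (𝕜 := ℝ) (f := fun w => φ (Ψ (a, w)))
      (convex_ball w₁ ε).isPreconnected
      (fun w hw => (hright a ha w hw).differentiableAt.differentiableWithinAt)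
      (fun w hw => ?_) hw hw₁
    rw [(hright a ha w hw).fderiv]
    ext1 w'
    exact (hB a ha w hw).1.2.2.2 w'
  -- By `hconst` any other slice `w` would define the same function on the ball, so the derivative
  -- of `σ` can be computed along every slice.
  obtain ⟨σ, hσ⟩ : ∃ σ : R₀ → V, ∀ a, σ a = φ (Ψ (a, w₁)) := ⟨_, fun _ => rfl⟩
  have hσd : ∀ a ∈ Metric.ball a₁ ε, ∀ w ∈ Metric.ball w₁ ε, HasFDerivAt σ
      ((fderiv ℝ φ (Ψ (a, w))).comp
        ((fderiv ℝ Ψ (a, w)).comp (ContinuousLinearMap.inl ℝ R₀ K₀))) a := by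
    intro a ha w hw
    apply (hleft a ha w hw).congr_of_eventuallyEq
    filter_upwards [Metric.isOpen_ball.mem_nhds ha] with a' ha'
    rw [hσ, hconst a' ha' w hw]
  have hσ1 : ∀ a : R₀, fderiv ℝ σ a₁ a = (a : V) := by
    intro a
    have hmem : fderiv ℝ σ a₁ a ∈ R₀ := by
      rw [(hσd a₁ ha₁ w₁ hw₁).fderiv, hΨ₀]; exact hR₀mem _
    have h1 : (fun a => R₀.orthogonalProjectionOnto (σ a)) =ᶠ[nhds a₁] fun a => a := by
      have h2 := (hB a₁ ha₁ w₁ hw₁).1.2.2.1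
      have h3 : ContinuousAt (fun a : R₀ => (a, w₁)) a₁ := by fun_prop
      filter_upwards [h3.eventually h2] with a' ha'
      rw [hσ]; exact ha'
    have h4 := (R₀.orthogonalProjectionOnto.hasFDerivAt.comp a₁
      (hσd a₁ ha₁ w₁ hw₁).differentiableAt.hasFDerivAt).unique
      ((hasFDerivAt_id a₁).congr_of_eventuallyEq h1)
    have h5 : R₀.orthogonalProjectionOnto (fderiv ℝ σ a₁ a) = a :=
      congrArg (fun B : R₀ →L[ℝ] R₀ => B a) h4
    have h6 := Submodule.orthogonalProjectionOnto_mem_subspace_eq_self (K := R₀)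
      ⟨fderiv ℝ σ a₁ a, hmem⟩
    exact (congrArg Subtype.val (h6.symm.trans h5))
  have hσsmooth : ContDiffAt ℝ ∞ σ a₁ := by
    have h3 : ContDiffAt ℝ ∞ (fun a : R₀ => (a, w₁)) a₁ := by fun_prop
    rw [funext hσ]
    exact ContDiffAt.comp a₁ (f := fun a => Ψ (a, w₁)) (hB a₁ ha₁ w₁ hw₁).2.2
      (ContDiffAt.comp a₁ (f := fun a => (a, w₁)) (hB a₁ ha₁ w₁ hw₁).1.1 h3)
  refine ⟨Ψ, a₁, w₁, ε, σ, hε, hΨ₀, hσsmooth, hσ1, fun a ha w hw => ?_⟩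
  obtain ⟨⟨h1, h2, -, h4⟩, h5, -⟩ := hB a ha w hw
  refine ⟨h5, h1, h2, by rw [hσ, hconst a ha w hw], h4, fun b => ?_⟩
  rw [(hσd a ha w hw).fderiv]
  rfl

end ConstantRank

/-! ### Isospectral shape operators of the focal submanifold -/

section FocalSymmetry

variable {E V : Type*} [NormedAddCommGroup E] [InnerProductSpace ℝ E] [FiniteDimensional ℝ E]
  [NormedAddCommGroup V] [InnerProductSpace ℝ V] [FiniteDimensional ℝ V]

/-- With `D` the second derivative of a graph parametrization, `T y` is the shape operator in the
normal direction `y`. Its linearity in `y` is what the later rotation argument uses. -/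
theorem exists_adjoint_family {R : Type*} [NormedAddCommGroup R] [InnerProductSpace ℝ R]
    [FiniteDimensional ℝ R] (D : R →L[ℝ] R →L[ℝ] V) :
    ∃ T : V →ₗ[ℝ] R →ₗ[ℝ] R, ∀ y a b, inner ℝ (T y a) b = inner ℝ y (D a b) := by
  refine ⟨LinearMap.mk₂ ℝ (fun y a => (D a).adjoint y)
      (fun y y' a => map_add _ _ _) (fun c y a => map_smul _ _ _) (fun y a a' => by simp)
      (fun c y a => by simp), fun y a b => ?_⟩
  rw [LinearMap.mk₂_apply]
  exact ContinuousLinearMap.adjoint_inner_left (D a) b y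

/-- Through `π` the space `R` is `E` modulo the `κ₀`-eigenspace, and every other eigenspace passes
to an eigenspace of `T`. The annihilating polynomial and the trace are then read off from the
decomposition of `E`. -/
theorem isospectral_of_semiconj {K : Finset ℝ} (hK : K.Nonempty) {A : E →L[ℝ] E}
    (hA : Polynomial.aeval A (Lagrange.nodal K id) = 0) {κ₀ : ℝ} (hκ₀ : κ₀ ∈ K) (c : ℝ → ℝ)
    {R : Type*} [AddCommGroup R] [Module ℝ R] [FiniteDimensional ℝ R] (T : Module.End ℝ R)
    {π : E →ₗ[ℝ] R} (hπ : Function.Surjective π)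
    (hT : ∀ κ ∈ K.erase κ₀, ∀ v, A v = κ • v → T (π v) = c κ • π v)
    (h0 : ∀ v, π v = 0 ↔ A v = κ₀ • v) :
    Polynomial.aeval T (∏ κ ∈ K.erase κ₀, (Polynomial.X - Polynomial.C (c κ))) = 0 ∧
      LinearMap.trace ℝ R T = ∑ κ ∈ K.erase κ₀, c κ * eigenMult K A κ := by
  have hdec : ∀ v, π v = ∑ κ ∈ K.erase κ₀, π (eigenProj K A κ v) := by
    intro v
    conv_lhs => rw [← sum_eigenProj_apply hK A v]
    rw [map_sum, ← Finset.add_sum_erase K _ hκ₀,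
      (h0 _).mpr (apply_eigenProj hA hκ₀ v), zero_add]
  constructor
  · ext r
    obtain ⟨v, rfl⟩ := hπ r
    rw [hdec v, map_sum, LinearMap.zero_apply]
    apply Finset.sum_eq_zero
    intro κ hκ
    have h1 := hT κ hκ _ (apply_eigenProj hA (Finset.mem_of_mem_erase hκ) v)
    rw [← Finset.prod_erase_mul _ _ hκ, map_mul, Module.End.mul_apply]
    have : (Polynomial.aeval T (Polynomial.X - Polynomial.C (c κ)))
        (π (eigenProj K A κ v)) = 0 := by
      simp [h1, Module.algebraMap_end_apply]
    rw [this, map_zero]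
  · rw [← Finset.sum_congr rfl (g := fun κ => (c κ) * eigenMult K A κ) (fun _ _ => rfl)]
    set C : E →L[ℝ] E := ∑ κ ∈ K, (if κ = κ₀ then 0 else c κ) • eigenProj K A κ with hC
    have hCv : ∀ v, C v = ∑ κ ∈ K.erase κ₀, c κ • eigenProj K A κ v := by
      intro v
      rw [hC, sum_apply, ← Finset.add_sum_erase K _ hκ₀]
      simp only [if_true, zero_smul, zero_apply, zero_add]
      apply Finset.sum_congr rfl
      intro κ hκ
      simp [Finset.ne_of_mem_erase hκ]
    rw [trace_eq_of_semiconj (C := (C : E →ₗ[ℝ] E)) hπ, hC,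
      trace_sum_smul_eigenProj K A (fun κ => if κ = κ₀ then 0 else c κ),
      ← Finset.add_sum_erase K _ hκ₀]
    · simp only [if_true, zero_mul, zero_add]
      apply Finset.sum_congr rfl
      intro κ hκ
      simp [Finset.ne_of_mem_erase hκ]
    · intro v
      have e : (C : E →ₗ[ℝ] E) v = C v := rfl
      rw [e, hCv, map_sum, hdec v, map_sum]
      apply Finset.sum_congr rfl
      intro κ hκ
      rw [hT κ hκ _ (apply_eigenProj hA (Finset.mem_of_mem_erase hκ) v), map_smul]
    · intro v hv
      have e : (C : E →ₗ[ℝ] E) v = C v := rfl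
      rw [e, hCv]
      apply Finset.sum_eq_zero
      intro κ hκ
      rw [eigenProj_of_eigenvector_ne hκ₀ (Finset.ne_of_mem_erase hκ) ((h0 v).mp hv), smul_zero]

namespace IsoparametricPatch

variable {O : Set E} {f ν : E → V} {K : Finset ℝ} (h : IsoparametricPatch O f ν K) {u₀ : E}
  {κ₀ θ : ℝ}
include h

theorem inner_normalVelocity_fderiv_normalGeodesic (hu : u₀ ∈ O) (t : ℝ) (v : E) :
    inner ℝ (normalVelocity f ν t u₀) (fderiv ℝ (normalGeodesic f ν t) u₀ v) = 0 := by
  rw [h.fderiv_normalGeodesic hu, h.inner_normalVelocity_fderiv hu]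

/-- By rank-nullity: the kernel is the `κ₀`-eigenspace, whose multiplicity is locally constant. -/
theorem eventually_finrank_range_focal (hu : u₀ ∈ O) (hκ : κ₀ ∈ K)
    (hθ : Real.cos θ = κ₀ * Real.sin θ) (hs : Real.sin θ ≠ 0) :
    ∀ᶠ u in nhds u₀,
      Module.finrank ℝ (LinearMap.range (fderiv ℝ (normalGeodesic f ν θ) u : E →ₗ[ℝ] V))
      = Module.finrank ℝ (LinearMap.range (fderiv ℝ (normalGeodesic f ν θ) u₀ : E →ₗ[ℝ] V)) := by
  have key : ∀ u ∈ O, ((Module.finrank ℝ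
      (LinearMap.range (fderiv ℝ (normalGeodesic f ν θ) u : E →ₗ[ℝ] V)) : ℝ))
      + eigenMult K (shapeOperator f ν u) κ₀ = Module.finrank ℝ E := by
    intro u hu
    have hk : LinearMap.ker (fderiv ℝ (normalGeodesic f ν θ) u : E →ₗ[ℝ] V)
        = LinearMap.ker ((shapeOperator f ν u : E →ₗ[ℝ] E) - κ₀ • LinearMap.id) := by
      ext v
      have := h.focal_eigenvalue_iff hu hθ hs v
      simpa [sub_eq_zero] using this
    rw [eigenMult_eq_finrank (h.aeval_shapeOperator hu) hκ, ← hk]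
    exact_mod_cast LinearMap.finrank_range_add_finrank_ker _
  filter_upwards [h.eventually_eigenMult_eq hu hκ, h.mem_nhds hu] with u h1 h2
  have h3 := key u h2
  have h4 := key u₀ hu
  rw [h1] at h3
  exact_mod_cast (by linarith : ((Module.finrank ℝ
      (LinearMap.range (fderiv ℝ (normalGeodesic f ν θ) u : E →ₗ[ℝ] V)) : ℝ)) =
      (Module.finrank ℝ (LinearMap.range (fderiv ℝ (normalGeodesic f ν θ) u₀ : E →ₗ[ℝ] V)) : ℝ))

/-- Along the leaf through `u₀` of the focal map, the shape operators `T y` of the focal submanifold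
depend linearly on the normal vector `y`, and they are isospectral. -/
theorem exists_focal_leaf (hu : u₀ ∈ O) (hκ : κ₀ ∈ K)
    (hθ : Real.cos θ = κ₀ * Real.sin θ) (hs : Real.sin θ ≠ 0)
    (R₀ : Submodule ℝ V)
    (hR₀ : R₀ = LinearMap.range (fderiv ℝ (normalGeodesic f ν θ) u₀ : E →ₗ[ℝ] V))
    (K₀ : Submodule ℝ E)
    (hK₀ : K₀ = LinearMap.ker (fderiv ℝ (normalGeodesic f ν θ) u₀ : E →ₗ[ℝ] V)) :
    ∃ (T : V →ₗ[ℝ] R₀ →ₗ[ℝ] R₀) (g : K₀ → E) (w₁ : K₀) (ε : ℝ), 0 < ε ∧ g w₁ = u₀ ∧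
      ContDiffAt ℝ ∞ g w₁ ∧ (∀ e ∈ K₀, ∃ w, fderiv ℝ g w₁ w = e) ∧
      ∀ w ∈ Metric.ball w₁ ε, g w ∈ O ∧ normalGeodesic f ν θ (g w) = normalGeodesic f ν θ u₀ ∧
      (∀ r ∈ R₀, inner ℝ (normalVelocity f ν θ (g w)) r = 0) ∧
      Polynomial.aeval (T (normalVelocity f ν θ (g w)) : Module.End ℝ R₀) (∏ κ ∈ K.erase κ₀,
        (Polynomial.X - Polynomial.C ((1 + κ₀ * κ) / (κ₀ - κ)))) = 0 ∧
      LinearMap.trace ℝ R₀ (T (normalVelocity f ν θ (g w))) = ∑ κ ∈ K.erase κ₀,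
        (1 + κ₀ * κ) / (κ₀ - κ) * eigenMult K (shapeOperator f ν u₀) κ ∧
      ∀ κ ∈ K.erase κ₀, ∃ a, a ≠ 0 ∧
        T (normalVelocity f ν θ (g w)) a = ((1 + κ₀ * κ) / (κ₀ - κ)) • a := by
  set φ := normalGeodesic f ν θ with hφ
  set n := normalVelocity f ν θ with hn
  have hsmooth : ∀ᶠ u in nhds u₀, ContDiffAt ℝ ∞ φ u := by
    filter_upwards [h.mem_nhds hu] with u hu' using h.contDiffAt_normalGeodesic hu' θ
  have hmult : ∀ᶠ u in nhds u₀, u ∈ O ∧ ∀ κ ∈ K,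
      eigenMult K (shapeOperator f ν u) κ = eigenMult K (shapeOperator f ν u₀) κ := by
    refine Filter.Eventually.and (h.mem_nhds hu) ?_
    rw [Filter.eventually_all_finset]
    exact fun κ hκ => h.eventually_eigenMult_eq hu hκ
  obtain ⟨Ψ, a₁, w₁, ε, σ, hε, hΨ₀, hσsmooth, hσ1, hB⟩ := exists_constantRank_normalForm hsmooth
    (h.eventually_finrank_range_focal hu hκ hθ hs) R₀ hR₀ K₀ hK₀ hmult
  have ha₁ : a₁ ∈ Metric.ball a₁ ε := Metric.mem_ball_self hε
  have hw₁ : w₁ ∈ Metric.ball w₁ ε := Metric.mem_ball_self hε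
  have hnd : ∀ w ∈ Metric.ball w₁ ε, HasFDerivAt (fun a => n (Ψ (a, w)))
      ((fderiv ℝ n (Ψ (a₁, w))).comp
        ((fderiv ℝ Ψ (a₁, w)).comp (ContinuousLinearMap.inl ℝ R₀ K₀))) a₁ := fun w hw =>
    HasFDerivAt.comp (f := fun a => Ψ (a, w)) a₁
      ((h.contDiffAt_normalVelocity (hB a₁ ha₁ w hw).1.1 θ).differentiableAt (by simp)).hasFDerivAt
      (HasFDerivAt.comp (f := fun a => (a, w)) a₁
        ((hB a₁ ha₁ w hw).2.1.differentiableAt (by simp)).hasFDerivAt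
        (hasFDerivAt_prodMk_left a₁ w))
  have hD2 : HasFDerivAt (fderiv ℝ σ) (fderiv ℝ (fderiv ℝ σ) a₁) a₁ :=
    ((hσsmooth.fderiv_right (m := ∞) (by simp)).differentiableAt (by simp)).hasFDerivAt
  obtain ⟨D2, hD2def⟩ : ∃ D2, D2 = fderiv ℝ (fderiv ℝ σ) a₁ := ⟨_, rfl⟩
  rw [← hD2def] at hD2
  -- The field `n` is normal to the focal submanifold along every slice `w`. Differentiating `⟪n, dσ
  -- b⟫ = 0` in `a` expresses the second fundamental form at the one point `σ a₁` through `dn` at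
  -- the leaf point `Ψ (a₁, w)`.
  have hII : ∀ w ∈ Metric.ball w₁ ε, ∀ a b : R₀,
      inner ℝ (n (Ψ (a₁, w))) (D2 a b)
        = -inner ℝ (fderiv ℝ n (Ψ (a₁, w)) (fderiv ℝ Ψ (a₁, w) (a, 0))) (b : V) := by
    intro w hw a b
    have h2 := (hnd w hw).inner ℝ (hD2.clm_apply (hasFDerivAt_const b a₁))
    have h3 : (fun a => inner ℝ (n (Ψ (a, w))) (fderiv ℝ σ a b)) =ᶠ[nhds a₁] fun _ => (0 : ℝ) := by
      filter_upwards [Metric.isOpen_ball.mem_nhds ha₁] with a' ha'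
      obtain ⟨⟨hO, -⟩, -, -, -, -, hd⟩ := hB a' ha' w hw
      rw [hd]
      exact h.inner_normalVelocity_fderiv_normalGeodesic hO θ _
    have h4 := h2.unique ((hasFDerivAt_const (0 : ℝ) a₁).congr_of_eventuallyEq h3)
    have h5 := congrArg (fun B : R₀ →L[ℝ] ℝ => B a) h4
    simp [hσ1] at h5
    linarith
  obtain ⟨T, hT⟩ : ∃ T : V →ₗ[ℝ] R₀ →ₗ[ℝ] R₀, ∀ y a b, inner ℝ (T y a) b = inner ℝ y (D2 a b) :=
    exists_adjoint_family D2
  have hΨr : HasFDerivAt (fun w => Ψ (a₁, w))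
      ((fderiv ℝ Ψ (a₁, w₁)).comp (ContinuousLinearMap.inr ℝ R₀ K₀)) w₁ :=
    HasFDerivAt.comp (f := fun w => (a₁, w)) w₁
      ((hB a₁ ha₁ w₁ hw₁).2.1.differentiableAt (by simp)).hasFDerivAt
      (hasFDerivAt_prodMk_right a₁ w₁)
  refine ⟨T, fun w => Ψ (a₁, w), w₁, ε, hε, hΨ₀, ?_, ?_, ?_⟩
  · have h3 : ContDiffAt ℝ ∞ (fun w : K₀ => (a₁, w)) w₁ := by fun_prop
    exact ContDiffAt.comp w₁ (f := fun w => (a₁, w)) (hB a₁ ha₁ w₁ hw₁).2.1 h3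
  · intro e he
    obtain ⟨-, -, hsurj, -, hker, hσd⟩ := hB a₁ ha₁ w₁ hw₁
    obtain ⟨⟨a, w⟩, haw⟩ := hsurj e
    have hφe : fderiv ℝ φ u₀ e = 0 := by rw [hK₀] at he; exact he
    have ha : a = 0 := by
      have h3 := hσ1 a
      rw [hσd] at h3
      have h4 : fderiv ℝ φ (Ψ (a₁, w₁)) (fderiv ℝ Ψ (a₁, w₁) (a, w)) = 0 := by
        rw [haw, hΨ₀, hφe]
      have : (a, w) = (a, (0 : K₀)) + ((0 : R₀), w) := by simp
      rw [this, map_add, map_add, hker, add_zero, h3] at h4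
      exact Subtype.ext h4
    subst ha
    exact ⟨w, by rw [hΨr.fderiv]; exact haw⟩
  · intro w hw
    obtain ⟨⟨hqO, hqm⟩, -, hsurj, hval, hker, hσq⟩ := hB a₁ ha₁ w hw
    refine ⟨hqO, ?_, ?_, ?_⟩
    · have := (hB a₁ ha₁ w₁ hw₁).2.2.2.1
      rw [hΨ₀] at this
      rw [hval, this]
    · intro r hr
      have h4 : r = fderiv ℝ σ a₁ ⟨r, hr⟩ := (hσ1 ⟨r, hr⟩).symm
      rw [h4, hσq]
      exact h.inner_normalVelocity_fderiv_normalGeodesic hqO θ _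
    have hIIw := hII w hw
    beta_reduce
    generalize hq : Ψ (a₁, w) = q at *
    have hsplit : ∀ a w', fderiv ℝ φ q (fderiv ℝ Ψ (a₁, w) (a, w')) = (a : V) := by
      intro a w'
      have : (a, w') = (a, (0 : K₀)) + ((0 : R₀), w') := by simp
      rw [this, map_add, map_add, hker, add_zero, ← hσq, hσ1]
    have hmem : ∀ v, (fderiv ℝ φ q : E →ₗ[ℝ] V) v ∈ R₀ := by
      intro v
      obtain ⟨⟨a, w'⟩, rfl⟩ := hsurj v
      have : (fderiv ℝ φ q : E →ₗ[ℝ] V) (fderiv ℝ Ψ (a₁, w) (a, w')) = (a : V) := hsplit a w'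
      rw [this]; exact a.2
    let π : E →ₗ[ℝ] R₀ := (fderiv ℝ φ q : E →ₗ[ℝ] V).codRestrict R₀ hmem
    have hπv : ∀ v, (π v : V) = fderiv ℝ φ q v := fun v => rfl
    have hπ : Function.Surjective π := fun a =>
      ⟨fderiv ℝ Ψ (a₁, w) (a, 0), Subtype.ext (hsplit a 0)⟩
    have hπ0 : ∀ v, π v = 0 ↔ shapeOperator f ν q v = κ₀ • v := by
      intro v
      rw [← h.focal_eigenvalue_iff hqO hθ hs, ← Subtype.coe_inj, hπv]
      rfl
    -- On a `κ`-eigenvector, `-dn` and `dφ` are the multiples `sin θ + κ cos θ` and `cos θ - κ sin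
    -- θ` of `df v`. Their quotient is the focal principal curvature, the cotangent of the
    -- difference of the two angles.
    have hTπ : ∀ κ ∈ K.erase κ₀, ∀ v, shapeOperator f ν q v = κ • v →
        T (n q) (π v) = ((1 + κ₀ * κ) / (κ₀ - κ)) • π v := by
      intro κ hκe v hv
      apply ext_inner_right ℝ
      intro b
      rw [hT, hIIw, inner_smul_left]
      -- The coordinate lift of `π v` and the vector `v` differ by a leaf vector, whose contribution
      -- to `dn` is orthogonal to `R₀`.
      set e := v - fderiv ℝ Ψ (a₁, w) (π v, 0) with he
      have he0 : shapeOperator f ν q e = κ₀ • e := by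
        rw [← h.focal_eigenvalue_iff hqO hθ hs]
        have : fderiv ℝ φ q e = 0 := by rw [he, map_sub, hsplit, hπv, sub_self]
        exact this
      have hv' : fderiv ℝ Ψ (a₁, w) (π v, 0) = v - e := by rw [he]; abel
      have hb : (b : V) = fderiv ℝ φ q (fderiv ℝ Ψ (a₁, w) (b, 0)) := (hsplit b 0).symm
      have h1 : inner ℝ (fderiv ℝ n q e) (b : V) = 0 := by
        have h2 : fderiv ℝ n q e = _ := h.fderiv_normalVelocity_eigenvector hqO θ he0
        rw [h2, inner_neg_left, inner_smul_left, hb,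
          h.inner_leaf_focal hqO hθ he0, mul_zero, neg_zero]
      have h2 : fderiv ℝ n q v = _ := h.fderiv_normalVelocity_eigenvector hqO θ hv
      have h3 : fderiv ℝ φ q v = _ := h.fderiv_normalGeodesic_eigenvector hqO θ hv
      have hne : κ₀ - κ ≠ 0 := sub_ne_zero.mpr (Finset.ne_of_mem_erase hκe).symm
      rw [hv', map_sub, inner_sub_left, h1, sub_zero, h2, inner_neg_left, inner_smul_left,
        Submodule.coe_inner, hπv, h3, inner_smul_left, hθ]
      simp only [conj_trivial]
      field_simp
    obtain ⟨h1, h2⟩ := isospectral_of_semiconj h.nonempty (h.aeval_shapeOperator hqO) hκ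
      (fun κ => (1 + κ₀ * κ) / (κ₀ - κ)) (T (n q)) hπ hTπ hπ0
    refine ⟨h1, ?_, ?_⟩
    · rw [h2]
      exact Finset.sum_congr rfl fun κ hκe => by rw [hqm κ (Finset.mem_of_mem_erase hκe)]
    · intro κ hκe
      obtain ⟨v, hv, hAv⟩ := h.exists_eigenvector hqO (Finset.mem_of_mem_erase hκe)
      refine ⟨π v, fun h0 => ?_, hTπ κ hκe v hAv⟩
      have h1 := (hπ0 v).mp h0
      rw [hAv] at h1
      have h2 : (κ - κ₀) • v = 0 := by rw [sub_smul, h1, sub_self]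
      rcases smul_eq_zero.mp h2 with h3 | h3
      · exact Finset.ne_of_mem_erase hκe (sub_eq_zero.mp h3)
      · exact hv h3

/-- The shape operators `T y` of the focal submanifold depend linearly on the normal vector `y`
and are isospectral for all unit normal vectors `y` close to the given one. -/
theorem exists_focal_shape_family (hu : u₀ ∈ O) (hκ : κ₀ ∈ K)
    (hθ : Real.cos θ = κ₀ * Real.sin θ) (hs : Real.sin θ ≠ 0)
    (R₀ : Submodule ℝ V)
    (hR₀ : R₀ = LinearMap.range (fderiv ℝ (normalGeodesic f ν θ) u₀ : E →ₗ[ℝ] V)) :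
    ∃ T : V →ₗ[ℝ] R₀ →ₗ[ℝ] R₀, ∀ᶠ y in nhds (normalVelocity f ν θ u₀),
      inner ℝ y y = 1 → inner ℝ y (normalGeodesic f ν θ u₀) = 0 → (∀ r ∈ R₀, inner ℝ y r = 0) →
      Polynomial.aeval (T y : Module.End ℝ R₀) (∏ κ ∈ K.erase κ₀,
        (Polynomial.X - Polynomial.C ((1 + κ₀ * κ) / (κ₀ - κ)))) = 0 ∧
      LinearMap.trace ℝ R₀ (T y) = ∑ κ ∈ K.erase κ₀,
        (1 + κ₀ * κ) / (κ₀ - κ) * eigenMult K (shapeOperator f ν u₀) κ ∧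
      ∀ κ ∈ K.erase κ₀, ∃ a, a ≠ 0 ∧ T y a = ((1 + κ₀ * κ) / (κ₀ - κ)) • a := by
  obtain ⟨K₀, hK₀⟩ : ∃ K₀, K₀ = LinearMap.ker (fderiv ℝ (normalGeodesic f ν θ) u₀ : E →ₗ[ℝ] V) :=
    ⟨_, rfl⟩
  obtain ⟨T, g, w₁, ε, hε, hg, hgsm, hgsurj, hB⟩ := h.exists_focal_leaf hu hκ hθ hs R₀ hR₀ K₀ hK₀
  refine ⟨T, ?_⟩
  set φ := normalGeodesic f ν θ with hφ
  set n := normalVelocity f ν θ with hn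
  have hw₁ : w₁ ∈ Metric.ball w₁ ε := Metric.mem_ball_self hε
  obtain ⟨U, hU⟩ : ∃ U : Submodule ℝ V, U = Submodule.span ℝ {φ u₀} ⊔ R₀ := ⟨_, rfl⟩
  have hUperp : ∀ y : V, inner ℝ y (φ u₀) = 0 → (∀ r ∈ R₀, inner ℝ y r = 0) →
      ∀ z ∈ U, inner ℝ y z = 0 := by
    intro y h1 h2 z hz
    rw [hU] at hz
    obtain ⟨x', hx', r, hr, rfl⟩ := Submodule.mem_sup.mp hz
    obtain ⟨c, rfl⟩ := Submodule.mem_span_singleton.mp hx'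
    rw [inner_add_right, inner_smul_right, h1, h2 r hr, mul_zero, add_zero]
  have hnsm : ContDiffAt ℝ ∞ (fun w => n (g w)) w₁ :=
    ContDiffAt.comp (g := n) (f := g) w₁ (h.contDiffAt_normalVelocity (hB w₁ hw₁).1 θ) hgsm
  have hnd : ∀ w, fderiv ℝ (fun w => n (g w)) w₁ w = fderiv ℝ n u₀ (fderiv ℝ g w₁ w) := by
    intro w
    have := HasFDerivAt.comp (g := n) (f := g) w₁
      ((h.contDiffAt_normalVelocity (hB w₁ hw₁).1 θ).differentiableAt (by simp)).hasFDerivAt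
      (hgsm.differentiableAt (by simp)).hasFDerivAt
    have e : fderiv ℝ (fun w => n (g w)) w₁ = _ := this.fderiv
    rw [e, ← hg]; rfl
  obtain ⟨m, hm⟩ : ∃ m : K₀ → V, m = fun w => n (g w) := ⟨_, rfl⟩
  rw [← hm] at hnsm hnd
  have hm1 : m w₁ = n u₀ := by rw [hm, ← hg]
  -- The leaf supplies only the normals `m w`; adding a radial factor and the complement `U` gives a
  -- submersion at `(1, w₁, 0)`, so its values fill a neighbourhood of `n u₀`. For a unit vector
  -- orthogonal to `U` the `U`-part vanishes and the factor is `1`, leaving a leaf normal.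
  let Q : ℝ × K₀ × U → V := fun p => p.1 • m p.2.1 + (p.2.2 : V)
  have hQsm : ContDiffAt ℝ ∞ Q (1, w₁, 0) := by
    have h2 : ContDiffAt ℝ ∞ (fun p : ℝ × K₀ × U => m p.2.1) (1, w₁, 0) :=
      ContDiffAt.comp (g := m) (f := fun p : ℝ × K₀ × U => p.2.1) (1, w₁, 0) hnsm (by fun_prop)
    exact (contDiffAt_fst.smul h2).add
      (U.subtypeL.contDiff.contDiffAt.comp (1, w₁, 0) (contDiffAt_snd.snd))
  have hQd : ∀ ρ w z, fderiv ℝ Q (1, w₁, 0) (ρ, w, z)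
      = ρ • n u₀ + fderiv ℝ n u₀ (fderiv ℝ g w₁ w) + z := by
    intro ρ w z
    have hm' := HasFDerivAt.comp (f := fun p : ℝ × K₀ × U => p.2.1) ((1, w₁, 0) : ℝ × K₀ × U)
      (hnsm.differentiableAt (by simp)).hasFDerivAt
      (hasFDerivAt_fst.comp (f := fun p : ℝ × K₀ × U => p.2) _ hasFDerivAt_snd)
    have h1 := (HasFDerivAt.smul (hasFDerivAt_fst (p := ((1, w₁, 0) : ℝ × K₀ × U))) hm').add
      (U.subtypeL.hasFDerivAt.comp (f := fun p : ℝ × K₀ × U => p.2.2) ((1, w₁, 0) : ℝ × K₀ × U)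
        (hasFDerivAt_snd.comp (f := fun p : ℝ × K₀ × U => p.2) ((1, w₁, 0) : ℝ × K₀ × U)
          hasFDerivAt_snd))
    have h2 : fderiv ℝ Q (1, w₁, 0) = _ := h1.fderiv
    rw [h2, ← hnd, ← hm1]
    simp [add_comm]
  have hQsurj : LinearMap.range (fderiv ℝ Q (1, w₁, 0) : ℝ × K₀ × U →ₗ[ℝ] V) = ⊤ := by
    rw [LinearMap.range_eq_top]
    intro y
    obtain ⟨y₁, hy₁, y₂, hy₂, rfl⟩ := U.exists_add_mem_mem_orthogonal y
    have h1 : inner ℝ y₂ (φ u₀) = 0 := by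
      rw [real_inner_comm]
      exact hy₂ _ (by
        rw [hU]; exact Submodule.mem_sup_left (Submodule.mem_span_singleton_self _))
    have h2 : ∀ v, inner ℝ y₂ (fderiv ℝ φ u₀ v) = 0 := by
      intro v
      rw [real_inner_comm]
      exact hy₂ _ (by
        rw [hU]; exact Submodule.mem_sup_right (by rw [hR₀]; exact ⟨v, rfl⟩))
    obtain ⟨ρ, e, he, hy⟩ := h.exists_eq_of_perp_focal hu hκ hθ hs h1 h2
    have hφe : fderiv ℝ φ u₀ e = 0 := (h.focal_eigenvalue_iff hu hθ hs e).mpr he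
    -- The factor `-sin θ` inverts `dn e = -(sin θ + κ₀ cos θ) • df e`; see `h4`.
    obtain ⟨w, hw⟩ := hgsurj (-(Real.sin θ) • e) (Submodule.smul_mem _ _ (by rw [hK₀]; exact hφe))
    refine ⟨(ρ, w, ⟨y₁, hy₁⟩), ?_⟩
    have h3 : fderiv ℝ n u₀ e = _ := h.fderiv_normalVelocity_eigenvector hu θ he
    have h4 : Real.sin θ * (Real.sin θ + κ₀ * Real.cos θ) = 1 := by
      have := Real.sin_sq_add_cos_sq θ
      linear_combination this - Real.cos θ * hθ
    change fderiv ℝ Q (1, w₁, 0) (ρ, w, ⟨y₁, hy₁⟩) = y₁ + y₂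
    rw [hQd, hw, map_smul, h3, hy, smul_neg, neg_smul, neg_neg, smul_smul, h4, one_smul]
    abel
  have hQ0 : Q (1, w₁, 0) = n u₀ := by simp [Q, hm1]
  have hmap := (hQsm.hasStrictFDerivAt (by simp)).map_nhds_eq_of_surj hQsurj
  rw [hQ0] at hmap
  rw [← hmap, Filter.eventually_map]
  have hnear : ∀ᶠ p : ℝ × K₀ × U in nhds (1, w₁, 0), 0 < p.1 ∧ p.2.1 ∈ Metric.ball w₁ ε := by
    refine Filter.Eventually.and ?_ ?_
    · exact (continuousAt_fst (p := ((1, w₁, 0) : ℝ × K₀ × U))).eventually (lt_mem_nhds one_pos)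
    · have : ContinuousAt (fun p : ℝ × K₀ × U => p.2.1) (1, w₁, 0) := by fun_prop
      exact this.eventually (Metric.isOpen_ball.mem_nhds hw₁)
  filter_upwards [hnear] with p hp hy1 hyx hyR
  obtain ⟨ρ, w, z⟩ := p
  obtain ⟨hρ, hw⟩ := hp
  obtain ⟨hqO, hqx, hqR, hspec⟩ := hB w hw
  have hmw : m w = n (g w) := by rw [hm]
  have horth := hUperp _ hyx hyR z z.2
  have horth' : inner ℝ (m w) (z : V) = 0 := by
    rw [hmw]
    exact hUperp _ (by rw [← hqx]; exact h.inner_normalVelocity_normalGeodesic hqO θ) hqR z z.2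
  have hz : (z : V) = 0 := by
    simp only [Q, inner_add_left, inner_smul_left, horth', mul_zero, zero_add] at horth
    exact inner_self_eq_zero.mp horth
  have hQy : Q (ρ, w, z) = ρ • m w := by simp [Q, hz]
  have hρ1 : ρ = 1 := by
    have h3 : inner ℝ (n (g w)) (n (g w)) = 1 := h.inner_normalVelocity_self hqO θ
    rw [hQy, inner_smul_left, inner_smul_right, hmw, h3] at hy1
    simp only [conj_trivial, mul_one] at hy1
    nlinarith
  rw [hQy, hρ1, one_smul, hmw]
  exact hspec

end IsoparametricPatch

end FocalSymmetry

/-! ### Symmetry of the focal principal curvatures -/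

section FocalSymmetry

variable {E V : Type*} [NormedAddCommGroup E] [InnerProductSpace ℝ E] [FiniteDimensional ℝ E]
  [NormedAddCommGroup V] [InnerProductSpace ℝ V] [FiniteDimensional ℝ V]

theorem analyticOnNhd_aeval {B : Type*} [NormedRing B] [NormedAlgebra ℝ B] {g : ℝ → B}
    (hg : AnalyticOnNhd ℝ g Set.univ) (p : Polynomial ℝ) :
    AnalyticOnNhd ℝ (fun t => Polynomial.aeval (g t) p) Set.univ := by
  induction p using Polynomial.induction_on with
  | C a => simpa using analyticOnNhd_const
  | add p q hp hq =>
    simp only [map_add]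
    exact hp.add hq
  | monomial n a h =>
    have e : (Polynomial.C a * Polynomial.X ^ (n + 1) : Polynomial ℝ)
        = (Polynomial.C a * Polynomial.X ^ n) * Polynomial.X := by ring
    simp only [e, map_mul (Polynomial.aeval _) _ Polynomial.X, Polynomial.aeval_X]
    exact h.mul hg

theorem aeval_toContinuousLinearMap {R : Type*} [NormedAddCommGroup R] [NormedSpace ℝ R]
    [FiniteDimensional ℝ R] (S : R →ₗ[ℝ] R) (p : Polynomial ℝ) (a : R) :
    Polynomial.aeval (LinearMap.toContinuousLinearMap S) p a
      = Polynomial.aeval (S : Module.End ℝ R) p a := by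
  induction p using Polynomial.induction_on generalizing a with
  | C c => simp [Algebra.algebraMap_eq_smul_one]
  | add p q hp hq => simp [hp, hq]
  | monomial n c h =>
    have e : (Polynomial.C c * Polynomial.X ^ (n + 1) : Polynomial ℝ)
        = (Polynomial.C c * Polynomial.X ^ n) * Polynomial.X := by ring
    rw [e, map_mul _ (Polynomial.C c * Polynomial.X ^ n), map_mul _ (Polynomial.C c * Polynomial.X ^ n),
      Polynomial.aeval_X, Polynomial.aeval_X, mul_apply_eq_comp,
      Module.End.mul_apply, h]
    rfl

/-- Both conditions are analytic in `α`, so they persist from near `0` to `α = π`, where the pencil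
is `-S₀`. Comparing the trace at `0` and at `π` gives `s = -s`. -/
theorem rotation_isospectral {R : Type*} [NormedAddCommGroup R] [NormedSpace ℝ R]
    [FiniteDimensional ℝ R] (S₀ S₁ : R →ₗ[ℝ] R) (p : Polynomial ℝ) (s : ℝ)
    (h : ∀ᶠ α in nhds (0 : ℝ),
      Polynomial.aeval (Real.cos α • S₀ + Real.sin α • S₁ : Module.End ℝ R) p = 0 ∧
      LinearMap.trace ℝ R (Real.cos α • S₀ + Real.sin α • S₁) = s) :
    Polynomial.aeval (-S₀ : Module.End ℝ R) p = 0 ∧ s = 0 := by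
  constructor
  · have h1 : AnalyticOnNhd ℝ (fun α : ℝ => Real.cos α • LinearMap.toContinuousLinearMap S₀
        + Real.sin α • LinearMap.toContinuousLinearMap S₁) Set.univ :=
      ((Real.analyticOnNhd_cos).smul analyticOnNhd_const).add
        ((Real.analyticOnNhd_sin).smul analyticOnNhd_const)
    have h2 := (analyticOnNhd_aeval h1 p).eq_of_eventuallyEq
      (analyticOnNhd_const (v := (0 : R →L[ℝ] R))) (z₀ := 0) (by
        filter_upwards [h] with α hα
        ext a
        have := aeval_toContinuousLinearMap (Real.cos α • S₀ + Real.sin α • S₁) p a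
        rw [map_add, map_smul, map_smul, hα.1] at this
        exact this)
    have h3 := congrFun h2 Real.pi
    simp only [Real.cos_pi, Real.sin_pi, neg_smul, one_smul, zero_smul, add_zero] at h3
    ext a
    have := aeval_toContinuousLinearMap (-S₀) p a
    rw [map_neg, h3] at this
    exact this.symm
  · have h1 : AnalyticOnNhd ℝ (fun α : ℝ => Real.cos α * LinearMap.trace ℝ R S₀
        + Real.sin α * LinearMap.trace ℝ R S₁) Set.univ :=
      ((Real.analyticOnNhd_cos).mul analyticOnNhd_const).add
        ((Real.analyticOnNhd_sin).mul analyticOnNhd_const)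
    have h2 := h1.eq_of_eventuallyEq (analyticOnNhd_const (v := s)) (z₀ := 0) (by
        filter_upwards [h] with α hα
        rw [← hα.2]
        simp)
    have h3 := congrFun h2 Real.pi
    have h4 := congrFun h2 0
    simp at h3 h4
    linarith

namespace IsoparametricPatch

variable {O : Set E} {f ν : E → V} {K : Finset ℝ} (h : IsoparametricPatch O f ν K) {u₀ : E}
  {κ₀ θ : ℝ}
include h

/-- The principal curvatures of a focal submanifold are symmetric about zero. -/
theorem focal_symmetry (hu : u₀ ∈ O) (hκ : κ₀ ∈ K) (hθ : Real.cos θ = κ₀ * Real.sin θ)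
    (hs : Real.sin θ ≠ 0) :
    (∀ κ ∈ K.erase κ₀, ∃ μ ∈ K.erase κ₀,
      (1 + κ₀ * μ) / (κ₀ - μ) = -((1 + κ₀ * κ) / (κ₀ - κ))) ∧
    ∑ κ ∈ K.erase κ₀,
        (1 + κ₀ * κ) / (κ₀ - κ) * eigenMult K (shapeOperator f ν u₀) κ = 0 := by
  obtain ⟨R₀, hR₀⟩ : ∃ R₀, R₀ =
    LinearMap.range (fderiv ℝ (normalGeodesic f ν θ) u₀ : E →ₗ[ℝ] V) := ⟨_, rfl⟩
  obtain ⟨T, hT⟩ := h.exists_focal_shape_family hu hκ hθ hs R₀ hR₀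
  obtain ⟨e, he, hAe⟩ := h.exists_eigenvector hu hκ
  have hne : fderiv ℝ f u₀ e ≠ 0 := fun h0 =>
    he ((injective_iff_map_eq_zero _).mp (h.immersion u₀ hu) e h0)
  have hnorm : ‖fderiv ℝ f u₀ e‖ ≠ 0 := norm_ne_zero_iff.mpr hne
  -- A unit normal orthogonal to `n u₀`, taken in the leaf direction; it spans with `n u₀` the plane
  -- in which the normal is rotated.
  obtain ⟨y, hy⟩ : ∃ y, y = ‖fderiv ℝ f u₀ e‖⁻¹ • fderiv ℝ f u₀ e := ⟨_, rfl⟩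
  set φ := normalGeodesic f ν θ with hφ
  set n := normalVelocity f ν θ with hn
  have hyy : inner ℝ y y = 1 := by
    rw [hy, inner_smul_left, inner_smul_right, real_inner_self_eq_norm_sq]
    simp only [conj_trivial]
    field_simp
  have hny : inner ℝ (n u₀) y = 0 := by
    rw [hy, inner_smul_right, hn, h.inner_normalVelocity_fderiv hu, mul_zero]
  have hyφ : inner ℝ y (φ u₀) = 0 := by
    rw [real_inner_comm, hy, inner_smul_right, hφ, h.inner_normalGeodesic_fderiv hu, mul_zero]
  have hyR : ∀ r ∈ R₀, inner ℝ y r = 0 := by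
    intro r hr
    rw [hR₀] at hr
    obtain ⟨v, rfl⟩ := hr
    rw [hy, inner_smul_left]
    exact mul_eq_zero_of_right _ (h.inner_leaf_focal hu hθ hAe v)
  have hnn : inner ℝ (n u₀) (n u₀) = 1 := h.inner_normalVelocity_self hu θ
  have hnφ : inner ℝ (n u₀) (φ u₀) = 0 := h.inner_normalVelocity_normalGeodesic hu θ
  have hnR : ∀ r ∈ R₀, inner ℝ (n u₀) r = 0 := by
    intro r hr
    rw [hR₀] at hr
    obtain ⟨v, rfl⟩ := hr
    exact h.inner_normalVelocity_fderiv_normalGeodesic hu θ v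
  have hc : ContinuousAt (fun α : ℝ => Real.cos α • n u₀ + Real.sin α • y) 0 := by fun_prop
  have hc' : Filter.Tendsto (fun α : ℝ => Real.cos α • n u₀ + Real.sin α • y) (nhds 0)
      (nhds (n u₀)) := by
    have := hc.tendsto
    rwa [Real.cos_zero, Real.sin_zero, one_smul, zero_smul, add_zero] at this
  have hev := hc'.eventually hT
  have hrot := rotation_isospectral (T (n u₀)) (T y) (∏ κ ∈ K.erase κ₀,
        (Polynomial.X - Polynomial.C ((1 + κ₀ * κ) / (κ₀ - κ)))) (∑ κ ∈ K.erase κ₀,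
        (1 + κ₀ * κ) / (κ₀ - κ) * eigenMult K (shapeOperator f ν u₀) κ) (by
    filter_upwards [hev] with α hα
    have hny' : inner ℝ y (n u₀) = 0 := by rw [real_inner_comm]; exact hny
    have g1 : inner ℝ (Real.cos α • n u₀ + Real.sin α • y) (Real.cos α • n u₀ + Real.sin α • y)
        = 1 := by
      simp only [inner_add_left, inner_add_right, inner_smul_left, inner_smul_right, hnn, hyy,
        hny, hny', conj_trivial]
      linarith [Real.sin_sq_add_cos_sq α]
    have g2 : inner ℝ (Real.cos α • n u₀ + Real.sin α • y) (φ u₀) = 0 := by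
      simp [inner_add_left, inner_smul_left, hnφ, hyφ]
    have g3 : ∀ r ∈ R₀, inner ℝ (Real.cos α • n u₀ + Real.sin α • y) r = 0 := fun r hr => by
      simp [inner_add_left, inner_smul_left, hnR r hr, hyR r hr]
    obtain ⟨h1, h2, -⟩ := hα g1 g2 g3
    rw [map_add, map_smul, map_smul] at h1 h2
    exact ⟨h1, h2⟩)
  refine ⟨fun κ hκe => ?_, hrot.2⟩
  obtain ⟨-, -, h3⟩ := hT.self_of_nhds hnn hnφ hnR
  obtain ⟨a, ha, hTa⟩ := h3 κ hκe
  -- The vector `a` is an eigenvector of `-T (n u₀)` for the opposite curvature, so this opposite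
  -- must be a root of the product, that is, another focal curvature.
  have h4 : Polynomial.aeval (LinearMap.toContinuousLinearMap (-T (n u₀)))
      (∏ κ ∈ K.erase κ₀, (Polynomial.X - Polynomial.C ((1 + κ₀ * κ) / (κ₀ - κ)))) a = 0 := by
    rw [aeval_toContinuousLinearMap, hrot.1]; rfl
  rw [aeval_apply_of_eigenvector (κ := -((1 + κ₀ * κ) / (κ₀ - κ)))] at h4
  · rcases smul_eq_zero.mp h4 with h5 | h5
    · rw [Polynomial.eval_prod, Finset.prod_eq_zero_iff] at h5
      obtain ⟨μ, hμ, h6⟩ := h5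
      refine ⟨μ, hμ, ?_⟩
      simp only [Polynomial.eval_sub, Polynomial.eval_X, Polynomial.eval_C] at h6
      linarith
    · exact absurd h5 ha
  · change (-T (n u₀)) a = _
    rw [LinearMap.neg_apply, hTa, neg_smul]

end IsoparametricPatch

end FocalSymmetry

/-! ### Spacing of the principal angles and equality of multiplicities -/

section Angles

theorem cotangent_difference_injective {κ₀ κ μ : ℝ} (hκ : κ ≠ κ₀) (hμ : μ ≠ κ₀)
    (h : (1 + κ₀ * κ) / (κ₀ - κ) = (1 + κ₀ * μ) / (κ₀ - μ)) : κ = μ := by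
  have h1 : κ₀ - κ ≠ 0 := sub_ne_zero.mpr hκ.symm
  have h2 : κ₀ - μ ≠ 0 := sub_ne_zero.mpr hμ.symm
  rw [div_eq_div_iff h1 h2] at h
  have h3 : (κ - μ) * (1 + κ₀ ^ 2) = 0 := by linear_combination h
  rcases mul_eq_zero.mp h3 with h4 | h4
  · linarith
  · nlinarith [sq_nonneg κ₀]

/-- A symmetric set of three reals contains zero, and the other two are opposite. -/
theorem zero_of_three_symmetric {x y z : ℝ} (hxy : x ≠ y) (hxz : x ≠ z) (hyz : y ≠ z)
    (hx : -x = x ∨ -x = y ∨ -x = z) (hy : -y = x ∨ -y = y ∨ -y = z)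
    (hz : -z = x ∨ -z = y ∨ -z = z) :
    (x = 0 ∧ y = -z) ∨ (y = 0 ∧ x = -z) ∨ (z = 0 ∧ x = -y) := by
  rcases hx with h | h | h <;> rcases hy with h' | h' | h' <;> rcases hz with h'' | h'' | h'' <;>
    first
    | (exfalso; apply hxy; linarith)
    | (exfalso; apply hxz; linarith)
    | (exfalso; apply hyz; linarith)
    | (left; constructor <;> linarith)
    | (right; left; constructor <;> linarith)
    | (right; right; constructor <;> linarith)

/-- `κ₁` is the cotangent of the angle that exceeds the angle of `κ₀` by a quarter of `π`, and
so on. -/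
structure IsQuarterSpaced (K : Finset ℝ) (κ₀ κ₁ κ₂ κ₃ : ℝ) : Prop where
  eq : K = {κ₀, κ₁, κ₂, κ₃}
  ne01 : κ₀ ≠ κ₁
  ne02 : κ₀ ≠ κ₂
  ne03 : κ₀ ≠ κ₃
  ne12 : κ₁ ≠ κ₂
  ne13 : κ₁ ≠ κ₃
  ne23 : κ₂ ≠ κ₃
  rel1 : 1 + κ₀ * κ₁ = κ₀ - κ₁
  rel2 : 1 + κ₀ * κ₂ = 0
  rel3 : 1 + κ₀ * κ₃ = κ₃ - κ₀

/-- The three focal curvatures at `κ₀` are distinct and form a symmetric set, so one is zero and the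
other two are opposite. A zero cotangent means that the angles of `κ₀` and `b` differ by `π/2`. -/
theorem exists_orthogonal_pair {K : Finset ℝ} (hK : K.card = 4)
    (hsym : ∀ κ₀ ∈ K, ∀ κ ∈ K.erase κ₀, ∃ μ ∈ K.erase κ₀,
      (1 + κ₀ * μ) / (κ₀ - μ) = -((1 + κ₀ * κ) / (κ₀ - κ))) {κ₀ : ℝ} (hκ₀ : κ₀ ∈ K) :
    ∃ a b c, K = {κ₀, a, b, c} ∧ a ≠ κ₀ ∧ b ≠ κ₀ ∧ c ≠ κ₀ ∧ a ≠ b ∧ a ≠ c ∧ b ≠ c ∧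
      1 + κ₀ * b = 0 ∧ (1 + κ₀ * a) / (κ₀ - a) = -((1 + κ₀ * c) / (κ₀ - c)) := by
  have h3 : (K.erase κ₀).card = 3 := by rw [Finset.card_erase_of_mem hκ₀, hK]
  obtain ⟨a, b, c, hab, hac, hbc, he⟩ := Finset.card_eq_three.mp h3
  have hK' : K = {κ₀, a, b, c} := by rw [← Finset.insert_erase hκ₀, he]
  have hmem : ∀ x, x ∈ ({a, b, c} : Finset ℝ) → x ≠ κ₀ := by
    intro x hx; rw [← he] at hx; exact Finset.ne_of_mem_erase hx
  have ha := hmem a (by simp)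
  have hb := hmem b (by simp)
  have hc := hmem c (by simp)
  have hs := hsym κ₀ hκ₀
  rw [he] at hs
  have hs' : ∀ x ∈ ({a, b, c} : Finset ℝ), -((1 + κ₀ * x) / (κ₀ - x)) = (1 + κ₀ * a) / (κ₀ - a) ∨
      -((1 + κ₀ * x) / (κ₀ - x)) = (1 + κ₀ * b) / (κ₀ - b) ∨
      -((1 + κ₀ * x) / (κ₀ - x)) = (1 + κ₀ * c) / (κ₀ - c) := by
    intro x hx
    obtain ⟨μ, hμ, h⟩ := hs x hx
    simp only [Finset.mem_insert, Finset.mem_singleton] at hμ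
    rcases hμ with rfl | rfl | rfl
    · exact Or.inl h.symm
    · exact Or.inr (Or.inl h.symm)
    · exact Or.inr (Or.inr h.symm)
  have hz : ∀ x, x ≠ κ₀ → (1 + κ₀ * x) / (κ₀ - x) = 0 → 1 + κ₀ * x = 0 := by
    intro x hx h
    exact (div_eq_zero_iff.mp h).resolve_right (sub_ne_zero.mpr hx.symm)
  rcases zero_of_three_symmetric (fun h => hab (cotangent_difference_injective ha hb h))
    (fun h => hac (cotangent_difference_injective ha hc h))
    (fun h => hbc (cotangent_difference_injective hb hc h)) (hs' a (by simp)) (hs' b (by simp))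
    (hs' c (by simp)) with ⟨h1, h2⟩ | ⟨h1, h2⟩ | ⟨h1, h2⟩
  · exact ⟨b, a, c, by rw [hK', Finset.insert_comm a b], hb, ha, hc, hab.symm, hbc, hac,
      hz a ha h1, h2⟩
  · exact ⟨a, b, c, hK', ha, hb, hc, hab, hac, hbc, hz b hb h1, h2⟩
  · exact ⟨a, c, b, by rw [hK', Finset.pair_comm b c], ha, hc, hb, hac, hab, hbc.symm,
      hz c hc h1, h2⟩

/-- The orthogonality relation splits the four angles into two pairs. The remaining pair is placed
symmetrically about the angle of `κ₀` and is itself orthogonal, which forces the differences `±π/4`.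
-/
theorem exists_isQuarterSpaced {K : Finset ℝ} (hK : K.card = 4)
    (hsym : ∀ κ₀ ∈ K, ∀ κ ∈ K.erase κ₀, ∃ μ ∈ K.erase κ₀,
      (1 + κ₀ * μ) / (κ₀ - μ) = -((1 + κ₀ * κ) / (κ₀ - κ))) {κ₀ : ℝ} (hκ₀ : κ₀ ∈ K) :
    ∃ κ₁ κ₂ κ₃, IsQuarterSpaced K κ₀ κ₁ κ₂ κ₃ := by
  obtain ⟨a, b, c, hK', ha, hb, hc, hab, hac, hbc, h0b, h⟩ := exists_orthogonal_pair hK hsym hκ₀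
  have haK : a ∈ K := by rw [hK']; simp
  obtain ⟨a', b', c', hK'', -, hb', -, -, -, -, h0b', -⟩ := exists_orthogonal_pair hK hsym haK
  have hb'K : b' ∈ K := by rw [hK'']; simp
  -- The partner of `a` cannot be `κ₀` or `b`, because partners are unique and these two are already
  -- paired with each other.
  have h1ac : 1 + a * c = 0 := by
    rw [hK'] at hb'K
    simp only [Finset.mem_insert, Finset.mem_singleton] at hb'K
    have hκ0 : κ₀ ≠ 0 := by rintro rfl; simp at h0b
    have hb0 : b ≠ 0 := by rintro rfl; simp at h0b
    rcases hb'K with rfl | rfl | rfl | rfl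
    · exfalso; apply hab
      have : b' * (a - b) = 0 := by linear_combination h0b' - h0b
      exact sub_eq_zero.mp ((mul_eq_zero.mp this).resolve_left hκ0)
    · exact absurd rfl hb'
    · exfalso; apply ha
      have : b' * (a - κ₀) = 0 := by linear_combination h0b' - h0b
      exact sub_eq_zero.mp ((mul_eq_zero.mp this).resolve_left hb0)
    · exact h0b'
  have hna : κ₀ - a ≠ 0 := sub_ne_zero.mpr ha.symm
  have hnc : κ₀ - c ≠ 0 := sub_ne_zero.mpr hc.symm
  rw [← neg_div, div_eq_div_iff hna hnc] at h
  have ha0 : a ≠ 0 := by rintro rfl; simp at h1ac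
  -- Eliminating `c` by `1 + a c = 0` turns the symmetry relation into a difference of squares. The
  -- two signs say whether `a` or `c` is the angle that follows `κ₀`.
  have hsq : ((1 + κ₀ * a) - (κ₀ - a)) * ((1 + κ₀ * a) + (κ₀ - a)) = 0 := by
    linear_combination a * h + ((1 + κ₀ * a) - κ₀ * (κ₀ - a)) * h1ac
  have hrel : ∀ x y, x ≠ 0 → 1 + x * y = 0 → 1 + κ₀ * x = κ₀ - x → 1 + κ₀ * y = y - κ₀ := by
    intro x y hx hxy h1
    have : x * ((1 + κ₀ * y) - (y - κ₀)) = 0 := by linear_combination (κ₀ - 1) * hxy + h1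
    linarith [(mul_eq_zero.mp this).resolve_left hx]
  have hrel' : ∀ x y, x ≠ 0 → 1 + x * y = 0 → 1 + κ₀ * x = x - κ₀ → 1 + κ₀ * y = κ₀ - y := by
    intro x y hx hxy h1
    have : x * ((1 + κ₀ * y) - (κ₀ - y)) = 0 := by linear_combination (κ₀ + 1) * hxy - h1
    linarith [(mul_eq_zero.mp this).resolve_left hx]
  rcases mul_eq_zero.mp hsq with h1 | h1
  · exact ⟨a, b, c, hK', ha.symm, hb.symm, hc.symm, hab, hac, hbc, by linarith, h0b,
      hrel a c ha0 h1ac (by linarith)⟩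
  · refine ⟨c, b, a, ?_, hc.symm, hb.symm, ha.symm, hbc.symm, hac.symm, hab.symm,
      hrel' a c ha0 h1ac (by linarith), h0b, by linarith⟩
    rw [hK']; ext x; simp only [Finset.mem_insert, Finset.mem_singleton]; tauto

namespace IsQuarterSpaced

variable {K : Finset ℝ} {κ₀ κ₁ κ₂ κ₃ θ : ℝ}

theorem rel13 (hK : IsQuarterSpaced K κ₀ κ₁ κ₂ κ₃) : 1 + κ₁ * κ₃ = 0 := by
  have h1 := hK.rel1
  have h3 := hK.rel3
  have h : (1 - κ₀) * ((1 + κ₀) * (1 + κ₁ * κ₃)) = 0 := by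
    linear_combination κ₃ * (1 - κ₀) * h1 + (1 - κ₀) * h3
  have hm : 1 - κ₀ ≠ 0 := by
    intro h0
    have : κ₀ = 1 := by linarith
    rw [this] at h3
    linarith
  have hp : 1 + κ₀ ≠ 0 := by
    intro h0
    have : κ₀ = -1 := by linarith
    rw [this] at h1
    linarith
  exact (mul_eq_zero.mp ((mul_eq_zero.mp h).resolve_left hm)).resolve_left hp

theorem sum_eq (hK : IsQuarterSpaced K κ₀ κ₁ κ₂ κ₃) {G : Type*} [AddCommMonoid G] (x : ℝ → G) :
    ∑ κ ∈ K, x κ = x κ₀ + (x κ₁ + (x κ₂ + x κ₃)) := by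
  rw [hK.eq, Finset.sum_insert, Finset.sum_insert, Finset.sum_insert, Finset.sum_singleton]
  · simpa using hK.ne23
  · simp [hK.ne12, hK.ne13]
  · simp [hK.ne01, hK.ne02, hK.ne03]

theorem mem (hK : IsQuarterSpaced K κ₀ κ₁ κ₂ κ₃) : κ₀ ∈ K ∧ κ₁ ∈ K ∧ κ₂ ∈ K ∧ κ₃ ∈ K := by
  rw [hK.eq]; simp

/-- The quarter spacing, seen from the next angle. -/
theorem rotate (hK : IsQuarterSpaced K κ₀ κ₁ κ₂ κ₃) : IsQuarterSpaced K κ₁ κ₂ κ₃ κ₀ := by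
  have h1 := hK.rel1
  have h2 := hK.rel2
  have hκ0 : κ₀ ≠ 0 := by rintro rfl; simp at h2
  refine ⟨?_, hK.ne12, hK.ne13, hK.ne01.symm, hK.ne23, hK.ne02.symm, hK.ne03.symm, ?_,
    hK.rel13, by linarith⟩
  · rw [hK.eq]; ext x; simp only [Finset.mem_insert, Finset.mem_singleton]; tauto
  · have : κ₀ * ((1 + κ₁ * κ₂) - (κ₁ - κ₂)) = 0 := by linear_combination (κ₁ + 1) * h2 - h1
    linarith [(mul_eq_zero.mp this).resolve_left hκ0]

theorem angle1 (hK : IsQuarterSpaced K κ₀ κ₁ κ₂ κ₃) (hθ : Real.cos θ = κ₀ * Real.sin θ) :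
    Real.cos (θ + Real.pi / 4) = κ₁ * Real.sin (θ + Real.pi / 4) := by
  rw [Real.cos_add, Real.sin_add, Real.cos_pi_div_four, Real.sin_pi_div_four, hθ]
  linear_combination (-(Real.sin θ * (Real.sqrt 2 / 2))) * hK.rel1

end IsQuarterSpaced

variable {E V : Type*} [NormedAddCommGroup E] [InnerProductSpace ℝ E] [FiniteDimensional ℝ E]
  [NormedAddCommGroup V] [InnerProductSpace ℝ V] [FiniteDimensional ℝ V]

theorem exists_cotangent (κ : ℝ) : ∃ θ, Real.cos θ = κ * Real.sin θ ∧ Real.sin θ ≠ 0 := by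
  refine ⟨Real.pi / 2 - Real.arctan κ, ?_, ?_⟩
  · rw [Real.cos_pi_div_two_sub, Real.sin_pi_div_two_sub]
    have h := Real.tan_arctan κ
    rw [Real.tan_eq_sin_div_cos, div_eq_iff (Real.cos_arctan_pos κ).ne'] at h
    exact h
  · rw [Real.sin_pi_div_two_sub]; exact (Real.cos_arctan_pos κ).ne'

namespace IsoparametricPatch

variable {O : Set E} {f ν : E → V} {K : Finset ℝ} (h : IsoparametricPatch O f ν K) {u : E}
include h

theorem exists_isQuarterSpaced (hu : u ∈ O) (hK : K.card = 4) {κ₀ : ℝ} (hκ₀ : κ₀ ∈ K) :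
    ∃ κ₁ κ₂ κ₃, IsQuarterSpaced K κ₀ κ₁ κ₂ κ₃ := by
  refine _root_.exists_isQuarterSpaced hK (fun κ hκ => ?_) hκ₀
  obtain ⟨θ, hθ, hs⟩ := exists_cotangent κ
  exact (h.focal_symmetry hu hκ hθ hs).1

/-- The focal curvatures at `κ₀` are `1`, `0`, `-1`, so the vanishing trace is the difference of the
two multiplicities. -/
theorem eigenMult_eq (hu : u ∈ O) {κ₀ κ₁ κ₂ κ₃ : ℝ} (hK : IsQuarterSpaced K κ₀ κ₁ κ₂ κ₃) :
    eigenMult K (shapeOperator f ν u) κ₁ = eigenMult K (shapeOperator f ν u) κ₃ := by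
  obtain ⟨θ, hθ, hs⟩ := exists_cotangent κ₀
  have h1 := (h.focal_symmetry hu hK.mem.1 hθ hs).2
  have h2 : ∀ x : ℝ → ℝ, ∑ κ ∈ K.erase κ₀, x κ = x κ₁ + (x κ₂ + x κ₃) := by
    intro x
    have := hK.sum_eq x
    rw [← Finset.add_sum_erase K x hK.mem.1] at this
    linarith
  rw [h2, hK.rel1, hK.rel2, hK.rel3, div_self (sub_ne_zero.mpr hK.ne01), zero_div,
    ← neg_sub κ₀ κ₃, neg_div, div_self (sub_ne_zero.mpr hK.ne03)] at h1
  linarith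

end IsoparametricPatch

end Angles

/-! ### Calculus of the Laplacian and Bochner's formula -/

section Harmonic

variable {V : Type*} [NormedAddCommGroup V] [InnerProductSpace ℝ V]
  {ι : Type*} [Fintype ι] (b : OrthonormalBasis ι ℝ V)

/-- The partial derivative in the direction of the `i`-th basis vector. -/
def partialDeriv (i : ι) (F : V → ℝ) (x : V) : ℝ := fderiv ℝ F x (b i)

/-- The sum of the second partial derivatives. -/
def laplacianSum (F : V → ℝ) (x : V) : ℝ := ∑ i, partialDeriv b i (partialDeriv b i F) x

variable {W : Set V} (hW : IsOpen W) {F G : V → ℝ} {x : V}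
include hW

theorem differentiableAt_of_contDiffOn (hF : ContDiffOn ℝ ∞ F W) (hx : x ∈ W) :
    DifferentiableAt ℝ F x :=
  (hF.contDiffAt (hW.mem_nhds hx)).differentiableAt (by simp)

theorem contDiffOn_partialDeriv (hF : ContDiffOn ℝ ∞ F W) (i : ι) :
    ContDiffOn ℝ ∞ (partialDeriv b i F) W := fun x hx =>
  (((hF.contDiffAt (hW.mem_nhds hx)).fderiv_right (m := ∞) (by simp)).clm_apply
    contDiffAt_const).contDiffWithinAt

theorem partialDeriv_congr (h : ∀ x ∈ W, F x = G x) (i : ι) :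
    ∀ x ∈ W, partialDeriv b i F x = partialDeriv b i G x := by
  intro x hx
  have : F =ᶠ[nhds x] G := Filter.eventually_of_mem (hW.mem_nhds hx) h
  rw [partialDeriv, partialDeriv, this.fderiv_eq]

theorem laplacianSum_congr (h : ∀ x ∈ W, F x = G x) :
    ∀ x ∈ W, laplacianSum b F x = laplacianSum b G x := by
  intro x hx
  exact Finset.sum_congr rfl fun i _ =>
    partialDeriv_congr b hW (partialDeriv_congr b hW h i) i x hx

theorem partialDeriv_comm (hF : ContDiffOn ℝ ∞ F W) (i j : ι) :
    ∀ x ∈ W, partialDeriv b i (partialDeriv b j F) x = partialDeriv b j (partialDeriv b i F) x := by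
  intro x hx
  have hs := hF.contDiffAt (hW.mem_nhds hx)
  have hd : DifferentiableAt ℝ (fderiv ℝ F) x :=
    (hs.fderiv_right (m := ∞) (by simp)).differentiableAt (by simp)
  have key : ∀ i j, partialDeriv b i (partialDeriv b j F) x
      = fderiv ℝ (fderiv ℝ F) x (b i) (b j) := by
    intro i j
    have h1 := hd.hasFDerivAt.clm_apply (hasFDerivAt_const (b j) x)
    have h2 : fderiv ℝ (partialDeriv b j F) x = _ := h1.fderiv
    rw [partialDeriv, h2]
    simp
  rw [key, key, (isSymmSndFDerivAt_of_smooth hs).eq]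

theorem partialDeriv_add (hF : ContDiffOn ℝ ∞ F W) (hG : ContDiffOn ℝ ∞ G W) (i : ι) :
    ∀ x ∈ W, partialDeriv b i (fun x => F x + G x) x
      = partialDeriv b i F x + partialDeriv b i G x := by
  intro x hx
  rw [partialDeriv, fderiv_fun_add (differentiableAt_of_contDiffOn hW hF hx)
    (differentiableAt_of_contDiffOn hW hG hx)]
  rfl

theorem partialDeriv_const_mul (hF : ContDiffOn ℝ ∞ F W) (c : ℝ) (i : ι) :
    ∀ x ∈ W, partialDeriv b i (fun x => c * F x) x = c * partialDeriv b i F x := by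
  intro x hx
  rw [partialDeriv, fderiv_const_mul (differentiableAt_of_contDiffOn hW hF hx)]
  rfl

theorem partialDeriv_mul (hF : ContDiffOn ℝ ∞ F W) (hG : ContDiffOn ℝ ∞ G W) (i : ι) :
    ∀ x ∈ W, partialDeriv b i (fun x => F x * G x) x
      = F x * partialDeriv b i G x + G x * partialDeriv b i F x := by
  intro x hx
  rw [partialDeriv, fderiv_fun_mul (differentiableAt_of_contDiffOn hW hF hx)
    (differentiableAt_of_contDiffOn hW hG hx)]
  rfl

theorem partialDeriv_sum {A : Type*} (s : Finset A) {g : A → V → ℝ}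
    (hg : ∀ a, ContDiffOn ℝ ∞ (g a) W) (i : ι) :
    ∀ x ∈ W, partialDeriv b i (fun x => ∑ a ∈ s, g a x) x = ∑ a ∈ s, partialDeriv b i (g a) x := by
  intro x hx
  rw [partialDeriv, fderiv_fun_sum fun a _ => differentiableAt_of_contDiffOn hW (hg a) hx]
  simp [partialDeriv]

theorem laplacianSum_add (hF : ContDiffOn ℝ ∞ F W) (hG : ContDiffOn ℝ ∞ G W) :
    ∀ x ∈ W, laplacianSum b (fun x => F x + G x) x = laplacianSum b F x + laplacianSum b G x := by
  intro x hx
  rw [laplacianSum, laplacianSum, laplacianSum, ← Finset.sum_add_distrib]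
  refine Finset.sum_congr rfl fun i _ => ?_
  rw [partialDeriv_congr b hW (partialDeriv_add b hW hF hG i) i x hx,
    partialDeriv_add b hW (contDiffOn_partialDeriv b hW hF i)
      (contDiffOn_partialDeriv b hW hG i) i x hx]

theorem laplacianSum_const_mul (hF : ContDiffOn ℝ ∞ F W) (c : ℝ) :
    ∀ x ∈ W, laplacianSum b (fun x => c * F x) x = c * laplacianSum b F x := by
  intro x hx
  rw [laplacianSum, laplacianSum, Finset.mul_sum]
  refine Finset.sum_congr rfl fun i _ => ?_
  rw [partialDeriv_congr b hW (partialDeriv_const_mul b hW hF c i) i x hx,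
    partialDeriv_const_mul b hW (contDiffOn_partialDeriv b hW hF i) c i x hx]

theorem laplacianSum_sum {A : Type*} (s : Finset A) {g : A → V → ℝ}
    (hg : ∀ a, ContDiffOn ℝ ∞ (g a) W) :
    ∀ x ∈ W, laplacianSum b (fun x => ∑ a ∈ s, g a x) x = ∑ a ∈ s, laplacianSum b (g a) x := by
  intro x hx
  simp only [laplacianSum]
  rw [Finset.sum_comm]
  refine Finset.sum_congr rfl fun i _ => ?_
  rw [partialDeriv_congr b hW (partialDeriv_sum b hW s hg i) i x hx,
    partialDeriv_sum b hW s (fun a => contDiffOn_partialDeriv b hW (hg a) i) i x hx]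

theorem laplacianSum_mul (hF : ContDiffOn ℝ ∞ F W) (hG : ContDiffOn ℝ ∞ G W) :
    ∀ x ∈ W, laplacianSum b (fun x => F x * G x) x
      = F x * laplacianSum b G x + G x * laplacianSum b F x
        + 2 * ∑ i, partialDeriv b i F x * partialDeriv b i G x := by
  intro x hx
  simp only [laplacianSum]
  rw [Finset.mul_sum, Finset.mul_sum, Finset.mul_sum, ← Finset.sum_add_distrib,
    ← Finset.sum_add_distrib]
  refine Finset.sum_congr rfl fun i _ => ?_
  have hF' := contDiffOn_partialDeriv b hW hF i
  have hG' := contDiffOn_partialDeriv b hW hG i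
  rw [partialDeriv_congr b hW (partialDeriv_mul b hW hF hG i) i x hx,
    partialDeriv_add b hW (hF.mul hG') (hG.mul hF') i x hx,
    partialDeriv_mul b hW hF hG' i x hx, partialDeriv_mul b hW hG hF' i x hx]
  ring

theorem laplacianSum_partialDeriv (hF : ContDiffOn ℝ ∞ F W)
    (h : ∀ x ∈ W, laplacianSum b F x = 0) (i : ι) :
    ∀ x ∈ W, laplacianSum b (partialDeriv b i F) x = 0 := by
  intro x hx
  have h1 := partialDeriv_congr b hW h i x hx
  have h2 : partialDeriv b i (fun _ => (0 : ℝ)) x = 0 := by simp [partialDeriv]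
  rw [h2] at h1
  rw [← h1]
  unfold laplacianSum
  rw [partialDeriv_sum b hW _ (fun j => contDiffOn_partialDeriv b hW
    (contDiffOn_partialDeriv b hW hF j) j) i x hx]
  refine Finset.sum_congr rfl fun j _ => ?_
  rw [partialDeriv_congr b hW (partialDeriv_comm b hW hF j i) j x hx,
    partialDeriv_comm b hW (contDiffOn_partialDeriv b hW hF j) j i x hx]

/-- Bochner's formula for a family of harmonic functions. -/
theorem sum_sq_partialDeriv {A : Type*} [Fintype A] {g : A → V → ℝ}
    (hg : ∀ a, ContDiffOn ℝ ∞ (g a) W) (hharm : ∀ a, ∀ x ∈ W, laplacianSum b (g a) x = 0)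
    {q : V → ℝ} (hq : ∀ x ∈ W, ∑ a, g a x ^ 2 = q x) :
    ∀ x ∈ W, ∑ p : A × ι, partialDeriv b p.2 (g p.1) x ^ 2 = 1 / 2 * laplacianSum b q x := by
  intro x hx
  rw [← laplacianSum_congr b hW hq x hx]
  simp only [pow_two]
  -- For harmonic `g` the Laplacian of `g²` is twice the square norm of the gradient.
  rw [laplacianSum_sum b hW _ (fun a => (hg a).mul (hg a)) x hx, Finset.mul_sum,
    Fintype.sum_prod_type]
  refine Finset.sum_congr rfl fun a _ => ?_
  rw [laplacianSum_mul b hW (hg a) (hg a) x hx, hharm a x hx]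
  ring

omit hW in
theorem partialDeriv_inner_self (i : ι) (x : V) :
    partialDeriv b i (fun x => inner ℝ x x) x = 2 * inner ℝ (b i) x := by
  have h := (hasFDerivAt_id (𝕜 := ℝ) x).inner ℝ (hasFDerivAt_id x)
  have h2 : fderiv ℝ (fun x : V => inner ℝ x x) x = _ := h.fderiv
  rw [partialDeriv, h2]
  simp [real_inner_comm]
  ring

omit hW in
theorem partialDeriv_inner_const (i j : ι) (x : V) :
    partialDeriv b i (fun x => inner ℝ (b j) x) x = inner ℝ (b j) (b i) := by
  have h : HasFDerivAt (fun x : V => inner ℝ (b j) x) (innerSL ℝ (b j)) x :=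
    (innerSL ℝ (b j)).hasFDerivAt
  rw [partialDeriv, h.fderiv]
  simp

omit hW in
theorem contDiff_inner_self : ContDiff ℝ ∞ fun x : V => (inner ℝ x x : ℝ) :=
  contDiff_id.inner ℝ contDiff_id

omit hW in
theorem laplacianSum_inner_self (x : V) :
    laplacianSum b (fun x => inner ℝ x x) x = 2 * Fintype.card ι := by
  have h : ∀ i, partialDeriv b i (fun x => inner ℝ x x) = fun x => 2 * inner ℝ (b i) x :=
    fun i => funext (partialDeriv_inner_self b i)
  simp only [laplacianSum, h]
  have h2 : ∀ i, partialDeriv b i (fun x => 2 * inner ℝ (b i) x) x = 2 := by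
    intro i
    have hs : ContDiffOn ℝ ∞ (fun x : V => (inner ℝ (b i) x : ℝ)) Set.univ :=
      (contDiff_const.inner ℝ contDiff_id).contDiffOn
    rw [partialDeriv_const_mul b isOpen_univ hs 2 i x trivial, partialDeriv_inner_const]
    simp
  simp [h2]
  ring

theorem sum_partialDeriv_inner_self (F : V → ℝ) (x : V) :
    ∑ i, partialDeriv b i (fun x => inner ℝ x x) x * partialDeriv b i F x
      = 2 * ∑ i, inner ℝ (b i) x * partialDeriv b i F x := by
  rw [Finset.mul_sum]
  exact Finset.sum_congr rfl fun i _ => by rw [partialDeriv_inner_self]; ring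

end Harmonic

/-! ### Euler's relation and vanishing of the fifth derivatives -/

section Harmonic

variable {V : Type*} [NormedAddCommGroup V] [InnerProductSpace ℝ V]
  {ι : Type*} [Fintype ι] (b : OrthonormalBasis ι ℝ V)

/-- The derivative in the radial direction, at `x` in the direction of `x`. -/
def eulerSum (F : V → ℝ) (x : V) : ℝ := ∑ i, inner ℝ (b i) x * partialDeriv b i F x

theorem eulerSum_eq_fderiv (F : V → ℝ) (x : V) : eulerSum b F x = fderiv ℝ F x x := by
  conv_rhs => rw [← b.sum_repr' x, map_sum]
  rw [eulerSum, b.sum_repr' x]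
  exact Finset.sum_congr rfl fun i _ => by rw [map_smul]; rfl

theorem eulerSum_inner_self (x : V) :
    eulerSum b (fun x => inner ℝ x x) x = 2 * inner ℝ x x := by
  rw [eulerSum, ← b.sum_inner_mul_inner x x, Finset.mul_sum]
  refine Finset.sum_congr rfl fun i _ => ?_
  rw [partialDeriv_inner_self, real_inner_comm x (b i)]
  ring

variable {W : Set V} (hW : IsOpen W) {F G : V → ℝ} {x : V}
include hW

theorem laplacianSum_inner_self_mul (hF : ContDiffOn ℝ ∞ F W) {k : ℝ}
    (hk : ∀ x ∈ W, eulerSum b F x = k * F x) :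
    ∀ x ∈ W, laplacianSum b (fun x => inner ℝ x x * F x) x
      = inner ℝ x x * laplacianSum b F x + (2 * Fintype.card ι + 4 * k) * F x := by
  intro x hx
  have hk' := hk x hx
  rw [eulerSum] at hk'
  rw [laplacianSum_mul b hW contDiff_inner_self.contDiffOn hF x hx, laplacianSum_inner_self,
    sum_partialDeriv_inner_self b hW, hk']
  ring

theorem eulerSum_inner_self_sq (x : V) :
    eulerSum b (fun x => inner ℝ x x * inner ℝ x x) x = 4 * (inner ℝ x x * inner ℝ x x) := by
  have hs : ContDiffOn ℝ ∞ (fun x : V => (inner ℝ x x : ℝ)) Set.univ :=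
    contDiff_inner_self.contDiffOn
  have h := eulerSum_inner_self b x
  rw [eulerSum] at h ⊢
  have : ∀ i, partialDeriv b i (fun x => inner ℝ x x * inner ℝ x x) x
      = 2 * (inner ℝ x x * partialDeriv b i (fun x => inner ℝ x x) x) := by
    intro i
    rw [partialDeriv_mul b isOpen_univ hs hs i x trivial]
    ring
  calc _ = (2 * inner ℝ x x)
        * ∑ i, inner ℝ (b i) x * partialDeriv b i (fun x => inner ℝ x x) x := by
        rw [Finset.mul_sum]
        exact Finset.sum_congr rfl fun i _ => by rw [this]; ring
    _ = _ := by rw [h]; ring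

/-- A harmonic function, homogeneous of degree four, whose gradient has the square norm
`α r⁶ + β r² G`, is a polynomial of degree four. -/
theorem fifth_partialDeriv_eq_zero (hG : ContDiffOn ℝ ∞ G W)
    (hharm : ∀ x ∈ W, laplacianSum b G x = 0) (heuler : ∀ x ∈ W, eulerSum b G x = 4 * G x)
    {α β : ℝ} (hgrad : ∀ x ∈ W, ∑ i, partialDeriv b i G x ^ 2
      = α * (inner ℝ x x * (inner ℝ x x * inner ℝ x x)) + β * (inner ℝ x x * G x))
    (i j k l m : ι) : ∀ x ∈ W, partialDeriv b m (partialDeriv b l (partialDeriv b k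
      (partialDeriv b j (partialDeriv b i G)))) x = 0 := by
  obtain ⟨R, hR⟩ : ∃ R : V → ℝ, R = fun x => inner ℝ x x := ⟨_, rfl⟩
  have hRx : ∀ x, inner ℝ x x = R x := fun x => by rw [hR]
  have hRs : ContDiffOn ℝ ∞ R W := by rw [hR]; exact contDiff_inner_self.contDiffOn
  have hlR : ∀ x, laplacianSum b R x = 2 * Fintype.card ι := by
    rw [hR]; exact laplacianSum_inner_self b
  have hmul : ∀ F : V → ℝ, ContDiffOn ℝ ∞ F W → ∀ k : ℝ, (∀ x ∈ W, eulerSum b F x = k * F x) →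
      ∀ x ∈ W, laplacianSum b (fun x => R x * F x) x
      = R x * laplacianSum b F x + (2 * Fintype.card ι + 4 * k) * F x := by
    intro F hF k hk
    have := laplacianSum_inner_self_mul b hW hF hk
    rw [hR]; exact this
  have heR : ∀ x ∈ W, eulerSum b R x = 2 * R x := by
    rw [hR]; exact fun x _ => eulerSum_inner_self b x
  have heR2 : ∀ x ∈ W, eulerSum b (fun x => R x * R x) x = 4 * (R x * R x) := by
    rw [hR]; exact fun x _ => eulerSum_inner_self_sq b hW x
  simp only [hRx] at hgrad
  have hl2 := hmul R hRs 2 heR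
  have hl3 := hmul _ (hRs.mul hRs) 4 heR2
  have hlG := hmul G hG 4 heuler
  set N : ℝ := ((Fintype.card ι : ℕ) : ℝ) with hN
  have h1s := fun i => contDiffOn_partialDeriv b hW hG i
  -- Every derivative of `G` is harmonic, so Bochner's formula can be iterated. With `R = r²`, the
  -- sums of squares of the derivatives of orders one to five are combinations of `R³` and `RG`,
  -- then of `R²` and `G`, then a multiple of `R`, a constant, and zero.
  have h1 := sum_sq_partialDeriv b hW h1s (laplacianSum_partialDeriv b hW hG hharm) hgrad
  have h1' : ∀ x ∈ W, ∑ p : ι × ι, partialDeriv b p.2 (partialDeriv b p.1 G) x ^ 2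
      = (α * (3 * N + 12)) * (R x * R x) + (β * (N + 8)) * G x := by
    intro x hx
    rw [h1 x hx, laplacianSum_add b hW (contDiffOn_const.mul (hRs.mul (hRs.mul hRs)))
      (contDiffOn_const.mul (hRs.mul hG)) x hx,
      laplacianSum_const_mul b hW (hRs.mul (hRs.mul hRs)) α x hx,
      laplacianSum_const_mul b hW (hRs.mul hG) β x hx, hl3 x hx, hl2 x hx, hlG x hx, hharm x hx,
      hlR x]
    ring
  have h2s := fun p : ι × ι => contDiffOn_partialDeriv b hW (h1s p.1) p.2
  have hh1 := fun i => laplacianSum_partialDeriv b hW hG hharm i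
  have hh2 := fun p : ι × ι => laplacianSum_partialDeriv b hW (h1s p.1) (hh1 p.1) p.2
  have h2 := sum_sq_partialDeriv b hW h2s hh2 h1'
  have h2' : ∀ x ∈ W, ∑ p : (ι × ι) × ι,
      partialDeriv b p.2 (partialDeriv b p.1.2 (partialDeriv b p.1.1 G)) x ^ 2
      = (α * (3 * N + 12) * (2 * N + 4)) * R x := by
    intro x hx
    rw [h2 x hx, laplacianSum_add b hW (contDiffOn_const.mul (hRs.mul hRs))
      (contDiffOn_const.mul hG) x hx, laplacianSum_const_mul b hW (hRs.mul hRs) _ x hx,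
      laplacianSum_const_mul b hW hG _ x hx, hl2 x hx, hharm x hx, hlR x]
    ring
  have h3s := fun p : (ι × ι) × ι => contDiffOn_partialDeriv b hW (h2s p.1) p.2
  have hh3 := fun p : (ι × ι) × ι => laplacianSum_partialDeriv b hW (h2s p.1) (hh2 p.1) p.2
  have h3 := sum_sq_partialDeriv b hW h3s hh3 h2'
  have h3' : ∀ x ∈ W, ∑ p : ((ι × ι) × ι) × ι, partialDeriv b p.2 (partialDeriv b p.1.2
      (partialDeriv b p.1.1.2 (partialDeriv b p.1.1.1 G))) x ^ 2
      = α * (3 * N + 12) * (2 * N + 4) * N := by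
    intro x hx
    rw [h3 x hx, laplacianSum_const_mul b hW hRs _ x hx, hlR x]
    ring
  have h4s := fun p : ((ι × ι) × ι) × ι => contDiffOn_partialDeriv b hW (h3s p.1) p.2
  have hh4 := fun p : ((ι × ι) × ι) × ι =>
    laplacianSum_partialDeriv b hW (h3s p.1) (hh3 p.1) p.2
  have h4 := sum_sq_partialDeriv b hW h4s hh4 h3'
  intro x hx
  have h5 := h4 x hx
  have h6 : laplacianSum b (fun _ : V => α * (3 * N + 12) * (2 * N + 4) * N) x = 0 := by
    have h0 : ∀ i, partialDeriv b i (fun _ : V => α * (3 * N + 12) * (2 * N + 4) * N)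
        = fun _ => 0 := fun i => by funext y; simp [partialDeriv]
    simp only [laplacianSum, h0]
    simp [partialDeriv]
  rw [h6, mul_zero, Finset.sum_eq_zero_iff_of_nonneg (fun _ _ => sq_nonneg _)] at h5
  have := h5 ((((i, j), k), l), m) (Finset.mem_univ _)
  exact pow_eq_zero_iff (two_ne_zero) |>.mp this

/-- Euler's relation for the derivatives of a homogeneous function. -/
theorem eulerSum_partialDeriv (hF : ContDiffOn ℝ ∞ F W) {k : ℝ}
    (hk : ∀ x ∈ W, eulerSum b F x = k * F x) (i : ι) :
    ∀ x ∈ W, eulerSum b (partialDeriv b i F) x = (k - 1) * partialDeriv b i F x := by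
  classical
  intro x hx
  have h1 := partialDeriv_congr b hW hk i x hx
  rw [partialDeriv_const_mul b hW hF k i x hx] at h1
  have hc : ∀ j, ContDiffOn ℝ ∞ (fun x : V => (inner ℝ (b j) x : ℝ)) W := fun j =>
    (contDiff_const.inner ℝ contDiff_id).contDiffOn
  unfold eulerSum at h1
  rw [partialDeriv_sum b hW _ (fun j => (hc j).mul (contDiffOn_partialDeriv b hW hF j)) i x hx]
    at h1
  have h2 : ∀ j, partialDeriv b i (fun x => inner ℝ (b j) x * partialDeriv b j F x) x
      = inner ℝ (b j) x * partialDeriv b j (partialDeriv b i F) x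
        + partialDeriv b j F x * (if j = i then 1 else 0) := by
    intro j
    rw [partialDeriv_mul b hW (hc j) (contDiffOn_partialDeriv b hW hF j) i x hx,
      partialDeriv_inner_const, partialDeriv_comm b hW hF i j x hx,
      orthonormal_iff_ite.mp b.orthonormal]
  simp only [h2, Finset.sum_add_distrib, mul_ite, mul_one, mul_zero, Finset.sum_ite_eq',
    Finset.mem_univ, if_true] at h1
  rw [eulerSum]
  linarith

/-- On a convex open set, a smooth function that is homogeneous of degree four and has vanishing
fifth derivatives is a quartic form; here its gradient. -/
theorem exists_quartic_coefficients (hconv : Convex ℝ W) (hne : W.Nonempty)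
    (hG : ContDiffOn ℝ ∞ G W) (heuler : ∀ x ∈ W, eulerSum b G x = 4 * G x)
    (h5 : ∀ i j k l m, ∀ x ∈ W, partialDeriv b m (partialDeriv b l (partialDeriv b k
      (partialDeriv b j (partialDeriv b i G)))) x = 0) :
    ∃ C : ι → ι → ι → ι → ℝ, (∀ i j k l, C i j k l = C j i k l) ∧
      (∀ i j k l, C i j k l = C i k j l) ∧ (∀ i j k l, C i j k l = C i j l k) ∧
      ∀ i, ∀ x ∈ W, partialDeriv b i G x = 1 / 6 * ∑ j, inner ℝ (b j) x *
        ∑ k, inner ℝ (b k) x * ∑ l, inner ℝ (b l) x * C i j k l := by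
  obtain ⟨x₀, hx₀⟩ := hne
  have s1 := fun i => contDiffOn_partialDeriv b hW hG i
  have s2 := fun i j => contDiffOn_partialDeriv b hW (s1 i) j
  have s3 := fun i j k => contDiffOn_partialDeriv b hW (s2 i j) k
  have s4 := fun i j k l => contDiffOn_partialDeriv b hW (s3 i j k) l
  -- Vanishing fifth derivatives make the fourth ones constant on the convex set `W`; their values
  -- at `x₀` are the coefficients.
  have hconst : ∀ i j k l, ∀ x ∈ W, partialDeriv b l (partialDeriv b k
      (partialDeriv b j (partialDeriv b i G))) x = partialDeriv b l (partialDeriv b k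
      (partialDeriv b j (partialDeriv b i G))) x₀ := by
    intro i j k l x hx
    refine hW.is_const_of_fderiv_eq_zero (𝕜 := ℝ) hconv.isPreconnected
      (fun y hy => (differentiableAt_of_contDiffOn hW (s4 i j k l) hy).differentiableWithinAt)
      (fun y hy => ?_) hx hx₀
    ext v
    rw [← b.sum_repr' v, map_sum]
    refine Finset.sum_eq_zero fun m _ => ?_
    rw [map_smul]
    have : fderiv ℝ (partialDeriv b l (partialDeriv b k
      (partialDeriv b j (partialDeriv b i G)))) y (b m) = 0 := h5 i j k l m y hy
    rw [this, smul_zero]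
  have e2 := fun i => eulerSum_partialDeriv b hW hG heuler i
  have e3 := fun i j => eulerSum_partialDeriv b hW (s1 i) (e2 i) j
  have e4 := fun i j k => eulerSum_partialDeriv b hW (s2 i j) (e3 i j) k
  refine ⟨fun i j k l => partialDeriv b l (partialDeriv b k
      (partialDeriv b j (partialDeriv b i G))) x₀, ?_, ?_, ?_, ?_⟩
  · intro i j k l
    exact partialDeriv_congr b hW (partialDeriv_congr b hW (partialDeriv_comm b hW hG j i) k)
      l x₀ hx₀
  · intro i j k l
    exact partialDeriv_congr b hW (partialDeriv_comm b hW (s1 i) k j) l x₀ hx₀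
  · intro i j k l
    exact partialDeriv_comm b hW (s2 i j) l k x₀ hx₀
  · intro i x hx
    -- Euler's relation in degrees three, two and one recovers the gradient from the fourth
    -- derivatives, whence the factor `1 / 6`.
    have f2 := e2 i x hx
    have f3 := fun j => e3 i j x hx
    have f4 := fun j k => e4 i j k x hx
    unfold eulerSum at f2 f3 f4
    simp only [hconst _ _ _ _ x hx] at f4
    simp only [f4]
    have g3 : ∀ j, ∑ k, inner ℝ (b k) x * ((4 - 1 - 1 - 1) * partialDeriv b k (partialDeriv b j
        (partialDeriv b i G)) x) = 2 * partialDeriv b j (partialDeriv b i G) x := by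
      intro j
      have := f3 j
      norm_num at this ⊢
      exact this
    simp only [g3]
    have : ∑ j, inner ℝ (b j) x * (2 * partialDeriv b j (partialDeriv b i G) x)
        = 2 * ∑ j, inner ℝ (b j) x * partialDeriv b j (partialDeriv b i G) x := by
      rw [Finset.mul_sum]; exact Finset.sum_congr rfl fun j _ => by ring
    rw [this, f2]
    ring

end Harmonic

/-! ### Symmetric quartic forms and the Cartan-Münzner equations -/

section QuarticForms

variable {V : Type*} [NormedAddCommGroup V] [InnerProductSpace ℝ V]

/-- `(a, b, c, d) ↦ ⟪Θ a b c, d⟫` is a symmetric quartic form. -/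
structure IsSymmetricQuartic (Θ : V →ₗ[ℝ] V →ₗ[ℝ] V →ₗ[ℝ] V) : Prop where
  swap_left : ∀ a b c, Θ a b c = Θ b a c
  swap_right : ∀ a b c, Θ a b c = Θ a c b
  inner_swap : ∀ a b c d, inner ℝ (Θ a b c) d = inner ℝ (Θ a b d) c

variable {ι : Type*} [Fintype ι] (b : OrthonormalBasis ι ℝ V)

theorem exists_quartic_of_coefficients (C : ι → ι → ι → ι → ℝ)
    (h1 : ∀ i j k l, C i j k l = C j i k l) (h2 : ∀ i j k l, C i j k l = C i k j l)
    (h3 : ∀ i j k l, C i j k l = C i j l k) :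
    ∃ Θ : V →ₗ[ℝ] V →ₗ[ℝ] V →ₗ[ℝ] V, IsSymmetricQuartic Θ ∧
      ∀ u v w z, inner ℝ (Θ u v w) z = ∑ i, inner ℝ (b i) z * ∑ j, inner ℝ (b j) u *
        ∑ k, inner ℝ (b k) v * ∑ l, inner ℝ (b l) w * C i j k l := by
  let Θ : V →ₗ[ℝ] V →ₗ[ℝ] V →ₗ[ℝ] V := ∑ i, ∑ j, ∑ k, ∑ l, C i j k l •
    (innerₛₗ ℝ (b j)).smulRight ((innerₛₗ ℝ (b k)).smulRight ((innerₛₗ ℝ (b l)).smulRight (b i)))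
  have hΘ : ∀ u v w, Θ u v w = ∑ i, ∑ j, ∑ k, ∑ l,
      (C i j k l * (inner ℝ (b j) u * (inner ℝ (b k) v * inner ℝ (b l) w))) • b i := by
    intro u v w
    simp only [Θ, LinearMap.sum_apply, LinearMap.smul_apply, LinearMap.smulRight_apply,
      innerₛₗ_apply_apply, smul_smul, mul_assoc]
  have hin : ∀ u v w z, inner ℝ (Θ u v w) z = ∑ i, inner ℝ (b i) z * ∑ j, inner ℝ (b j) u *
        ∑ k, inner ℝ (b k) v * ∑ l, inner ℝ (b l) w * C i j k l := by
    intro u v w z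
    simp only [hΘ, sum_inner, inner_smul_left, Finset.mul_sum, conj_trivial]
    refine Finset.sum_congr rfl fun i _ => Finset.sum_congr rfl fun j _ =>
      Finset.sum_congr rfl fun k _ => Finset.sum_congr rfl fun l _ => by ring
  refine ⟨Θ, ⟨?_, ?_, ?_⟩, hin⟩
  · intro u v w
    rw [hΘ, hΘ]
    refine Finset.sum_congr rfl fun i _ => ?_
    rw [Finset.sum_comm]
    refine Finset.sum_congr rfl fun j _ => Finset.sum_congr rfl fun k _ =>
      Finset.sum_congr rfl fun l _ => ?_
    rw [h2]
    congr 1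
    ring
  · intro u v w
    rw [hΘ, hΘ]
    refine Finset.sum_congr rfl fun i _ => Finset.sum_congr rfl fun j _ => ?_
    rw [Finset.sum_comm]
    refine Finset.sum_congr rfl fun k _ => Finset.sum_congr rfl fun l _ => ?_
    rw [h3]
    congr 1
    ring
  · have h4 : ∀ i j k l, C i j k l = C l j k i := by
      intro i j k l
      rw [h3 i j k l, h2 i j l k, h1 i l j k, h2 l i j k, h3 l j i k]
    intro u v w z
    rw [hΘ, hΘ]
    simp only [sum_inner, inner_smul_left, conj_trivial]
    have : ∀ (g : ι → ι → ι → ι → ℝ), ∑ i, ∑ j, ∑ k, ∑ l, g i j k l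
        = ∑ l, ∑ j, ∑ k, ∑ i, g i j k l := by
      intro g
      rw [Finset.sum_comm]
      conv_rhs => rw [Finset.sum_comm]
      refine Finset.sum_congr rfl fun j _ => ?_
      rw [Finset.sum_comm]
      conv_rhs => rw [Finset.sum_comm]
      refine Finset.sum_congr rfl fun k _ => ?_
      rw [Finset.sum_comm]
    rw [this]
    refine Finset.sum_congr rfl fun i _ => Finset.sum_congr rfl fun j _ =>
      Finset.sum_congr rfl fun k _ => Finset.sum_congr rfl fun l _ => ?_
    rw [h4]
    ring

/-- This is the polarization of `r⁴`: on the diagonal it is `3 |x|² x`, three quarters of the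
gradient of `r⁴`. -/
theorem exists_quartic_norm_sq : ∃ Θ : V →ₗ[ℝ] V →ₗ[ℝ] V →ₗ[ℝ] V, IsSymmetricQuartic Θ ∧
    ∀ u v w, Θ u v w = (inner ℝ u v : ℝ) • w + (inner ℝ v w : ℝ) • u + (inner ℝ u w : ℝ) • v := by
  let Θ : V →ₗ[ℝ] V →ₗ[ℝ] V →ₗ[ℝ] V := LinearMap.mk₂ ℝ
    (fun u v => (inner ℝ u v : ℝ) • LinearMap.id + (innerₛₗ ℝ v).smulRight u
      + (innerₛₗ ℝ u).smulRight v)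
    (fun u u' v => by ext w; simp [inner_add_left, add_smul]; abel)
    (fun c u v => by ext w; simp [inner_smul_left, smul_smul, mul_comm])
    (fun u v v' => by ext w; simp [inner_add_right, add_smul]; abel)
    (fun c u v => by ext w; simp [inner_smul_right, smul_smul, mul_comm])
  have hΘ : ∀ u v w, Θ u v w
      = (inner ℝ u v : ℝ) • w + (inner ℝ v w : ℝ) • u + (inner ℝ u w : ℝ) • v := by
    intro u v w; simp [Θ]
  refine ⟨Θ, ⟨?_, ?_, ?_⟩, hΘ⟩
  · intro u v w; rw [hΘ, hΘ, real_inner_comm u v]; abel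
  · intro u v w; rw [hΘ, hΘ, real_inner_comm w v]; abel
  · intro u v w z
    rw [hΘ, hΘ]
    simp only [inner_add_left, inner_smul_left, conj_trivial]
    rw [real_inner_comm w z]
    ring

theorem IsSymmetricQuartic.add_smul {Θ Ξ : V →ₗ[ℝ] V →ₗ[ℝ] V →ₗ[ℝ] V} (hΘ : IsSymmetricQuartic Θ)
    (hΞ : IsSymmetricQuartic Ξ) (s t : ℝ) : IsSymmetricQuartic (s • Θ + t • Ξ) where
  swap_left a b c := by
    simp only [LinearMap.add_apply, LinearMap.smul_apply]
    rw [hΘ.swap_left, hΞ.swap_left]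
  swap_right a b c := by
    simp only [LinearMap.add_apply, LinearMap.smul_apply]
    rw [hΘ.swap_right, hΞ.swap_right]
  inner_swap a b c d := by
    simp only [LinearMap.add_apply, LinearMap.smul_apply, inner_add_left, inner_smul_left]
    rw [hΘ.inner_swap, hΞ.inner_swap]

/-- Münzner's theorem for four principal curvatures, in local form: a solution of the
Cartan-Münzner equations of degree four is a quartic form. -/
theorem exists_quartic_of_cartan_munzner {W : Set V} (hW : IsOpen W) (hconv : Convex ℝ W)
    (hne : W.Nonempty) {F : V → ℝ} (hF : ContDiffOn ℝ ∞ F W) {c : ℝ}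
    (hlap : ∀ x ∈ W, laplacianSum b F x = c * inner ℝ x x)
    (heuler : ∀ x ∈ W, eulerSum b F x = 4 * F x)
    (hgrad : ∀ x ∈ W, ∑ i, partialDeriv b i F x ^ 2
      = 16 * (inner ℝ x x * (inner ℝ x x * inner ℝ x x))) :
    ∃ Θ : V →ₗ[ℝ] V →ₗ[ℝ] V →ₗ[ℝ] V, IsSymmetricQuartic Θ ∧
      ∀ x ∈ W, ∀ v, fderiv ℝ F x v = inner ℝ (Θ x x x) v := by
  set N : ℝ := ((Fintype.card ι : ℕ) : ℝ) with hN
  have hN4 : 4 * N + 8 ≠ 0 := by positivity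
  -- Since `Δ r⁴ = (4N + 8) r²`, this is the multiple of `r⁴` whose subtraction makes `F` harmonic.
  set s : ℝ := c / (4 * N + 8) with hs
  have hR : ContDiffOn ℝ ∞ (fun x : V => (inner ℝ x x : ℝ)) W := contDiff_inner_self.contDiffOn
  have hR2 : ContDiffOn ℝ ∞ (fun x : V => (inner ℝ x x * inner ℝ x x : ℝ)) W := hR.mul hR
  have hQ : ContDiffOn ℝ ∞ (fun x : V => (-s * (inner ℝ x x * inner ℝ x x) : ℝ)) W :=
    contDiffOn_const.mul hR2
  obtain ⟨G, hG⟩ : ∃ G : V → ℝ, G = fun x => F x + -s * (inner ℝ x x * inner ℝ x x) := ⟨_, rfl⟩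
  have hGs : ContDiffOn ℝ ∞ G W := by rw [hG]; exact hF.add hQ
  have hpR2 : ∀ i, ∀ x ∈ W, partialDeriv b i (fun x => inner ℝ x x * inner ℝ x x) x
      = 4 * (inner ℝ x x * inner ℝ (b i) x) := by
    intro i x hx
    rw [partialDeriv_mul b hW hR hR i x hx, partialDeriv_inner_self]
    ring
  have hpG : ∀ i, ∀ x ∈ W, partialDeriv b i G x
      = partialDeriv b i F x - 4 * s * (inner ℝ x x * inner ℝ (b i) x) := by
    intro i x hx
    rw [hG, partialDeriv_add b hW hF hQ i x hx, partialDeriv_const_mul b hW hR2 (-s) i x hx,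
      hpR2 i x hx]
    ring
  have hxx : ∀ x : V, ∑ i, inner ℝ (b i) x * inner ℝ (b i) x = inner ℝ x x := by
    intro x
    rw [← b.sum_inner_mul_inner x x]
    exact Finset.sum_congr rfl fun i _ => by rw [real_inner_comm x (b i)]
  have hharm : ∀ x ∈ W, laplacianSum b G x = 0 := by
    intro x hx
    rw [hG, laplacianSum_add b hW hF hQ x hx, laplacianSum_const_mul b hW hR2 (-s) x hx,
      laplacianSum_inner_self_mul b hW hR (fun x _ => eulerSum_inner_self b x) x hx,
      laplacianSum_inner_self, hlap x hx, ← hN, hs]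
    field_simp
    ring
  have heG : ∀ x ∈ W, eulerSum b G x = 4 * G x := by
    intro x hx
    have h1 : eulerSum b G x = eulerSum b F x
        - 4 * s * inner ℝ x x * ∑ i, inner ℝ (b i) x * inner ℝ (b i) x := by
      rw [eulerSum, eulerSum, Finset.mul_sum, ← Finset.sum_sub_distrib]
      exact Finset.sum_congr rfl fun i _ => by rw [hpG i x hx]; ring
    rw [h1, hxx, heuler x hx, hG]
    ring
  have hgG : ∀ x ∈ W, ∑ i, partialDeriv b i G x ^ 2
      = (16 - 16 * s ^ 2) * (inner ℝ x x * (inner ℝ x x * inner ℝ x x))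
        + (-32 * s) * (inner ℝ x x * G x) := by
    intro x hx
    have h1 : ∑ i, partialDeriv b i G x ^ 2 = ∑ i, partialDeriv b i F x ^ 2
        - 8 * s * inner ℝ x x * eulerSum b F x
        + 16 * s ^ 2 * (inner ℝ x x * inner ℝ x x)
          * ∑ i, inner ℝ (b i) x * inner ℝ (b i) x := by
      rw [eulerSum, Finset.mul_sum, Finset.mul_sum, ← Finset.sum_sub_distrib,
        ← Finset.sum_add_distrib]
      exact Finset.sum_congr rfl fun i _ => by rw [hpG i x hx]; ring
    rw [h1, hxx, hgrad x hx, heuler x hx, hG]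
    ring
  obtain ⟨C, h1, h2, h3, h4⟩ := exists_quartic_coefficients b hW hconv hne hGs heG
    (fifth_partialDeriv_eq_zero b hW hGs hharm heG hgG)
  obtain ⟨Θ₁, hΘ₁, hΘ₁'⟩ := exists_quartic_of_coefficients b C h1 h2 h3
  obtain ⟨Θ₂, hΘ₂, hΘ₂'⟩ := exists_quartic_norm_sq (V := V)
  -- The second term restores the gradient `4 s |x|² x` of `s r⁴`, because `Θ₂ x x x = 3 |x|² x`.
  refine ⟨(1 / 6 : ℝ) • Θ₁ + (4 * s / 3) • Θ₂, hΘ₁.add_smul hΘ₂ _ _, fun x hx v => ?_⟩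
  have h5 : fderiv ℝ F x v = ∑ i, inner ℝ (b i) v * partialDeriv b i F x := by
    conv_lhs => rw [← b.sum_repr' v, map_sum]
    exact Finset.sum_congr rfl fun i _ => by rw [map_smul]; rfl
  have h6 : ∀ i, partialDeriv b i F x = 1 / 6 * ∑ j, inner ℝ (b j) x *
        ∑ k, inner ℝ (b k) x * ∑ l, inner ℝ (b l) x * C i j k l
        + 4 * s * inner ℝ x x * inner ℝ (b i) x := by
    intro i
    have := hpG i x hx
    rw [h4 i x hx] at this
    linarith
  have h7 : inner ℝ x v = ∑ i, inner ℝ (b i) v * inner ℝ (b i) x := by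
    rw [← b.sum_inner_mul_inner x v]
    exact Finset.sum_congr rfl fun i _ => by rw [real_inner_comm x (b i)]; ring
  simp only [LinearMap.add_apply, LinearMap.smul_apply, inner_add_left, inner_smul_left,
    conj_trivial, hΘ₁', hΘ₂']
  rw [h5, h7, Finset.mul_sum, Finset.mul_sum, ← Finset.sum_add_distrib,
    ← Finset.sum_add_distrib, Finset.mul_sum, ← Finset.sum_add_distrib]
  exact Finset.sum_congr rfl fun i _ => by rw [h6]; ring

end QuarticForms

/-! ### The Cartan-Münzner function in the normal plane -/

section PolarQuartic

/-- The real part of `(a + i b) ^ 4` times the conjugate of `C + i S`. -/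
def polarQuartic (C S a b : ℝ) : ℝ :=
  C * (a ^ 4 - 6 * a ^ 2 * b ^ 2 + b ^ 4) + S * (4 * a ^ 3 * b - 4 * a * b ^ 3)

/-- The first partial derivative of `polarQuartic`. -/
def polarQuarticFst (C S a b : ℝ) : ℝ :=
  4 * C * (a ^ 3 - 3 * a * b ^ 2) + 4 * S * (3 * a ^ 2 * b - b ^ 3)

/-- The second partial derivative of `polarQuartic`. -/
def polarQuarticSnd (C S a b : ℝ) : ℝ :=
  4 * C * (b ^ 3 - 3 * a ^ 2 * b) + 4 * S * (a ^ 3 - 3 * a * b ^ 2)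

theorem polarQuartic_euler (C S a b : ℝ) :
    a * polarQuarticFst C S a b + b * polarQuarticSnd C S a b = 4 * polarQuartic C S a b := by
  simp only [polarQuartic, polarQuarticFst, polarQuarticSnd]; ring

theorem polarQuartic_gradient {C S : ℝ} (h : C ^ 2 + S ^ 2 = 1) (a b : ℝ) :
    polarQuarticFst C S a b ^ 2 + polarQuarticSnd C S a b ^ 2 = 16 * (a ^ 2 + b ^ 2) ^ 3 := by
  simp only [polarQuarticFst, polarQuarticSnd]
  linear_combination 16 * (a ^ 2 + b ^ 2) ^ 3 * h

theorem polarQuarticFst_cos_sin (φ t : ℝ) :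
    polarQuarticFst (Real.cos φ) (Real.sin φ) (Real.cos t) (Real.sin t)
      = 4 * Real.cos (3 * t - φ) := by
  rw [polarQuarticFst, Real.cos_sub, Real.cos_three_mul, Real.sin_three_mul]
  linear_combination (-12 * Real.cos φ * Real.cos t + 12 * Real.sin φ * Real.sin t)
    * Real.sin_sq_add_cos_sq t

theorem polarQuarticSnd_cos_sin (φ t : ℝ) :
    polarQuarticSnd (Real.cos φ) (Real.sin φ) (Real.cos t) (Real.sin t)
      = -(4 * Real.sin (3 * t - φ)) := by
  rw [polarQuarticSnd, Real.sin_sub, Real.cos_three_mul, Real.sin_three_mul]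
  linear_combination (-12 * Real.cos φ * Real.sin t - 12 * Real.sin φ * Real.cos t)
    * Real.sin_sq_add_cos_sq t

/-- The quotient of `polarQuarticFst - κ * polarQuarticSnd` by the linear form `a - κ * b`, where
`κ` is the cotangent of `φ`. -/
def polarQuotient (φ a b : ℝ) : ℝ :=
  -4 * (a ^ 2 + b ^ 2)
    - 8 * (Real.cos (2 * φ) * (a ^ 2 - b ^ 2) + Real.sin (2 * φ) * (2 * a * b))

/-- On the line at angle `φ` the gradient of `r⁴ cos (4 (t - φ))` is radial, so the cubic on the
left vanishes where `a - κ b` does. The quadratic quotient is the eigenvalue of the Hessian on the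
corresponding eigenspace. -/
theorem polarQuotient_mul {φ κ : ℝ} (h : Real.cos φ = κ * Real.sin φ) (a b : ℝ) :
    polarQuarticFst (Real.cos (4 * φ)) (Real.sin (4 * φ)) a b
      - κ * polarQuarticSnd (Real.cos (4 * φ)) (Real.sin (4 * φ)) a b
      = polarQuotient φ a b * (a - κ * b) := by
  have h1 : Real.sin φ ^ 2 * (1 + κ ^ 2) = 1 := by
    have := Real.sin_sq_add_cos_sq φ
    rw [h] at this
    linear_combination this
  obtain ⟨p, hp⟩ : ∃ p, p = Real.sin φ ^ 2 := ⟨_, rfl⟩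
  have h2 : Real.cos (2 * φ) = p * (κ ^ 2 - 1) := by
    rw [Real.cos_two_mul', h, hp]; ring
  have h3 : Real.sin (2 * φ) = 2 * κ * p := by
    rw [Real.sin_two_mul, h, hp]; ring
  have h4 : Real.cos (4 * φ) = p ^ 2 * (κ ^ 4 - 6 * κ ^ 2 + 1) := by
    rw [show 4 * φ = 2 * (2 * φ) by ring, Real.cos_two_mul', h2, h3]; ring
  have h5 : Real.sin (4 * φ) = p ^ 2 * (4 * κ ^ 3 - 4 * κ) := by
    rw [show 4 * φ = 2 * (2 * φ) by ring, Real.sin_two_mul, h2, h3]; ring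
  rw [← hp] at h1
  rw [polarQuarticFst, polarQuarticSnd, polarQuotient, h2, h3, h4, h5]
  linear_combination (-(a - κ * b) * (4 * (a ^ 2 + b ^ 2) * (1 + p * (1 + κ ^ 2))
    + 8 * p * ((κ ^ 2 - 1) * (a ^ 2 - b ^ 2) + 4 * κ * a * b))) * h1

/-- Opposite multiplicities agree, so the Laplacian only needs these two sums. Shifting the angle by
`π/4` changes the sign of the quartic. Shifting it by `π/2` changes the sign of the angular term of
the quotient, which therefore cancels in each sum. -/
theorem IsQuarterSpaced.exists_quotients {K : Finset ℝ} {κ₀ κ₁ κ₂ κ₃ θ : ℝ}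
    (hK : IsQuarterSpaced K κ₀ κ₁ κ₂ κ₃) (hθ : Real.cos θ = κ₀ * Real.sin θ) {a b : ℝ}
    (hab : ∀ κ ∈ K, a - κ * b ≠ 0) :
    ∃ x : ℝ → ℝ, (∀ κ ∈ K, polarQuarticFst (Real.cos (4 * θ)) (Real.sin (4 * θ)) a b
        - κ * polarQuarticSnd (Real.cos (4 * θ)) (Real.sin (4 * θ)) a b = x κ * (a - κ * b)) ∧
      x κ₀ + x κ₂ = -8 * (a ^ 2 + b ^ 2) ∧ x κ₁ + x κ₃ = 8 * (a ^ 2 + b ^ 2) := by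
  obtain ⟨C, hC⟩ : ∃ C, C = Real.cos (4 * θ) := ⟨_, rfl⟩
  obtain ⟨S, hS⟩ : ∃ S, S = Real.sin (4 * θ) := ⟨_, rfl⟩
  have h1 := hK.angle1 hθ
  have h2 := hK.rotate.angle1 h1
  have h3 := hK.rotate.rotate.angle1 h2
  have e0 := polarQuotient_mul hθ a b
  have e1 := polarQuotient_mul h1 a b
  have e2 := polarQuotient_mul h2 a b
  have e3 := polarQuotient_mul h3 a b
  rw [show 4 * (θ + Real.pi / 4) = 4 * θ + Real.pi by ring, Real.cos_add_pi, Real.sin_add_pi] at e1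
  rw [show 4 * (θ + Real.pi / 4 + Real.pi / 4) = 4 * θ + 2 * Real.pi by ring,
    Real.cos_add_two_pi, Real.sin_add_two_pi] at e2
  rw [show 4 * (θ + Real.pi / 4 + Real.pi / 4 + Real.pi / 4) = 4 * θ + Real.pi + 2 * Real.pi by
    ring, Real.cos_add_two_pi, Real.sin_add_two_pi, Real.cos_add_pi, Real.sin_add_pi] at e3
  have q2 : polarQuotient (θ + Real.pi / 4 + Real.pi / 4) a b
      = -4 * (a ^ 2 + b ^ 2)
        + 8 * (Real.cos (2 * θ) * (a ^ 2 - b ^ 2) + Real.sin (2 * θ) * (2 * a * b)) := by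
    rw [polarQuotient, show 2 * (θ + Real.pi / 4 + Real.pi / 4) = 2 * θ + Real.pi by ring,
      Real.cos_add_pi, Real.sin_add_pi]
    ring
  have q3 : polarQuotient (θ + Real.pi / 4 + Real.pi / 4 + Real.pi / 4) a b
      = -8 * (a ^ 2 + b ^ 2) - polarQuotient (θ + Real.pi / 4) a b := by
    rw [polarQuotient, polarQuotient,
      show 2 * (θ + Real.pi / 4 + Real.pi / 4 + Real.pi / 4) = 2 * (θ + Real.pi / 4) + Real.pi by
        ring, Real.cos_add_pi, Real.sin_add_pi]
    ring
  rw [← hC, ← hS] at e0 e1 e2 e3 ⊢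
  simp only [polarQuarticFst, polarQuarticSnd] at e0 e1 e2 e3 ⊢
  obtain ⟨m0, m1, m2, m3⟩ := hK.mem
  have key : ∀ κ ∈ K, ∀ y : ℝ, (4 * C * (a ^ 3 - 3 * a * b ^ 2) + 4 * S * (3 * a ^ 2 * b - b ^ 3)
      - κ * (4 * C * (b ^ 3 - 3 * a ^ 2 * b) + 4 * S * (a ^ 3 - 3 * a * b ^ 2)))
        = y * (a - κ * b) →
      (4 * C * (a ^ 3 - 3 * a * b ^ 2) + 4 * S * (3 * a ^ 2 * b - b ^ 3)
      - κ * (4 * C * (b ^ 3 - 3 * a ^ 2 * b) + 4 * S * (a ^ 3 - 3 * a * b ^ 2))) / (a - κ * b)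
        = y := by
    intro κ hκ y hy
    rw [hy, mul_div_cancel_right₀ _ (hab κ hκ)]
  refine ⟨fun κ => (4 * C * (a ^ 3 - 3 * a * b ^ 2) + 4 * S * (3 * a ^ 2 * b - b ^ 3)
      - κ * (4 * C * (b ^ 3 - 3 * a ^ 2 * b) + 4 * S * (a ^ 3 - 3 * a * b ^ 2))) / (a - κ * b),
    fun κ hκ => (div_mul_cancel₀ _ (hab κ hκ)).symm, ?_, ?_⟩
  · simp only
    rw [key κ₀ m0 _ e0, key κ₂ m2 _ e2, q2, polarQuotient]
    ring
  · simp only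
    rw [key κ₁ m1 (-polarQuotient (θ + Real.pi / 4) a b) (by linear_combination -e1),
      key κ₃ m3 (-polarQuotient (θ + Real.pi / 4 + Real.pi / 4 + Real.pi / 4) a b)
        (by linear_combination -e3), q3]
    ring

end PolarQuartic

/-! ### Normal planes as local coordinates -/

section Patches

variable {E V : Type*} [NormedAddCommGroup E] [InnerProductSpace ℝ E] [FiniteDimensional ℝ E]
  [NormedAddCommGroup V] [InnerProductSpace ℝ V] [FiniteDimensional ℝ V]

/-- The point with polar coordinates `(a, b)` in the normal plane over `u`. -/
def normalPlaneMap (f ν : E → V) (p : E × ℝ × ℝ) : V := p.2.1 • f p.1 + p.2.2 • ν p.1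

namespace IsoparametricPatch

variable {O : Set E} {f ν : E → V} {K : Finset ℝ} (h : IsoparametricPatch O f ν K) {u : E}
include h

theorem contDiffAt_normalPlaneMap {p : E × ℝ × ℝ} (hp : p.1 ∈ O) :
    ContDiffAt ℝ ∞ (normalPlaneMap f ν) p := by
  have h1 : ContDiffAt ℝ ∞ (fun p : E × ℝ × ℝ => f p.1) p :=
    ContDiffAt.comp p (h.contDiffAt hp) contDiffAt_fst
  have h2 : ContDiffAt ℝ ∞ (fun p : E × ℝ × ℝ => ν p.1) p :=
    ContDiffAt.comp p (h.contDiffAt_normal hp) contDiffAt_fst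
  have h3 : ContDiffAt ℝ ∞ (fun p : E × ℝ × ℝ => p.2.1) p := by fun_prop
  have h4 : ContDiffAt ℝ ∞ (fun p : E × ℝ × ℝ => p.2.2) p := by fun_prop
  exact (h3.smul h1).add (h4.smul h2)

/-- The derivative of a field `x • f + y • ν`. -/
theorem hasFDerivAt_combination {p : E × ℝ × ℝ} (hp : p.1 ∈ O) {x y : E × ℝ × ℝ → ℝ}
    {x' y' : E × ℝ × ℝ →L[ℝ] ℝ} (hx : HasFDerivAt x x' p) (hy : HasFDerivAt y y' p) :
    ∃ L : E × ℝ × ℝ →L[ℝ] V, HasFDerivAt (fun p => x p • f p.1 + y p • ν p.1) L p ∧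
      ∀ ξ, L ξ = fderiv ℝ f p.1 (x p • ξ.1 - y p • shapeOperator f ν p.1 ξ.1)
        + x' ξ • f p.1 + y' ξ • ν p.1 := by
  have h1 : HasFDerivAt (fun p : E × ℝ × ℝ => f p.1) _ p :=
    HasFDerivAt.comp (f := Prod.fst) p (h.hasFDerivAt hp) hasFDerivAt_fst
  have h2 : HasFDerivAt (fun p : E × ℝ × ℝ => ν p.1) _ p :=
    HasFDerivAt.comp (f := Prod.fst) p (h.hasFDerivAt_normal hp) hasFDerivAt_fst
  refine ⟨_, (hx.smul h1).add (hy.smul h2), fun ξ => ?_⟩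
  rw [map_sub, map_smul, map_smul, h.fderiv_shapeOperator hp]
  simp
  abel

/-- In the tangential directions the derivative is `df ∘ (a - b A)`, singular only if `a = κ b` for
some `κ ∈ K`, that is, at focal points and at the origin. -/
theorem exists_hasFDerivAt_normalPlaneMap {p : E × ℝ × ℝ} (hp : p.1 ∈ O)
    (hK : ∀ κ ∈ K, p.2.1 - κ * p.2.2 ≠ 0) :
    ∃ L : (E × ℝ × ℝ) ≃L[ℝ] V,
      HasFDerivAt (normalPlaneMap f ν) (L : E × ℝ × ℝ →L[ℝ] V) p ∧
      ∀ ξ, L ξ = fderiv ℝ f p.1 (p.2.1 • ξ.1 - p.2.2 • shapeOperator f ν p.1 ξ.1)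
        + ξ.2.1 • f p.1 + ξ.2.2 • ν p.1 := by
  obtain ⟨L, hL, hL'⟩ := h.hasFDerivAt_combination hp (x := fun p => p.2.1) (y := fun p => p.2.2)
    (hasFDerivAt_fst.comp (f := Prod.snd) p hasFDerivAt_snd)
    (hasFDerivAt_snd.comp (f := Prod.snd) p hasFDerivAt_snd)
  have hL'' : ∀ ξ, L ξ = fderiv ℝ f p.1 (p.2.1 • ξ.1 - p.2.2 • shapeOperator f ν p.1 ξ.1)
        + ξ.2.1 • f p.1 + ξ.2.2 • ν p.1 := fun ξ => by rw [hL']; rfl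
  have hinj : Function.Injective L := by
    rw [injective_iff_map_eq_zero]
    rintro ⟨v, α, β⟩ hz
    rw [hL''] at hz
    simp only at hz
    have h1 := congrArg (fun z => inner ℝ (f p.1) z) hz
    have h2 := congrArg (fun z => inner ℝ (ν p.1) z) hz
    have h3 : inner ℝ (f p.1) (ν p.1) = 0 := by
      rw [real_inner_comm]; exact h.normal_perp_position _ hp
    simp only [inner_add_right, inner_smul_right, h.inner_position_fderiv hp, h.inner_self hp, h3,
      h.normal_perp_tangent _ hp, h.normal_perp_position _ hp, h.inner_normal_self hp,
      inner_zero_right] at h1 h2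
    have ha : α = 0 := by linarith
    have hb : β = 0 := by linarith
    subst ha hb
    simp only [zero_smul, add_zero] at hz
    have h5 := (injective_iff_map_eq_zero _).mp (h.immersion _ hp) _ hz
    have hv : v = 0 := by
      by_contra hv
      obtain ⟨κ, hκ⟩ := h.nonempty
      by_cases hb : p.2.2 = 0
      · have ha := hK κ hκ
        rw [hb, mul_zero, sub_zero] at ha
        rw [hb, zero_smul, sub_zero, smul_eq_zero_iff_right ha] at h5
        exact hv h5
      · have h6 : shapeOperator f ν p.1 v = (p.2.1 / p.2.2) • v := by
          rw [div_eq_inv_mul, mul_smul, sub_eq_zero.mp h5, smul_smul, inv_mul_cancel₀ hb, one_smul]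
        refine hK _ (h.eigenvalue_mem hp hv h6) ?_
        field_simp
        ring
    simp [hv]
  have hfr : Module.finrank ℝ (E × ℝ × ℝ) = Module.finrank ℝ V := by
    rw [h.finrank_eq]; simp
  refine ⟨(LinearEquiv.ofInjectiveOfFinrankEq (L : E × ℝ × ℝ →ₗ[ℝ] V) hinj
    hfr).toContinuousLinearEquiv, ?_, hL''⟩
  exact hL

/-- In the moving frame `H` is the direct sum of `B` and a two by two block on the normal plane. -/
theorem trace_eq_of_frame (hu : u ∈ O) {H : V →ₗ[ℝ] V} {B : E →ₗ[ℝ] E} {a b c d : ℝ}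
    (hB : ∀ v, H (fderiv ℝ f u v) = fderiv ℝ f u (B v)) (hf : H (f u) = a • f u + b • ν u)
    (hν : H (ν u) = c • f u + d • ν u) :
    LinearMap.trace ℝ V H = LinearMap.trace ℝ E B + (a + d) := by
  obtain ⟨κ, hκ⟩ := h.nonempty
  let L : (E × ℝ × ℝ) →ₗ[ℝ] V :=
    (fderiv ℝ f u : E →ₗ[ℝ] V).coprod
      ((LinearMap.toSpanSingleton ℝ V (f u)).coprod (LinearMap.toSpanSingleton ℝ V (ν u)))
  have hL : ∀ x, L x = fderiv ℝ f u x.1 + (x.2.1 • f u + x.2.2 • ν u) := fun x => by simp [L]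
  have hsurj : Function.Surjective L := by
    intro y
    obtain ⟨v, a, b, hy⟩ := h.exists_frame_decomposition hu y
    exact ⟨(v, a, b), by rw [hL, hy, add_assoc]⟩
  have hfr : Module.finrank ℝ (E × ℝ × ℝ) = Module.finrank ℝ V := by
    rw [h.finrank_eq]; simp
  have hinj : Function.Injective L :=
    (LinearMap.injective_iff_surjective_of_finrank_eq_finrank hfr).mpr hsurj
  let M : ℝ × ℝ →ₗ[ℝ] ℝ × ℝ :=
    (a • LinearMap.fst ℝ ℝ ℝ + c • LinearMap.snd ℝ ℝ ℝ).prod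
      (b • LinearMap.fst ℝ ℝ ℝ + d • LinearMap.snd ℝ ℝ ℝ)
  have hM : LinearMap.trace ℝ (ℝ × ℝ) M = a + d := by
    rw [LinearMap.trace_eq_matrix_trace ℝ (Module.Basis.finTwoProd ℝ), Matrix.trace_fin_two,
      LinearMap.toMatrix_apply, LinearMap.toMatrix_apply]
    simp [M]
  rw [← hM, ← LinearMap.trace_prodMap']
  refine trace_eq_of_semiconj hsurj (fun x => ?_) (fun x hx => ?_)
  · rw [hL, hL, map_add, map_add, map_smul, map_smul, hB, hf, hν]
    have hMx : M x.2 = (a * x.2.1 + c * x.2.2, b * x.2.1 + d * x.2.2) := rfl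
    simp only [LinearMap.prodMap_apply, hMx]
    module
  · rw [(injective_iff_map_eq_zero L).mp hinj x hx, map_zero]

end IsoparametricPatch

end Patches

/-! ### Extension of identities between quartic forms -/

section QuarticForms

variable {V : Type*} [NormedAddCommGroup V] [InnerProductSpace ℝ V]

namespace IsSymmetricQuartic

variable {Θ Ξ : V →ₗ[ℝ] V →ₗ[ℝ] V →ₗ[ℝ] V} (hΘ : IsSymmetricQuartic Θ)
  (hΞ : IsSymmetricQuartic Ξ)
include hΘ

theorem cube_combination (x y : V) (a b : ℝ) :
    Θ (a • x + b • y) (a • x + b • y) (a • x + b • y) = a ^ 3 • Θ x x x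
      + (3 * (a ^ 2 * b)) • Θ x x y + (3 * (a * b ^ 2)) • Θ x y y + b ^ 3 • Θ y y y := by
  simp only [map_add, map_smul, LinearMap.add_apply, LinearMap.smul_apply]
  rw [hΘ.swap_left y x x, hΘ.swap_right x y x, hΘ.swap_left y x y, hΘ.swap_right y y x,
    hΘ.swap_left y x y]
  module

include hΞ in
/-- A quartic form is determined by its gradient near a point. -/
theorem cube_eq_of_eventuallyEq {x₀ : V} (h : ∀ᶠ x in nhds x₀, Θ x x x = Ξ x x x) (y : V) :
    Θ y y y = Ξ y y y := by
  have hline : ∀ s : ℝ, (1 : ℝ) • x₀ + s • (y - x₀) = x₀ + s • (y - x₀) := fun s => by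
    rw [one_smul]
  have h1 : ∀ᶠ s in nhds (0 : ℝ), (fun s : ℝ => (1 : ℝ) ^ 3 • Θ x₀ x₀ x₀
      + (3 * ((1 : ℝ) ^ 2 * s)) • Θ x₀ x₀ (y - x₀) + (3 * (1 * s ^ 2)) • Θ x₀ (y - x₀) (y - x₀)
      + s ^ 3 • Θ (y - x₀) (y - x₀) (y - x₀)) s = (fun s : ℝ => (1 : ℝ) ^ 3 • Ξ x₀ x₀ x₀
      + (3 * ((1 : ℝ) ^ 2 * s)) • Ξ x₀ x₀ (y - x₀) + (3 * (1 * s ^ 2)) • Ξ x₀ (y - x₀) (y - x₀)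
      + s ^ 3 • Ξ (y - x₀) (y - x₀) (y - x₀)) s := by
    have hc : Filter.Tendsto (fun s : ℝ => (1 : ℝ) • x₀ + s • (y - x₀)) (nhds 0) (nhds x₀) := by
      have : Continuous fun s : ℝ => (1 : ℝ) • x₀ + s • (y - x₀) := by fun_prop
      have h2 := this.tendsto 0
      simpa using h2
    filter_upwards [hc.eventually h] with s hs
    rw [← hΘ.cube_combination, ← hΞ.cube_combination, hs]
  -- On the line from `x₀` to `y` both sides are polynomials in `s` that agree near `0`; the value
  -- `s = 1` is the claim at `y`.
  have h2 := AnalyticOnNhd.eq_of_eventuallyEq (𝕜 := ℝ) (z₀ := 0)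
    (fun s _ => by fun_prop) (fun s _ => by fun_prop) h1
  have h3 := congrFun h2 1
  rw [← hΘ.cube_combination, ← hΞ.cube_combination] at h3
  simpa using h3

/-- The eikonal identity of a quartic form extends from an open set. -/
theorem eikonal_of_eventually {x₀ : V}
    (h : ∀ᶠ x in nhds x₀, inner ℝ (Θ x x x) (Θ x x x) = 16 * (inner ℝ x x : ℝ) ^ 3) (y : V) :
    inner ℝ (Θ y y y) (Θ y y y) = 16 * (inner ℝ y y : ℝ) ^ 3 := by
  obtain ⟨G, hG⟩ : ∃ G : ℝ → V, G = fun s : ℝ => (1 : ℝ) ^ 3 • Θ x₀ x₀ x₀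
      + (3 * ((1 : ℝ) ^ 2 * s)) • Θ x₀ x₀ (y - x₀) + (3 * (1 * s ^ 2)) • Θ x₀ (y - x₀) (y - x₀)
      + s ^ 3 • Θ (y - x₀) (y - x₀) (y - x₀) := ⟨_, rfl⟩
  obtain ⟨c, hc⟩ : ∃ c : ℝ → V, c = fun s : ℝ => (1 : ℝ) • x₀ + s • (y - x₀) := ⟨_, rfl⟩
  have hGc : ∀ s, Θ (c s) (c s) (c s) = G s := fun s => by rw [hc, hG, hΘ.cube_combination]
  have hGa : ∀ s, AnalyticAt ℝ G s := fun s => by rw [hG]; fun_prop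
  have hca : ∀ s, AnalyticAt ℝ c s := fun s => by rw [hc]; fun_prop
  have hin : ∀ g : ℝ → V, (∀ s, AnalyticAt ℝ g s) →
      ∀ s, AnalyticAt ℝ (fun s => (inner ℝ (g s) (g s) : ℝ)) s := fun g hg s => by
    have h2 := (innerSL ℝ (E := V)).analyticAt_bilinear (g s, g s)
    exact h2.comp₂ (hg s) (hg s)
  have h1 : ∀ᶠ s in nhds (0 : ℝ), (fun s => (inner ℝ (G s) (G s) : ℝ)) s
      = (fun s => 16 * (inner ℝ (c s) (c s) : ℝ) ^ 3) s := by
    have ht : Filter.Tendsto c (nhds 0) (nhds x₀) := by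
      have h2 := (hca 0).continuousAt.tendsto
      simpa [hc] using h2
    filter_upwards [ht.eventually h] with s hs
    rw [← hGc, hs]
  have h2 := AnalyticOnNhd.eq_of_eventuallyEq (𝕜 := ℝ) (z₀ := 0)
    (fun s _ => hin G hGa s) (fun s _ => (analyticAt_const.mul ((hin c hca s).pow 3))) h1
  have h3 := congrFun h2 1
  rw [← hGc] at h3
  simpa [hc] using h3

theorem hasFDerivAt_cube [FiniteDimensional ℝ V] (x : V) :
    HasFDerivAt (fun y => Θ y y y) (LinearMap.toContinuousLinearMap ((3 : ℝ) • Θ x x)) x := by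
  let T : V →L[ℝ] V →L[ℝ] V →L[ℝ] V := LinearMap.toContinuousLinearMap
    ((LinearMap.toContinuousLinearMap : (V →ₗ[ℝ] V →L[ℝ] V) ≃ₗ[ℝ] V →L[ℝ] V →L[ℝ] V).toLinearMap ∘ₗ
      (LinearMap.compRight ℝ
        (LinearMap.toContinuousLinearMap : (V →ₗ[ℝ] V) ≃ₗ[ℝ] V →L[ℝ] V).toLinearMap) ∘ₗ Θ)
  have hT : ∀ a b c, T a b c = Θ a b c := fun a b c => rfl
  have h1 := (T.hasFDerivAt (x := x)).clm_apply (hasFDerivAt_id x)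
  have h2 := h1.clm_apply (hasFDerivAt_id x)
  refine h2.congr_fderiv ?_
  ext v
  simp [hT]
  rw [hΘ.swap_right x v x, hΘ.swap_left v x x, hΘ.swap_right x v x]
  module

end IsSymmetricQuartic

end QuarticForms

/-! ### Derivatives of the polar quartic -/

section PolarQuartic

variable {G : Type*} [NormedAddCommGroup G] [NormedSpace ℝ G] {a b : G → ℝ} {a' b' : G →L[ℝ] ℝ}
  {p : G}

theorem hasFDerivAt_polarQuartic (C S : ℝ) (ha : HasFDerivAt a a' p) (hb : HasFDerivAt b b' p) :
    HasFDerivAt (fun p => polarQuartic C S (a p) (b p))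
      (polarQuarticFst C S (a p) (b p) • a' + polarQuarticSnd C S (a p) (b p) • b') p := by
  have h := ((((ha.pow 4).sub (((ha.pow 2).const_mul 6).mul (hb.pow 2))).add (hb.pow 4)).const_mul
    C).add (((((ha.pow 3).const_mul 4).mul hb).sub ((ha.const_mul 4).mul (hb.pow 3))).const_mul S)
  refine h.congr_fderiv ?_
  ext ξ
  simp [polarQuarticFst, polarQuarticSnd]
  ring

theorem hasFDerivAt_polarQuarticFst (C S : ℝ) (ha : HasFDerivAt a a' p) (hb : HasFDerivAt b b' p) :
    HasFDerivAt (fun p => polarQuarticFst C S (a p) (b p))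
      ((12 * C * (a p ^ 2 - b p ^ 2) + 24 * S * (a p * b p)) • a'
        + (-24 * C * (a p * b p) + 12 * S * (a p ^ 2 - b p ^ 2)) • b') p := by
  have h := (((ha.pow 3).sub ((ha.const_mul 3).mul (hb.pow 2))).const_mul (4 * C)).add
    ((((((ha.pow 2).const_mul 3)).mul hb).sub (hb.pow 3)).const_mul (4 * S))
  refine h.congr_fderiv ?_
  ext ξ
  simp
  ring

theorem hasFDerivAt_polarQuarticSnd (C S : ℝ) (ha : HasFDerivAt a a' p) (hb : HasFDerivAt b b' p) :
    HasFDerivAt (fun p => polarQuarticSnd C S (a p) (b p))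
      ((-24 * C * (a p * b p) + 12 * S * (a p ^ 2 - b p ^ 2)) • a'
        + (-(12 * C * (a p ^ 2 - b p ^ 2) + 24 * S * (a p * b p))) • b') p := by
  have h := (((hb.pow 3).sub (((ha.pow 2).const_mul 3).mul hb)).const_mul (4 * C)).add
    (((ha.pow 3).sub ((ha.const_mul 3).mul (hb.pow 2))).const_mul (4 * S))
  refine h.congr_fderiv ?_
  ext ξ
  simp
  ring

end PolarQuartic

/-! ### Münzner's theorem on a patch -/

section Patches

variable {E V : Type*} [NormedAddCommGroup E] [InnerProductSpace ℝ E] [FiniteDimensional ℝ E]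
  [NormedAddCommGroup V] [InnerProductSpace ℝ V] [FiniteDimensional ℝ V]

/-- The gradient, at the point with polar coordinates `p`, of the quartic function that is
`polarQuartic C S` in the normal planes. -/
def polarGradient (C S : ℝ) (f ν : E → V) (p : E × ℝ × ℝ) : V :=
  polarQuarticFst C S p.2.1 p.2.2 • f p.1 + polarQuarticSnd C S p.2.1 p.2.2 • ν p.1

namespace IsoparametricPatch

variable {O : Set E} {f ν : E → V} {K : Finset ℝ} (h : IsoparametricPatch O f ν K) {u₀ : E}
include h

theorem inner_combination {u : E} (hu : u ∈ O) (a b c d : ℝ) :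
    inner ℝ (a • f u + b • ν u) (c • f u + d • ν u) = a * c + b * d := by
  have h3 : inner ℝ (f u) (ν u) = 0 := by
    rw [real_inner_comm]; exact h.normal_perp_position _ hu
  simp only [inner_add_left, inner_add_right, inner_smul_left, inner_smul_right, h.inner_self hu,
    h3, h.normal_perp_position _ hu, h.inner_normal_self hu, conj_trivial]
  ring

theorem inner_combination_frame {u : E} (hu : u ∈ O) (a b c d : ℝ) (v : E) :
    inner ℝ (a • f u + b • ν u) (fderiv ℝ f u v + c • f u + d • ν u) = a * c + b * d := by
  rw [add_assoc, inner_add_right, h.inner_combination hu]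
  simp [inner_add_left, inner_smul_left, h.inner_position_fderiv hu, h.normal_perp_tangent _ hu]

/-- The Laplacian of the Cartan-Münzner function at a point over `p`. -/
theorem trace_hessian {κ₀ κ₁ κ₂ κ₃ θ : ℝ} (hK : IsQuarterSpaced K κ₀ κ₁ κ₂ κ₃)
    (hθ : Real.cos θ = κ₀ * Real.sin θ) {p : E × ℝ × ℝ} (hp : p.1 ∈ O)
    (hab : ∀ κ ∈ K, p.2.1 - κ * p.2.2 ≠ 0) {H : V →L[ℝ] V} {L DY : E × ℝ × ℝ →L[ℝ] V}
    (hL : HasFDerivAt (normalPlaneMap f ν) L p)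
    (hDY : HasFDerivAt (polarGradient (Real.cos (4 * θ)) (Real.sin (4 * θ)) f ν) DY p)
    (hH : ∀ ξ, H (L ξ) = DY ξ) :
    LinearMap.trace ℝ V (H : V →ₗ[ℝ] V) = 8 * (eigenMult K (shapeOperator f ν p.1) κ₁
      - eigenMult K (shapeOperator f ν p.1) κ₀) * (p.2.1 ^ 2 + p.2.2 ^ 2) := by
  obtain ⟨C, hC⟩ : ∃ C, C = Real.cos (4 * θ) := ⟨_, rfl⟩
  obtain ⟨S, hS⟩ : ∃ S, S = Real.sin (4 * θ) := ⟨_, rfl⟩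
  obtain ⟨x, hx, hx02, hx13⟩ := hK.exists_quotients hθ hab
  rw [← hC, ← hS] at hx hDY
  have ha : HasFDerivAt (fun p : E × ℝ × ℝ => p.2.1)
      ((ContinuousLinearMap.fst ℝ ℝ ℝ).comp (ContinuousLinearMap.snd ℝ E (ℝ × ℝ))) p :=
    hasFDerivAt_fst.comp (f := Prod.snd) p hasFDerivAt_snd
  have hb : HasFDerivAt (fun p : E × ℝ × ℝ => p.2.2)
      ((ContinuousLinearMap.snd ℝ ℝ ℝ).comp (ContinuousLinearMap.snd ℝ E (ℝ × ℝ))) p :=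
    hasFDerivAt_snd.comp (f := Prod.snd) p hasFDerivAt_snd
  obtain ⟨L', hL', hL''⟩ := h.hasFDerivAt_combination hp ha hb
  obtain rfl : L' = L := hL'.unique hL
  obtain ⟨D', hD', hD''⟩ := h.hasFDerivAt_combination hp (hasFDerivAt_polarQuarticFst C S ha hb)
    (hasFDerivAt_polarQuarticSnd C S ha hb)
  obtain rfl : D' = DY := hD'.unique hDY
  have hHf : H (f p.1) = D' (0, 1, 0) := by rw [← hH, hL'']; simp
  have hHν : H (ν p.1) = D' (0, 0, 1) := by rw [← hH, hL'']; simp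
  -- On a `κ`-eigenvector, `H (L ξ) = DY ξ` carries the factor `a - κ b` on both sides; it is
  -- nonzero by `hab` and is cancelled.
  have hHv : ∀ v, H (fderiv ℝ f p.1 v)
      = fderiv ℝ f p.1 ((∑ κ ∈ K, x κ • eigenProj K (shapeOperator f ν p.1) κ : E →L[ℝ] E) v) := by
    have key : ∀ κ ∈ K, ∀ v, shapeOperator f ν p.1 v = κ • v →
        H (fderiv ℝ f p.1 v) = fderiv ℝ f p.1 (x κ • v) := by
      intro κ hκ v hv
      have h1 := hH (v, 0, 0)
      rw [hL'', hD''] at h1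
      simp only [hv] at h1
      simp only [ContinuousLinearMap.coe_comp, add_apply, smul_apply, Function.comp_apply,
        ContinuousLinearMap.coe_fst', ContinuousLinearMap.coe_snd', smul_eq_mul, mul_zero,
        add_zero, zero_smul] at h1
      rw [smul_smul, smul_smul, ← sub_smul, ← sub_smul, map_smul, map_smul, mul_comm p.2.2,
        mul_comm _ κ, hx κ hκ, mul_comm, mul_smul, map_smul,
        map_smul, smul_comm, mul_comm p.2.2] at h1
      rw [map_smul]
      exact (smul_right_injective V (hab κ hκ)) h1
    intro v
    conv_lhs => rw [← sum_eigenProj_apply h.nonempty (shapeOperator f ν p.1) v]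
    rw [map_sum, map_sum, sum_apply, map_sum]
    refine Finset.sum_congr rfl fun κ hκ => ?_
    rw [key κ hκ _ (h.shapeOperator_eigenProj hp hκ v)]
    rfl
  -- The block on the normal plane has trace zero, since the polar quartic is harmonic in two
  -- variables. Only the eigenspaces contribute, and their multiplicities are grouped into opposite
  -- pairs.
  rw [h.trace_eq_of_frame hp
    (B := ((∑ κ ∈ K, x κ • eigenProj K (shapeOperator f ν p.1) κ : E →L[ℝ] E) : E →ₗ[ℝ] E))
    (a := 12 * C * (p.2.1 ^ 2 - p.2.2 ^ 2) + 24 * S * (p.2.1 * p.2.2))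
    (b := -24 * C * (p.2.1 * p.2.2) + 12 * S * (p.2.1 ^ 2 - p.2.2 ^ 2))
    (c := -24 * C * (p.2.1 * p.2.2) + 12 * S * (p.2.1 ^ 2 - p.2.2 ^ 2))
    (d := -(12 * C * (p.2.1 ^ 2 - p.2.2 ^ 2) + 24 * S * (p.2.1 * p.2.2))) hHv
    (by rw [ContinuousLinearMap.coe_coe, hHf, hD'']; simp)
    (by rw [ContinuousLinearMap.coe_coe, hHν, hD'']; simp),
    trace_sum_smul_eigenProj, hK.sum_eq, ← h.eigenMult_eq hp hK,
    h.eigenMult_eq hp hK.rotate.rotate.rotate]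
  linear_combination (eigenMult K (shapeOperator f ν p.1) κ₂) * hx02
    + (eigenMult K (shapeOperator f ν p.1) κ₁) * hx13

/-- Near a point of an isoparametric hypersurface with four principal curvatures, the
Cartan-Münzner function is a quartic form. -/
theorem exists_quartic_cube_eq_polarGradient {κ₀ κ₁ κ₂ κ₃ θ : ℝ}
    (hK : IsQuarterSpaced K κ₀ κ₁ κ₂ κ₃) (hθ : Real.cos θ = κ₀ * Real.sin θ) (hu₀ : u₀ ∈ O) :
    ∃ Θ : V →ₗ[ℝ] V →ₗ[ℝ] V →ₗ[ℝ] V, IsSymmetricQuartic Θ ∧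
      (∀ y, inner ℝ (Θ y y y) (Θ y y y) = 16 * (inner ℝ y y : ℝ) ^ 3) ∧
      ∀ᶠ p in nhds ((u₀, 1, 0) : E × ℝ × ℝ),
        Θ (normalPlaneMap f ν p) (normalPlaneMap f ν p) (normalPlaneMap f ν p)
          = polarGradient (Real.cos (4 * θ)) (Real.sin (4 * θ)) f ν p := by
  obtain ⟨C, hC⟩ : ∃ C, C = Real.cos (4 * θ) := ⟨_, rfl⟩
  obtain ⟨S, hS⟩ : ∃ S, S = Real.sin (4 * θ) := ⟨_, rfl⟩
  have hCS : C ^ 2 + S ^ 2 = 1 := by rw [hC, hS]; exact Real.cos_sq_add_sin_sq _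
  obtain ⟨p₀, hp₀⟩ : ∃ p₀ : E × ℝ × ℝ, p₀ = (u₀, 1, 0) := ⟨_, rfl⟩
  have hp₀O : p₀.1 ∈ O := by rw [hp₀]; exact hu₀
  have hp₀K : ∀ κ ∈ K, p₀.2.1 - κ * p₀.2.2 ≠ 0 := by intro κ _; rw [hp₀]; simp
  obtain ⟨Φ, hΦ⟩ : ∃ Φ, Φ = normalPlaneMap f ν := ⟨_, rfl⟩
  have hΦs : ∀ p : E × ℝ × ℝ, p.1 ∈ O → ContDiffAt ℝ ∞ Φ p := fun p hp => by
    rw [hΦ]; exact h.contDiffAt_normalPlaneMap hp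
  have hΦd : ∀ p : E × ℝ × ℝ, p.1 ∈ O → (∀ κ ∈ K, p.2.1 - κ * p.2.2 ≠ 0) →
      ∃ L : (E × ℝ × ℝ) ≃L[ℝ] V, HasFDerivAt Φ (L : E × ℝ × ℝ →L[ℝ] V) p ∧
      ∀ ξ, L ξ = fderiv ℝ f p.1 (p.2.1 • ξ.1 - p.2.2 • shapeOperator f ν p.1 ξ.1)
        + ξ.2.1 • f p.1 + ξ.2.2 • ν p.1 := fun p hp hpK => by
    rw [hΦ]; exact h.exists_hasFDerivAt_normalPlaneMap hp hpK
  obtain ⟨L₀, hL₀, -⟩ := hΦd p₀ hp₀O hp₀K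
  -- At `p₀ = (u₀, 1, 0)`, the point `f u₀` itself, every `a - κ b` equals `1`, so the normal planes
  -- give smooth coordinates near it.
  let e := (hΦs p₀ hp₀O).toOpenPartialHomeomorph Φ hL₀ (by simp)
  have hes : p₀ ∈ e.source := (hΦs p₀ hp₀O).mem_toOpenPartialHomeomorph_source hL₀ (by simp)
  have heΦ : ∀ p, e p = Φ p := fun p => rfl
  have het : Φ p₀ ∈ e.target := e.map_source hes
  have hsymm₀ : e.symm (Φ p₀) = p₀ := e.left_inv hes
  obtain ⟨m₀, hm₀⟩ : ∃ m, m = eigenMult K (shapeOperator f ν u₀) κ₀ := ⟨_, rfl⟩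
  obtain ⟨m₁, hm₁⟩ : ∃ m, m = eigenMult K (shapeOperator f ν u₀) κ₁ := ⟨_, rfl⟩
  have hfst : Filter.Tendsto (fun p : E × ℝ × ℝ => p.1) (nhds p₀) (nhds u₀) := by
    have := (continuous_fst (X := E) (Y := ℝ × ℝ)).tendsto p₀
    rwa [hp₀] at this ⊢
  have hgood : ∀ᶠ p in nhds p₀, p.1 ∈ O ∧ (∀ κ ∈ K, p.2.1 - κ * p.2.2 ≠ 0) ∧
      eigenMult K (shapeOperator f ν p.1) κ₀ = m₀ ∧
      eigenMult K (shapeOperator f ν p.1) κ₁ = m₁ := by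
    have h1 := hfst.eventually (h.mem_nhds hu₀)
    have h2 : ∀ᶠ p in nhds p₀, ∀ κ ∈ K, p.2.1 - κ * p.2.2 ≠ 0 := by
      rw [Filter.eventually_all_finset]
      intro κ hκ
      have : Continuous fun p : E × ℝ × ℝ => p.2.1 - κ * p.2.2 := by fun_prop
      exact this.continuousAt.eventually_ne (hp₀K κ hκ)
    have h3 := hfst.eventually (h.eventually_eigenMult_eq hu₀ hK.mem.1)
    have h4 := hfst.eventually (h.eventually_eigenMult_eq hu₀ hK.mem.2.1)
    filter_upwards [h1, h2, h3, h4] with p h1 h2 h3 h4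
    exact ⟨h1, h2, h3.trans hm₀.symm, h4.trans hm₁.symm⟩
  have hpull := (e.continuousAt_symm het).eventually (by rw [hsymm₀]; exact hgood)
  obtain ⟨ε, hε, hball⟩ := Metric.eventually_nhds_iff_ball.mp
    (hpull.and (e.open_target.mem_nhds het))
  obtain ⟨W, hWdef⟩ : ∃ W, W = Metric.ball (Φ p₀) ε := ⟨_, rfl⟩
  rw [← hWdef] at hball
  have hWo : IsOpen W := by rw [hWdef]; exact Metric.isOpen_ball
  have hΦW : Φ p₀ ∈ W := by rw [hWdef]; exact Metric.mem_ball_self hε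
  obtain ⟨Y, hY⟩ : ∃ Y, Y = polarGradient C S f ν := ⟨_, rfl⟩
  have hYd : ∀ p : E × ℝ × ℝ, p.1 ∈ O → DifferentiableAt ℝ Y p := by
    intro p hp
    obtain ⟨D, hD, -⟩ := h.hasFDerivAt_combination hp
      (hasFDerivAt_polarQuarticFst C S (a := fun p : E × ℝ × ℝ => p.2.1)
        (b := fun p : E × ℝ × ℝ => p.2.2) (hasFDerivAt_fst.comp (f := Prod.snd) p hasFDerivAt_snd)
        (hasFDerivAt_snd.comp (f := Prod.snd) p hasFDerivAt_snd))
      (hasFDerivAt_polarQuarticSnd C S (a := fun p : E × ℝ × ℝ => p.2.1)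
        (b := fun p : E × ℝ × ℝ => p.2.2) (hasFDerivAt_fst.comp (f := Prod.snd) p hasFDerivAt_snd)
        (hasFDerivAt_snd.comp (f := Prod.snd) p hasFDerivAt_snd))
    rw [hY]
    exact hD.differentiableAt
  let F : V → ℝ := fun x => polarQuartic C S (e.symm x).2.1 (e.symm x).2.2
  have hpt : ∀ x ∈ W, ContDiffAt ℝ ∞ e.symm x ∧ (e.symm x).1 ∈ O ∧ Φ (e.symm x) = x ∧
      (∀ v, fderiv ℝ F x v = inner ℝ (Y (e.symm x)) v) ∧
      ∃ H : V →L[ℝ] V, HasFDerivAt (fun z => Y (e.symm z)) H x ∧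
        LinearMap.trace ℝ V (H : V →ₗ[ℝ] V)
          = 8 * (m₁ - m₀) * ((e.symm x).2.1 ^ 2 + (e.symm x).2.2 ^ 2) := by
    intro x hx
    obtain ⟨⟨hxO, hxK, hx0, hx1⟩, hxt⟩ := hball x hx
    obtain ⟨L, hL, hL'⟩ := hΦd (e.symm x) hxO hxK
    have hds : HasFDerivAt e.symm (L.symm : V →L[ℝ] E × ℝ × ℝ) x := e.hasFDerivAt_symm hxt hL
    have hcs : ContDiffAt ℝ ∞ e.symm x := e.contDiffAt_symm hxt hL (hΦs _ hxO)
    refine ⟨hcs, hxO, e.right_inv hxt, fun v => ?_, ?_⟩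
    · have hF := (hasFDerivAt_polarQuartic C S (a := fun p : E × ℝ × ℝ => p.2.1)
        (b := fun p : E × ℝ × ℝ => p.2.2) (p := e.symm x)
        (hasFDerivAt_fst.comp (f := Prod.snd) _ hasFDerivAt_snd)
        (hasFDerivAt_snd.comp (f := Prod.snd) _ hasFDerivAt_snd)).comp (f := e.symm) x hds
      have hF' : fderiv ℝ F x = _ := hF.fderiv
      obtain ⟨ξ, rfl⟩ := L.surjective v
      rw [hF', ContinuousLinearMap.comp_apply,
        show (L.symm : V →L[ℝ] E × ℝ × ℝ) (L ξ) = ξ from L.symm_apply_apply ξ, hL', hY, polarGradient, h.inner_combination_frame hxO]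
      simp
    · have hH := (hYd _ hxO).hasFDerivAt.comp (f := e.symm) x hds
      refine ⟨_, hH, ?_⟩
      rw [← hx0, ← hx1]
      rw [hΦ] at hL
      have hYH := (hYd _ hxO).hasFDerivAt
      rw [hY, hC, hS] at hYH
      refine h.trace_hessian hK hθ hxO hxK hL hYH fun ξ => ?_
      simp [hY, hC, hS]
  have hxx : ∀ x ∈ W, (inner ℝ x x : ℝ) = (e.symm x).2.1 ^ 2 + (e.symm x).2.2 ^ 2 := by
    intro x hx
    obtain ⟨-, hxO, hΦx, -⟩ := hpt x hx
    conv_lhs => rw [← hΦx, hΦ, normalPlaneMap, h.inner_combination hxO]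
    ring
  have hFs : ContDiffOn ℝ ∞ F W := by
    intro x hx
    have h1 := (hpt x hx).1
    have h2 : ContDiff ℝ ∞ fun p : E × ℝ × ℝ => polarQuartic C S p.2.1 p.2.2 := by
      simp only [polarQuartic]; fun_prop
    exact (h2.contDiffAt.comp x h1).contDiffWithinAt
  let b := stdOrthonormalBasis ℝ V
  have hpd : ∀ x ∈ W, ∀ i, partialDeriv b i F x = inner ℝ (Y (e.symm x)) (b i) :=
    fun x hx i => (hpt x hx).2.2.2.1 (b i)
  have hYY : ∀ x ∈ W, (inner ℝ (Y (e.symm x)) (Y (e.symm x)) : ℝ)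
      = 16 * (inner ℝ x x * (inner ℝ x x * inner ℝ x x)) := by
    intro x hx
    rw [hY, polarGradient, h.inner_combination (hpt x hx).2.1, hxx x hx]
    linear_combination polarQuartic_gradient hCS (e.symm x).2.1 (e.symm x).2.2
  obtain ⟨Θ, hΘ, hΘF⟩ := exists_quartic_of_cartan_munzner b hWo
    (by rw [hWdef]; exact convex_ball _ _) ⟨_, hΦW⟩ hFs (c := 8 * (m₁ - m₀))
    (fun x hx => by
      obtain ⟨-, -, -, -, H, hH, htr⟩ := hpt x hx
      rw [hxx x hx, ← htr, LinearMap.trace_eq_sum_inner _ b]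
      refine Finset.sum_congr rfl fun i _ => ?_
      -- The Laplacian is the trace of the derivative of the gradient field `Y`.
      have h1 : partialDeriv b i F =ᶠ[nhds x] fun z => inner ℝ (Y (e.symm z)) (b i) :=
        Filter.eventually_of_mem (hWo.mem_nhds hx) fun z hz => hpd z hz i
      have h2 := hH.inner ℝ (hasFDerivAt_const (b i) x)
      rw [partialDeriv, h1.fderiv_eq, h2.fderiv]
      simp [real_inner_comm])
    (fun x hx => by
      obtain ⟨-, hxO, hΦx, hgr, -⟩ := hpt x hx
      rw [eulerSum_eq_fderiv, hgr]
      nth_rewrite 2 [← hΦx]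
      rw [hY, hΦ, polarGradient, normalPlaneMap, h.inner_combination hxO]
      linear_combination polarQuartic_euler C S (e.symm x).2.1 (e.symm x).2.2)
    (fun x hx => by
      rw [← hYY x hx, ← b.sum_inner_mul_inner]
      refine Finset.sum_congr rfl fun i _ => ?_
      rw [hpd x hx, real_inner_comm (Y (e.symm x)) (b i), sq])
  have hΘY : ∀ x ∈ W, Θ x x x = Y (e.symm x) := by
    intro x hx
    apply ext_inner_right ℝ
    intro v
    rw [← hΘF x hx, (hpt x hx).2.2.2.1]
  refine ⟨Θ, hΘ, hΘ.eikonal_of_eventually (x₀ := Φ p₀) ?_, ?_⟩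
  · filter_upwards [hWo.mem_nhds hΦW] with x hx
    rw [hΘY x hx, hYY x hx]
    ring
  · rw [← hp₀, ← hΦ, ← hC, ← hS, ← hY]
    have h1 := (hΦs p₀ hp₀O).continuousAt.eventually (hWo.mem_nhds hΦW)
    filter_upwards [h1, e.open_source.mem_nhds hes] with p hpW hps
    rw [hΘY _ hpW]
    exact congrArg Y (e.left_inv hps)

/-- The quartic form along the normal geodesics. -/
theorem exists_quartic {κ₀ κ₁ κ₂ κ₃ θ : ℝ}
    (hK : IsQuarterSpaced K κ₀ κ₁ κ₂ κ₃) (hθ : Real.cos θ = κ₀ * Real.sin θ) (hu₀ : u₀ ∈ O) :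
    ∃ Θ : V →ₗ[ℝ] V →ₗ[ℝ] V →ₗ[ℝ] V, IsSymmetricQuartic Θ ∧
      (∀ y, inner ℝ (Θ y y y) (Θ y y y) = 16 * (inner ℝ y y : ℝ) ^ 3) ∧
      (∀ᶠ u in nhds u₀, ∀ t, Θ (normalGeodesic f ν t u) (normalGeodesic f ν t u)
        (normalGeodesic f ν t u) = (4 * Real.cos (3 * t - 4 * θ)) • f u
          - (4 * Real.sin (3 * t - 4 * θ)) • ν u) := by
  obtain ⟨Θ, hΘ, hΘ', hev⟩ := h.exists_quartic_cube_eq_polarGradient hK hθ hu₀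
  refine ⟨Θ, hΘ, hΘ', ?_⟩
  rw [nhds_prod_eq] at hev
  filter_upwards [hev.curry] with u hu
  have hcs : Filter.Tendsto (fun t => (Real.cos t, Real.sin t)) (nhds 0) (nhds (1, 0)) := by
    have : Continuous fun t => (Real.cos t, Real.sin t) := by fun_prop
    simpa using this.tendsto 0
  have h1 : ∀ᶠ t in nhds (0 : ℝ), (fun t => Real.cos t ^ 3 • Θ (f u) (f u) (f u)
      + (3 * (Real.cos t ^ 2 * Real.sin t)) • Θ (f u) (f u) (ν u)
      + (3 * (Real.cos t * Real.sin t ^ 2)) • Θ (f u) (ν u) (ν u)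
      + Real.sin t ^ 3 • Θ (ν u) (ν u) (ν u)) t
      = (fun t => (4 * Real.cos (3 * t - 4 * θ)) • f u
          - (4 * Real.sin (3 * t - 4 * θ)) • ν u) t := by
    filter_upwards [hcs.eventually hu] with t ht
    rw [polarGradient, polarQuarticFst_cos_sin, polarQuarticSnd_cos_sin] at ht
    rw [← hΘ.cube_combination]
    rw [neg_smul, ← sub_eq_add_neg] at ht
    exact ht
  -- The quartic was found only near the hypersurface, but both sides are analytic in `t`. The
  -- identity therefore holds on the whole circle, including its focal points.
  have h2 := AnalyticOnNhd.eq_of_eventuallyEq (𝕜 := ℝ) (z₀ := 0)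
    (fun s _ => by fun_prop) (fun s _ => by fun_prop) h1
  intro t
  have h3 := congrFun h2 t
  rw [← hΘ.cube_combination] at h3
  exact h3

end IsoparametricPatch

end Patches

/-! ### A patch determines its quartic form -/

section Patches

variable {E V : Type*} [NormedAddCommGroup E] [InnerProductSpace ℝ E] [FiniteDimensional ℝ E]
  [NormedAddCommGroup V] [InnerProductSpace ℝ V] [FiniteDimensional ℝ V]

theorem exists_smul_normalGeodesic {X : Type*} (f ν : X → V) (p : X) (a b : ℝ) :
    ∃ r t : ℝ, a • f p + b • ν p = r • normalGeodesic f ν t p := by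
  refine ⟨‖(⟨a, b⟩ : ℂ)‖, (⟨a, b⟩ : ℂ).arg, ?_⟩
  rw [normalGeodesic, smul_add, smul_smul, smul_smul, Complex.norm_mul_cos_arg,
    Complex.norm_mul_sin_arg]

namespace IsoparametricPatch

variable {O : Set E} {f ν : E → V} {K : Finset ℝ} (h : IsoparametricPatch O f ν K) {u₀ : E}
include h

/-- Quartic forms that agree along the normal geodesics of a patch have the same gradient. -/
theorem cube_eq (hu₀ : u₀ ∈ O) {Θ Ξ : V →ₗ[ℝ] V →ₗ[ℝ] V →ₗ[ℝ] V} (hΘ : IsSymmetricQuartic Θ)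
    (hΞ : IsSymmetricQuartic Ξ)
    (H : ∀ᶠ u in nhds u₀, ∀ t, Θ (normalGeodesic f ν t u) (normalGeodesic f ν t u)
        (normalGeodesic f ν t u) = Ξ (normalGeodesic f ν t u) (normalGeodesic f ν t u)
        (normalGeodesic f ν t u)) (y : V) : Θ y y y = Ξ y y y := by
  obtain ⟨L, hL, -⟩ := h.exists_hasFDerivAt_normalPlaneMap (p := ((u₀, 1, 0) : E × ℝ × ℝ)) hu₀
    (fun κ _ => by simp)
  have hs := (h.contDiffAt_normalPlaneMap (p := ((u₀, 1, 0) : E × ℝ × ℝ)) hu₀).hasStrictFDerivAt'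
    hL (by simp)
  refine hΘ.cube_eq_of_eventuallyEq hΞ
    (x₀ := normalPlaneMap f ν ((u₀, 1, 0) : E × ℝ × ℝ)) ?_ y
  rw [← hs.map_nhds_eq_of_equiv, Filter.eventually_map]
  have hfst := (continuous_fst (X := E) (Y := ℝ × ℝ)).tendsto (u₀, 1, 0)
  filter_upwards [hfst.eventually H] with p hp
  obtain ⟨r, t, hrt⟩ := exists_smul_normalGeodesic f ν p.1 p.2.1 p.2.2
  rw [normalPlaneMap, hrt]
  simp only [map_smul, LinearMap.smul_apply, hp t]

end IsoparametricPatch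

end Patches

/-! ### From patches to the connected hypersurface -/

section Hypersurfaces

variable {d : ℕ} {X : Type*} [TopologicalSpace X]
  [ChartedSpace (EuclideanSpace ℝ (Fin d)) X] [IsManifold (𝓡 d) ∞ X]
  {f ν : X → EuclideanSpace ℝ (Fin (d + 2))} {K : Finset ℝ}

/-- The parametrization is an inverse chart; the statement on neighbourhood filters carries local
results back to `X`. -/
theorem IsIsoparametric.exists_patch (h : IsIsoparametric f ν K) (hK : K.Nonempty) (p₀ : X) :
    ∃ (g : EuclideanSpace ℝ (Fin d) → X) (O : Set (EuclideanSpace ℝ (Fin d)))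
      (u₀ : EuclideanSpace ℝ (Fin d)), IsoparametricPatch O (f ∘ g) (ν ∘ g) K ∧ u₀ ∈ O ∧
      g u₀ = p₀ ∧ Filter.map g (nhds u₀) = nhds p₀ := by
  have : IsManifold (𝓡 d) 1 X := IsManifold.of_le (n := ∞) (by norm_cast)
  obtain ⟨e, he⟩ : ∃ e, e = chartAt (EuclideanSpace ℝ (Fin d)) p₀ := ⟨_, rfl⟩
  have hp₀ : p₀ ∈ e.source := by rw [he]; exact mem_chart_source _ p₀
  have hes : ContMDiffOn (𝓡 d) (𝓡 d) ∞ e.symm e.target := by rw [he]; exact contMDiffOn_chart_symm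
  have hed : e.symm.MDifferentiable (𝓡 d) (𝓡 d) := by rw [he]; exact (mdifferentiable_chart p₀).symm
  have hbij : ∀ u ∈ e.target, Function.Bijective (mfderiv (𝓡 d) (𝓡 d) e.symm u) :=
    fun u hu => hed.mfderiv_bijective hu
  have hcomp : ∀ F : X → EuclideanSpace ℝ (Fin (d + 2)),
      ContMDiff (𝓡 d) 𝓘(ℝ, EuclideanSpace ℝ (Fin (d + 2))) ∞ F →
      ContDiffOn ℝ ∞ (F ∘ e.symm) e.target ∧ ∀ u ∈ e.target, ∀ v,
        fderiv ℝ (F ∘ e.symm) u v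
          = differential d F (e.symm u) (mfderiv (𝓡 d) (𝓡 d) e.symm u v) := by
    intro F hF
    refine ⟨contMDiffOn_iff_contDiffOn.mp (hF.comp_contMDiffOn hes), fun u hu v => ?_⟩
    rw [← mfderiv_eq_fderiv, mfderiv_comp u (hF.mdifferentiableAt (by simp))
      (hed.mdifferentiableAt hu)]
    rfl
  have hf := hcomp f h.hypersurface.smooth
  have hν := hcomp ν h.hypersurface.smooth_normal
  refine ⟨e.symm, e.target, e p₀, ?_, e.map_source hp₀, e.left_inv hp₀, ?_⟩
  · refine ⟨by simp, e.open_target, hf.1, hν.1, fun u hu => ?_, fun u _ =>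
      h.hypersurface.norm_eq_one _, fun u _ => h.hypersurface.norm_normal _, fun u _ =>
      h.hypersurface.normal_perp_position _, fun u hu v => ?_, fun u hu κ => ?_, hK⟩
    · intro v w hvw
      rw [hf.2 u hu, hf.2 u hu] at hvw
      exact (hbij u hu).1 (h.hypersurface.immersion _ hvw)
    · rw [hf.2 u hu]; exact h.hypersurface.normal_perp_tangent _ _
    · rw [← h.curvatures (e.symm u) κ]
      constructor
      · rintro ⟨v, hv, hv'⟩
        rw [hf.2 u hu, hν.2 u hu] at hv'
        exact ⟨_, fun h0 => hv ((hbij u hu).1 (h0.trans (map_zero _).symm)), hv'⟩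
      · rintro ⟨w, hw, hw'⟩
        obtain ⟨v, rfl⟩ : ∃ v : EuclideanSpace ℝ (Fin d), mfderiv (𝓡 d) (𝓡 d) e.symm u v = w :=
          (hbij u hu).2 w
        refine ⟨v, fun h0 => hw ?_, ?_⟩
        · rw [h0]; exact map_zero _
        rw [hf.2 u hu, hν.2 u hu]
        exact hw'
  · rw [e.symm.map_nhds_eq (e.map_source hp₀)]
    exact congrArg nhds (e.left_inv hp₀)

/-- The set of points near which one fixed local form works is open. It is also closed: near a limit
point the local form there agrees with the fixed one along an open family of normal geodesics, so
both have the same gradient by `cube_eq`. Connectedness concludes. -/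
theorem IsIsoparametric.exists_quartic [ConnectedSpace X] (h : IsIsoparametric f ν K)
    (hK : K.card = 4) {κ₀ θ : ℝ} (hκ₀ : κ₀ ∈ K) (hθ : Real.cos θ = κ₀ * Real.sin θ) :
    ∃ Θ : EuclideanSpace ℝ (Fin (d + 2)) →ₗ[ℝ] EuclideanSpace ℝ (Fin (d + 2)) →ₗ[ℝ]
        EuclideanSpace ℝ (Fin (d + 2)) →ₗ[ℝ] EuclideanSpace ℝ (Fin (d + 2)),
      IsSymmetricQuartic Θ ∧
      (∀ y, inner ℝ (Θ y y y) (Θ y y y) = 16 * (inner ℝ y y : ℝ) ^ 3) ∧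
      (∀ p t, Θ (normalGeodesic f ν t p) (normalGeodesic f ν t p) (normalGeodesic f ν t p)
        = (4 * Real.cos (3 * t - 4 * θ)) • f p - (4 * Real.sin (3 * t - 4 * θ)) • ν p) := by
  have hne : K.Nonempty := ⟨κ₀, hκ₀⟩
  have hloc : ∀ p₀ : X, ∃ Θ : EuclideanSpace ℝ (Fin (d + 2)) →ₗ[ℝ]
        EuclideanSpace ℝ (Fin (d + 2)) →ₗ[ℝ]
        EuclideanSpace ℝ (Fin (d + 2)) →ₗ[ℝ] EuclideanSpace ℝ (Fin (d + 2)),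
      IsSymmetricQuartic Θ ∧
      (∀ y, inner ℝ (Θ y y y) (Θ y y y) = 16 * (inner ℝ y y : ℝ) ^ 3) ∧
      (∀ᶠ p in nhds p₀, ∀ t,
        Θ (normalGeodesic f ν t p) (normalGeodesic f ν t p) (normalGeodesic f ν t p)
        = (4 * Real.cos (3 * t - 4 * θ)) • f p - (4 * Real.sin (3 * t - 4 * θ)) • ν p) := by
    intro p₀
    obtain ⟨g, O, u₀, hp, hu₀, -, hmap⟩ := h.exists_patch hne p₀
    obtain ⟨κ₁, κ₂, κ₃, hq⟩ := hp.exists_isQuarterSpaced hu₀ hK hκ₀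
    obtain ⟨Θ, hΘ, hΘe, hΘγ⟩ := hp.exists_quartic hq hθ hu₀
    refine ⟨Θ, hΘ, hΘe, ?_⟩
    rw [← hmap, Filter.eventually_map]
    exact hΘγ
  obtain ⟨p₀⟩ : Nonempty X := inferInstance
  obtain ⟨Θ, hΘ, hΘe, hΘγ⟩ := hloc p₀
  refine ⟨Θ, hΘ, hΘe, ?_⟩
  obtain ⟨S, hS⟩ : ∃ S : Set X, S = {p₁ | ∀ᶠ p in nhds p₁, ∀ t,
        Θ (normalGeodesic f ν t p) (normalGeodesic f ν t p) (normalGeodesic f ν t p)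
        = (4 * Real.cos (3 * t - 4 * θ)) • f p - (4 * Real.sin (3 * t - 4 * θ)) • ν p} := ⟨_, rfl⟩
  have hSo : IsOpen S := by rw [hS]; exact isOpen_setOfPred_eventually_nhds
  have hSc : IsClosed S := by
    refine isClosed_of_closure_subset fun p₁ hp₁ => ?_
    obtain ⟨Ξ, hΞ, -, hΞγ⟩ := hloc p₁
    obtain ⟨p₂, hp₂, hp₂'⟩ :=
      ((mem_closure_iff_frequently.mp hp₁).and_eventually hΞγ.eventually_nhds).exists
    rw [hS] at hp₂
    obtain ⟨g, O, u₀, hp, hu₀, -, hmap⟩ := h.exists_patch hne p₂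
    have heq := hp.cube_eq hu₀ hΘ hΞ (by
      have h1 := hp₂.and hp₂'
      rw [← hmap, Filter.eventually_map] at h1
      filter_upwards [h1] with u hu t
      exact (hu.1 t).trans (hu.2 t).symm)
    rw [hS]
    filter_upwards [hΞγ] with p hp t
    rw [heq, hp]
  have huniv : S = Set.univ := IsClopen.eq_univ ⟨hSc, hSo⟩ ⟨p₀, by rw [hS]; exact hΘγ⟩
  intro p
  have : p ∈ S := by rw [huniv]; trivial
  rw [hS] at this
  exact this.self_of_nhds

end Hypersurfaces

/-! ### Algebra of the quartic form on the focal set -/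

section QuarticForms

variable {V : Type*} [NormedAddCommGroup V] [InnerProductSpace ℝ V]

namespace IsSymmetricQuartic

variable {Θ : V →ₗ[ℝ] V →ₗ[ℝ] V →ₗ[ℝ] V} (hΘ : IsSymmetricQuartic Θ)
include hΘ

theorem inner_comm_left (x v w : V) : inner ℝ (Θ x x v) w = inner ℝ (Θ x x w) v :=
  hΘ.inner_swap x x v w

theorem neg : IsSymmetricQuartic (-Θ) where
  swap_left a b c := by simp only [LinearMap.neg_apply]; rw [hΘ.swap_left]
  swap_right a b c := by simp only [LinearMap.neg_apply]; rw [hΘ.swap_right]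
  inner_swap a b c d := by
    simp only [LinearMap.neg_apply, inner_neg_left]; rw [hΘ.inner_swap]

theorem inner_eq_zero_of_eigenvectors {x v w : V} {a b : ℝ} (hab : a ≠ b)
    (hv : Θ x x v = a • v) (hw : Θ x x w = b • w) : inner ℝ v w = 0 := by
  have h := hΘ.inner_comm_left x v w
  rw [hv, hw, inner_smul_left, inner_smul_left, real_inner_comm v w, conj_trivial,
    conj_trivial] at h
  have h2 : (a - b) * inner ℝ v w = 0 := by linarith
  exact (mul_eq_zero.mp h2).resolve_left (sub_ne_zero.mpr hab)

/-- On the focal set of a quartic form, normal vectors and base points can be interchanged. -/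
theorem swap_of_eikonal
    (heik : ∀ y, inner ℝ (Θ y y y) (Θ y y y) = 16 * (inner ℝ y y : ℝ) ^ 3) {x n : V}
    (hx : inner ℝ x x = 1) (hn : inner ℝ n n = 1) (hnx : inner ℝ n x = 0)
    (hZx : Θ x x x = (4 : ℝ) • x) (hZn : Θ x x n = (-4 : ℝ) • n) :
    Θ n n n = (4 : ℝ) • n ∧ Θ n n x = (-4 : ℝ) • x := by
  have hxn : inner ℝ x n = 0 := by rw [real_inner_comm]; exact hnx
  obtain ⟨w, hw⟩ : ∃ w, w = Θ x n n := ⟨_, rfl⟩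
  obtain ⟨z, hz⟩ : ∃ z, z = Θ n n n := ⟨_, rfl⟩
  have hw' : Θ n n x = w := by rw [hΘ.swap_right, hΘ.swap_left, hw]
  have hq : inner ℝ x w = -4 := by
    rw [hw, real_inner_comm, hΘ.swap_right, hΘ.inner_swap, hΘ.swap_right, hZn, inner_smul_left, hn]
    simp
  have hwx : inner ℝ w x = -4 := by rw [real_inner_comm]; exact hq
  have hzz : inner ℝ z z = 16 := by rw [hz, heik, hn]; norm_num
  -- Adding the eikonal identities at `x + n` and `x - n` removes the terms odd in `n` and leaves `9
  -- |w|² - 24 ⟪n, z⟫ = 48`. But `⟪x, w⟫ = -4` gives `|w|² ≥ 16`, and `|z| = 4` gives `⟪n, z⟫ ≤ 4`.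
  -- Hence both are equalities, with `w = -4x` and `z = 4n`.
  have h1 := heik ((1 : ℝ) • x + (1 : ℝ) • n)
  have h2 := heik ((1 : ℝ) • x + (-1 : ℝ) • n)
  rw [hΘ.cube_combination, hZx, hZn, ← hw, ← hz] at h1 h2
  simp only [inner_add_left, inner_add_right, inner_smul_left, inner_smul_right, hx, hn, hnx, hxn,
    hq, hwx, hzz, conj_trivial] at h1 h2
  have hzn : inner ℝ z n = inner ℝ n z := real_inner_comm _ _
  have h3 : 9 * inner ℝ w w - 24 * inner ℝ n z = 48 := by
    rw [hzn] at h1 h2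
    linarith
  have h4 : 0 ≤ inner ℝ (w + (4 : ℝ) • x) (w + (4 : ℝ) • x) := real_inner_self_nonneg
  have h5 : 0 ≤ inner ℝ (z - (4 : ℝ) • n) (z - (4 : ℝ) • n) := real_inner_self_nonneg
  have h4' : inner ℝ (w + (4 : ℝ) • x) (w + (4 : ℝ) • x) = inner ℝ w w - 16 := by
    simp only [inner_add_left, inner_add_right, inner_smul_left, inner_smul_right, hx, hq, hwx,
      conj_trivial]
    ring
  have h5' : inner ℝ (z - (4 : ℝ) • n) (z - (4 : ℝ) • n) = 32 - 8 * inner ℝ n z := by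
    simp only [inner_sub_left, inner_sub_right, inner_smul_left, inner_smul_right, hn, hzz, hzn,
      conj_trivial]
    ring
  have h6 : inner ℝ (z - (4 : ℝ) • n) (z - (4 : ℝ) • n) = 0 := by linarith
  have h7 : inner ℝ (w + (4 : ℝ) • x) (w + (4 : ℝ) • x) = 0 := by linarith
  constructor
  · rw [← hz]; exact sub_eq_zero.mp ((inner_self_eq_zero (𝕜 := ℝ)).mp h6)
  · rw [hw', neg_smul]; exact eq_neg_of_add_eq_zero_left ((inner_self_eq_zero (𝕜 := ℝ)).mp h7)

/-- Differentiate `Θ y y y = 4 y` along `M`; the cube contributes the factor three. -/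
theorem eigenvector_of_mem_tangentConeAt [FiniteDimensional ℝ V] {M : Set V} {x v : V}
    (hM : ∀ y ∈ M, Θ y y y = (4 : ℝ) • y) (hx : x ∈ M) (hv : v ∈ tangentConeAt ℝ M x) :
    Θ x x v = (4 / 3 : ℝ) • v := by
  have h1 : HasFDerivWithinAt (fun y => Θ y y y - (4 : ℝ) • y) _ M x :=
    ((hΘ.hasFDerivAt_cube x).sub ((hasFDerivAt_id x).const_smul (4 : ℝ))).hasFDerivWithinAt
  have h2 : HasFDerivWithinAt (fun y => Θ y y y - (4 : ℝ) • y) (0 : V →L[ℝ] V) M x :=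
    (hasFDerivWithinAt_const (0 : V) x M).congr (fun y hy => sub_eq_zero.mpr (hM y hy))
      (sub_eq_zero.mpr (hM x hx))
  have h3 := h1.unique_on h2 hv
  simp at h3
  have h4 : (3 : ℝ) • Θ x x v = (4 : ℝ) • v := sub_eq_zero.mp h3
  rw [div_eq_inv_mul, mul_smul, ← h4, smul_smul]
  norm_num

end IsSymmetricQuartic

theorem normalGeodesic_add {X : Type*} (f ν : X → V) (t s : ℝ) (p : X) :
    normalGeodesic f ν (t + s) p
      = Real.cos s • normalGeodesic f ν t p + Real.sin s • normalVelocity f ν t p := by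
  simp only [normalGeodesic, normalVelocity, Real.cos_add, Real.sin_add]
  module

theorem hasDerivAt_normalGeodesic {X : Type*} (f ν : X → V) (t : ℝ) (p : X) :
    HasDerivAt (fun t => normalGeodesic f ν t p) (normalVelocity f ν t p) t := by
  have h := ((Real.hasDerivAt_cos t).smul_const (f p)).add
    ((Real.hasDerivAt_sin t).smul_const (ν p))
  rw [neg_smul] at h
  exact h

/-- `Θ` is the quartic form of Cartan and Münzner of the hypersurface `(f, ν)` with focal
distance `θ`. -/
structure IsCartanMunzner {X : Type*} (Θ : V →ₗ[ℝ] V →ₗ[ℝ] V →ₗ[ℝ] V) (f ν : X → V) (θ : ℝ) :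
    Prop where
  symm : IsSymmetricQuartic Θ
  eikonal : ∀ y, inner ℝ (Θ y y y) (Θ y y y) = 16 * (inner ℝ y y : ℝ) ^ 3
  geodesic : ∀ p t, Θ (normalGeodesic f ν t p) (normalGeodesic f ν t p) (normalGeodesic f ν t p)
    = (4 * Real.cos (3 * t - 4 * θ)) • f p - (4 * Real.sin (3 * t - 4 * θ)) • ν p

namespace IsCartanMunzner

variable {X : Type*} {Θ : V →ₗ[ℝ] V →ₗ[ℝ] V →ₗ[ℝ] V} {f ν : X → V} {θ : ℝ}
  (H : IsCartanMunzner Θ f ν θ)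
include H

/-- Changing the sign of the quartic exchanges its maxima and minima on the sphere, which lie `π/4`
apart on each normal circle. Everything proved for one focal set thus applies to the other. -/
theorem rotate : IsCartanMunzner (-Θ) f ν (θ + Real.pi / 4) where
  symm := H.symm.neg
  eikonal y := by simp only [LinearMap.neg_apply, inner_neg_neg]; exact H.eikonal y
  geodesic p t := by
    simp only [LinearMap.neg_apply]
    rw [H.geodesic p t, show 3 * t - 4 * (θ + Real.pi / 4) = 3 * t - 4 * θ - Real.pi by ring,
      Real.cos_sub_pi, Real.sin_sub_pi]
    module

theorem focal_cube (p : X) :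
    Θ (normalGeodesic f ν θ p) (normalGeodesic f ν θ p) (normalGeodesic f ν θ p)
      = (4 : ℝ) • normalGeodesic f ν θ p := by
  rw [H.geodesic p θ, show 3 * θ - 4 * θ = -θ by ring, Real.cos_neg, Real.sin_neg, normalGeodesic]
  module

/-- Differentiate the identity along the normal geodesic in `t` at `t = θ`. -/
theorem focal_normalVelocity [FiniteDimensional ℝ V] (p : X) :
    Θ (normalGeodesic f ν θ p) (normalGeodesic f ν θ p) (normalVelocity f ν θ p)
      = (-4 : ℝ) • normalVelocity f ν θ p := by
  have h1 := (H.symm.hasFDerivAt_cube (normalGeodesic f ν θ p)).comp_hasDerivAt θ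
    (hasDerivAt_normalGeodesic f ν θ p)
  have h0 : HasDerivAt (fun t : ℝ => 3 * t - 4 * θ) 3 θ := by
    simpa using ((hasDerivAt_id θ).const_mul 3).sub_const (4 * θ)
  have h2 := ((h0.cos.const_mul 4).smul_const (f p)).sub ((h0.sin.const_mul 4).smul_const (ν p))
  have h3 := h1.unique (h2.congr_of_eventuallyEq (Filter.Eventually.of_forall (H.geodesic p)))
  simp only [LinearMap.coe_toContinuousLinearMap', LinearMap.smul_apply,
    show 3 * θ - 4 * θ = -θ by ring, Real.cos_neg, Real.sin_neg] at h3
  have h4 : (3 : ℝ) • Θ (normalGeodesic f ν θ p) (normalGeodesic f ν θ p) (normalVelocity f ν θ p)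
      = (3 : ℝ) • ((-4 : ℝ) • normalVelocity f ν θ p) := by
    rw [h3, normalVelocity]; module
  exact smul_right_injective V (three_ne_zero' ℝ) h4

end IsCartanMunzner

end QuarticForms

/-! ### Leaf directions at a focal point -/

section Patches

variable {E V : Type*} [NormedAddCommGroup E] [InnerProductSpace ℝ E] [FiniteDimensional ℝ E]
  [NormedAddCommGroup V] [InnerProductSpace ℝ V] [FiniteDimensional ℝ V]

namespace IsoparametricPatch

variable {O : Set E} {f ν : E → V} {K : Finset ℝ} (h : IsoparametricPatch O f ν K) {u : E}
include h

/-- At the focal point the differential kills `e`, so differentiating the geodesic identity there in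
the direction `e` gives nothing. For general `t` both sides, multiplied by `sin θ`, carry the factor
`sin (θ - t)`; it is divided out before letting `t` tend to `θ`. -/
theorem focal_leaf_eigenvector {Θ : V →ₗ[ℝ] V →ₗ[ℝ] V →ₗ[ℝ] V} {κ₀ θ : ℝ}
    (H : IsCartanMunzner Θ f ν θ) (hθ : Real.cos θ = κ₀ * Real.sin θ) (hu : u ∈ O) {e : E}
    (he : shapeOperator f ν u e = κ₀ • e) :
    Θ (normalGeodesic f ν θ u) (normalGeodesic f ν θ u) (fderiv ℝ f u e)
      = (-4 : ℝ) • fderiv ℝ f u e := by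
  obtain ⟨G, hG⟩ : ∃ G : ℝ → V, G = fun t => (3 : ℝ) • Θ (normalGeodesic f ν t u)
    (normalGeodesic f ν t u) (fderiv ℝ f u e)
      + (4 * (3 - 4 * Real.sin (θ - t) ^ 2)) • fderiv ℝ f u e := ⟨_, rfl⟩
  have hGc : Continuous G := by
    have : ∀ t, Θ (normalGeodesic f ν t u) (normalGeodesic f ν t u) (fderiv ℝ f u e)
        = (Real.cos t ^ 2) • Θ (f u) (f u) (fderiv ℝ f u e)
          + (2 * (Real.cos t * Real.sin t)) • Θ (f u) (ν u) (fderiv ℝ f u e)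
          + (Real.sin t ^ 2) • Θ (ν u) (ν u) (fderiv ℝ f u e) := by
      intro t
      simp only [normalGeodesic, map_add, map_smul, LinearMap.add_apply, LinearMap.smul_apply]
      rw [H.symm.swap_left (ν u) (f u)]
      module
    rw [hG]
    simp only [this]
    fun_prop
  have hG0 : ∀ t, Real.sin (θ - t) • G t = 0 := by
    intro t
    have h1 := (H.symm.hasFDerivAt_cube (normalGeodesic f ν t u)).comp (f := normalGeodesic f ν t) u
      ((h.contDiffAt_normalGeodesic hu t).differentiableAt (by simp)).hasFDerivAt
    have h2 := ((h.hasFDerivAt hu).const_smul (4 * Real.cos (3 * t - 4 * θ))).sub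
      ((h.hasFDerivAt_normal hu).const_smul (4 * Real.sin (3 * t - 4 * θ)))
    have h3 := h1.unique (h2.congr_of_eventuallyEq
      (Filter.Eventually.of_forall fun v => H.geodesic v t))
    have h4 := congrArg (fun B : E →L[ℝ] V => B e) h3
    simp only [ContinuousLinearMap.comp_apply, sub_apply, smul_apply,
      LinearMap.coe_toContinuousLinearMap',
      h.fderiv_normalGeodesic_eigenvector hu t he, h.fderiv_normal_eigenvector hu he,
      map_smul] at h4
    have h5 : Real.sin θ * (Real.cos t - κ₀ * Real.sin t) = Real.sin (θ - t) := by
      rw [Real.sin_sub, hθ]; ring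
    have h6 : Real.sin θ * (4 * Real.cos (3 * t - 4 * θ) + 4 * Real.sin (3 * t - 4 * θ) * κ₀)
        = -(4 * (3 - 4 * Real.sin (θ - t) ^ 2)) * Real.sin (θ - t) := by
      have h7 := Real.sin_three_mul (θ - t)
      have h8 : Real.sin (3 * (θ - t)) = -Real.sin (θ + (3 * t - 4 * θ)) := by
        rw [← Real.sin_neg]; congr 1; ring
      rw [h8, Real.sin_add, hθ] at h7
      linear_combination -4 * h7
    have h7 := congrArg (fun y => Real.sin θ • y) h4
    simp only [smul_sub, smul_neg, smul_smul] at h7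
    rw [hG]
    simp only [smul_add, smul_smul]
    have h8 : Real.sin (θ - t) * (4 * (3 - 4 * Real.sin (θ - t) ^ 2))
        = -(Real.sin θ * (4 * Real.cos (3 * t - 4 * θ) + 4 * Real.sin (3 * t - 4 * θ) * κ₀)) := by
      rw [h6]; ring
    rw [h8, ← h5]
    have h9 : (Real.sin θ * (Real.cos t - κ₀ * Real.sin t) * 3) • Θ (normalGeodesic f ν t u)
        (normalGeodesic f ν t u) (fderiv ℝ f u e)
        = (Real.sin θ * (4 * Real.cos (3 * t - 4 * θ))) • fderiv ℝ f u e
        - -((Real.sin θ * (4 * Real.sin (3 * t - 4 * θ) * κ₀)) • fderiv ℝ f u e) := by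
      rw [← h7]; congr 1; ring
    rw [h9]
    module
  -- The zero of `sin (θ - t)` at `t = θ` is simple, hence isolated.
  have hne : ∀ᶠ t in nhdsWithin θ {θ}ᶜ, G t = 0 := by
    have hd : HasDerivAt (fun t => Real.sin (θ - t)) (-1) θ := by
      have := ((hasDerivAt_id θ).const_sub θ).sin
      simpa using this
    filter_upwards [hd.eventually_ne (c := 0) (by norm_num)] with t ht
    exact (smul_eq_zero.mp (hG0 t)).resolve_left ht
  have hlim : Filter.Tendsto G (nhdsWithin θ {θ}ᶜ) (nhds (G θ)) :=
    hGc.continuousAt.tendsto.mono_left nhdsWithin_le_nhds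
  have h0 : G θ = 0 :=
    tendsto_nhds_unique hlim (tendsto_const_nhds.congr' (hne.mono fun t ht => ht.symm))
  rw [hG] at h0
  simp only [sub_self, Real.sin_zero] at h0
  have h1 : (3 : ℝ) • Θ (normalGeodesic f ν θ u) (normalGeodesic f ν θ u) (fderiv ℝ f u e)
      = (3 : ℝ) • ((-4 : ℝ) • fderiv ℝ f u e) := by
    rw [eq_neg_of_add_eq_zero_left h0]; module
  exact smul_right_injective V (three_ne_zero' ℝ) h1

end IsoparametricPatch

end Patches

/-- If `4θ` were a multiple of `π`, one of the four principal angles would be a multiple of `π` and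
have no cotangent. Geometrically, the hypersurface is a regular level of the quartic. -/
theorem IsQuarterSpaced.sin_four_mul_ne_zero {K : Finset ℝ} {κ₀ κ₁ κ₂ κ₃ θ : ℝ}
    (hK : IsQuarterSpaced K κ₀ κ₁ κ₂ κ₃) (hθ : Real.cos θ = κ₀ * Real.sin θ)
    (hs : Real.sin θ ≠ 0) : Real.sin (4 * θ) ≠ 0 := by
  have h1 : Real.sin (4 * θ) = 4 * Real.sin θ ^ 4 * (κ₀ * ((κ₀ - 1) * (κ₀ + 1))) := by
    rw [show 4 * θ = 2 * (2 * θ) by ring, Real.sin_two_mul, Real.sin_two_mul, Real.cos_two_mul', hθ]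
    ring
  have r1 := hK.rel1
  have r2 := hK.rel2
  have r13 := hK.rel13
  rw [h1]
  refine mul_ne_zero (by positivity) (mul_ne_zero ?_ (mul_ne_zero ?_ ?_))
  · rintro rfl; simp at r2
  · intro h0
    have h2 : κ₀ = 1 := by linarith
    rw [h2] at r1
    have h3 : κ₁ = 0 := by linarith
    rw [h3] at r13
    simp at r13
  · intro h0
    have h2 : κ₀ = -1 := by linarith
    rw [h2] at r1
    linarith

/-! ### Great circles normal to the focal set -/

section QuarticForms

variable {V : Type*} [NormedAddCommGroup V] [InnerProductSpace ℝ V]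

namespace IsSymmetricQuartic

variable {Θ : V →ₗ[ℝ] V →ₗ[ℝ] V →ₗ[ℝ] V} (hΘ : IsSymmetricQuartic Θ)
include hΘ

/-- The gradient along a great circle normal to the focal set. -/
theorem cube_normal_circle
    (heik : ∀ y, inner ℝ (Θ y y y) (Θ y y y) = 16 * (inner ℝ y y : ℝ) ^ 3) {x n : V}
    (hx : inner ℝ x x = 1) (hn : inner ℝ n n = 1) (hnx : inner ℝ n x = 0)
    (hZx : Θ x x x = (4 : ℝ) • x) (hZn : Θ x x n = (-4 : ℝ) • n) (s : ℝ) :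
    Θ (Real.cos s • x + Real.sin s • n) (Real.cos s • x + Real.sin s • n)
      (Real.cos s • x + Real.sin s • n)
      = (4 * Real.cos (3 * s)) • x - (4 * Real.sin (3 * s)) • n := by
  obtain ⟨h1, h2⟩ := hΘ.swap_of_eikonal heik hx hn hnx hZx hZn
  have h3 : Θ x n n = (-4 : ℝ) • x := by rw [← h2, hΘ.swap_right n n x, hΘ.swap_left n x n]
  rw [hΘ.cube_combination, hZx, hZn, h3, h1, Real.cos_three_mul, Real.sin_three_mul]
  have hcs := Real.sin_sq_add_cos_sq s
  match_scalars
  · linear_combination (-12 * Real.cos s) * hcs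
  · linear_combination (-12 * Real.sin s) * hcs

end IsSymmetricQuartic

namespace IsCartanMunzner

variable {X : Type*} {Θ : V →ₗ[ℝ] V →ₗ[ℝ] V →ₗ[ℝ] V} {f ν : X → V} {θ : ℝ}
  (H : IsCartanMunzner Θ f ν θ)
include H

/-- A point of the hypersurface on a great circle normal to the focal set determines the
circle. -/
theorem normalGeodesic_eq_of_position (hs : Real.sin (4 * θ) ≠ 0) {x n : V}
    (hx : inner ℝ x x = 1) (hn : inner ℝ n n = 1) (hnx : inner ℝ n x = 0)
    (hZx : Θ x x x = (4 : ℝ) • x) (hZn : Θ x x n = (-4 : ℝ) • n) {p : X}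
    (hp : f p = Real.cos θ • x - Real.sin θ • n) :
    normalGeodesic f ν θ p = x ∧ normalVelocity f ν θ p = n := by
  have hcs := Real.sin_sq_add_cos_sq θ
  have h1 := H.symm.cube_normal_circle H.eikonal hx hn hnx hZx hZn (-θ)
  have h2 := H.geodesic p 0
  have h0 : normalGeodesic f ν 0 p = f p := by simp [normalGeodesic]
  rw [Real.cos_neg, Real.sin_neg, neg_smul, ← sub_eq_add_neg, ← hp] at h1
  rw [h0, h1, mul_zero, zero_sub, Real.cos_neg, Real.sin_neg,
    show 3 * -θ = θ - 4 * θ by ring, Real.cos_sub, Real.sin_sub, hp] at h2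
  -- The gradient at `f p` is known twice, from the normal geodesic at `t = 0` and from the circle
  -- through `x` and `n`. Comparing them determines `ν p`, since `sin (4θ)` is nonzero.
  have h3 : (4 * Real.sin (4 * θ)) • ν p
      = (4 * Real.sin (4 * θ)) • (Real.sin θ • x + Real.cos θ • n) := by
    have h4 : (4 * Real.sin (4 * θ)) • ν p = (4 * (Real.cos θ * Real.cos (4 * θ)
        + Real.sin θ * Real.sin (4 * θ))) • x
        - (4 * (Real.sin θ * Real.cos (4 * θ) - Real.cos θ * Real.sin (4 * θ))) • n
        - (4 * Real.cos (4 * θ)) • (Real.cos θ • x - Real.sin θ • n) := by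
      rw [h2]; module
    rw [h4]; module
  have h4 := smul_right_injective V (mul_ne_zero four_ne_zero hs) h3
  constructor
  · rw [normalGeodesic, hp, h4]
    match_scalars
    · linear_combination hcs
    · ring
  · rw [normalVelocity, hp, h4]
    match_scalars
    · ring
    · linear_combination hcs

end IsCartanMunzner

end QuarticForms

/-! ### The hypersurface as a local level set -/

section Hypersurfaces

variable {d : ℕ} {X : Type*} [TopologicalSpace X]
  [ChartedSpace (EuclideanSpace ℝ (Fin d)) X] [IsManifold (𝓡 d) ∞ X]
  {f ν : X → EuclideanSpace ℝ (Fin (d + 2))} {K : Finset ℝ}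
  {Θ : EuclideanSpace ℝ (Fin (d + 2)) →ₗ[ℝ] EuclideanSpace ℝ (Fin (d + 2)) →ₗ[ℝ]
    EuclideanSpace ℝ (Fin (d + 2)) →ₗ[ℝ] EuclideanSpace ℝ (Fin (d + 2))} {κ₀ θ : ℝ}

namespace IsIsoparametric

variable (h : IsIsoparametric f ν K)
include h

theorem inner_self (p : X) : inner ℝ (f p) (f p) = 1 := by
  rw [real_inner_self_eq_norm_sq, h.hypersurface.norm_eq_one p]; norm_num

theorem inner_normal_self (p : X) : inner ℝ (ν p) (ν p) = 1 := by
  rw [real_inner_self_eq_norm_sq, h.hypersurface.norm_normal p]; norm_num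

/-- The height function in the direction `y` is critical at `p`, so `y` is orthogonal to the tangent
space there. -/
theorem exists_eq_of_isMax (hK : K.Nonempty) {y : EuclideanSpace ℝ (Fin (d + 2))} {p : X}
    (hp : ∀ q, inner ℝ (f q) y ≤ inner ℝ (f p) y) : ∃ a b : ℝ, y = a • f p + b • ν p := by
  obtain ⟨g, O, u₀, hpatch, hu₀, rfl, -⟩ := h.exists_patch hK p
  refine hpatch.exists_eq_of_perp_tangent hu₀ fun v => ?_
  have h1 := (hpatch.hasFDerivAt hu₀).inner ℝ (hasFDerivAt_const y u₀)
  have h2 : IsLocalMax (fun u => (inner ℝ ((f ∘ g) u) y : ℝ)) u₀ :=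
    Filter.Eventually.of_forall fun u => hp (g u)
  have h3 := congrArg (fun B : EuclideanSpace ℝ (Fin d) →L[ℝ] ℝ => B v) (h2.hasFDerivAt_eq_zero h1)
  simpa [real_inner_comm] using h3

/-- Near each of its points, the hypersurface is a level set in the sphere of its quartic form. -/
theorem eventually_mem_range [CompactSpace X] (hK : K.Nonempty) (H : IsCartanMunzner Θ f ν θ)
    (hs : Real.sin (4 * θ) ≠ 0) (q : X) :
    ∀ᶠ y in nhds (f q), inner ℝ y y = 1 → inner ℝ (Θ y y y) y = 4 * Real.cos (4 * θ) →
      ∃ p, f p = y := by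
  -- Along a normal geodesic the quartic is `cos (4t - 4θ)` up to a factor. Its derivative at `0` is
  -- nonzero, so nearby the level is attained only at `t = 0`.
  have hd : HasDerivAt (fun t => Real.cos (4 * t - 4 * θ)) (4 * Real.sin (4 * θ)) 0 := by
    have h1 := (((hasDerivAt_id (0 : ℝ)).const_mul 4).sub_const (4 * θ)).cos
    simp only [id, mul_zero, zero_sub, mul_one, Real.sin_neg, neg_neg] at h1
    exact h1.congr_deriv (mul_comm _ _)
  have hb : ∀ᶠ b in nhds (0 : ℝ),
      Real.cos (4 * Real.arcsin b - 4 * θ) = Real.cos (4 * θ) → b = 0 := by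
    have h1 := hd.eventually_ne (c := Real.cos (4 * θ)) (mul_ne_zero four_ne_zero hs)
    rw [eventually_nhdsWithin_iff] at h1
    have h2 : Filter.Tendsto Real.arcsin (nhds 0) (nhds 0) := by
      simpa using Real.continuous_arcsin.tendsto 0
    filter_upwards [h2.eventually h1] with b hb heq
    by_contra hne
    exact hb (fun h0 => hne (Real.arcsin_eq_zero_iff.mp h0)) heq
  obtain ⟨δ, hδ, hδb⟩ := Metric.eventually_nhds_iff.mp hb
  have hc : Continuous fun y : EuclideanSpace ℝ (Fin (d + 2)) => (inner ℝ (f q) y : ℝ) := by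
    fun_prop
  have e1 : ∀ᶠ y in nhds (f q), 0 < (inner ℝ (f q) y : ℝ) :=
    hc.continuousAt.eventually_const_lt (by simp only [h.inner_self q]; norm_num)
  have e2 : ∀ᶠ y in nhds (f q), 1 - (inner ℝ (f q) y : ℝ) ^ 2 < δ ^ 2 :=
    (continuous_const.sub (hc.pow 2)).continuousAt.eventually_lt_const
      (by
        change 1 - (inner ℝ (f q) (f q) : ℝ) ^ 2 < δ ^ 2
        rw [h.inner_self q]; norm_num; positivity)
  filter_upwards [e1, e2] with y h1 h2 hy hlev
  have hfc : Continuous fun p => (inner ℝ (f p) y : ℝ) :=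
    (h.hypersurface.smooth.continuous).inner continuous_const
  -- On the unit sphere the maximizer is the point of the hypersurface nearest to `y`, and `y` lies
  -- on its normal circle.
  obtain ⟨p, -, hp⟩ := isCompact_univ.exists_isMaxOn ⟨q, trivial⟩ hfc.continuousOn
  have hp' : ∀ q, inner ℝ (f q) y ≤ inner ℝ (f p) y := fun q => hp (Set.mem_univ q)
  obtain ⟨a, b, hab⟩ := h.exists_eq_of_isMax hK hp'
  have hνf : inner ℝ (ν p) (f p) = 0 := h.hypersurface.normal_perp_position p
  have hfν : inner ℝ (f p) (ν p) = 0 := by rw [real_inner_comm]; exact hνf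
  have hin : ∀ a b c d : ℝ, inner ℝ (a • f p + b • ν p) (c • f p + d • ν p) = a * c + b * d := by
    intro a b c d
    simp only [inner_add_left, inner_add_right, inner_smul_left, inner_smul_right, h.inner_self p,
      h.inner_normal_self p, hνf, hfν, conj_trivial]
    ring
  have ha : inner ℝ (f p) y = a := by
    have := hin 1 0 a b
    rw [hab]
    simpa using this
  have ha' := hp' q
  rw [ha] at ha'
  have hab1 : a ^ 2 + b ^ 2 = 1 := by
    rw [hab, hin] at hy; linarith
  -- Maximality gives `a ≥ ⟪f q, y⟫ > 0`, so `b² = 1 - a²` is bounded by `1 - ⟪f q, y⟫²`.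
  have hbδ : |b| < δ := by
    apply abs_lt_of_sq_lt_sq _ hδ.le
    nlinarith
  have hb1 : -1 ≤ b ∧ b ≤ 1 := abs_le.mp ((sq_le_one_iff_abs_le_one b).mp (by nlinarith [sq_nonneg a]))
  have hsin : Real.sin (Real.arcsin b) = b := Real.sin_arcsin hb1.1 hb1.2
  have hcos : Real.cos (Real.arcsin b) = a := by
    rw [Real.cos_arcsin, show 1 - b ^ 2 = a ^ 2 by linarith, Real.sqrt_sq (by linarith)]
  have hyg : normalGeodesic f ν (Real.arcsin b) p = y := by
    rw [normalGeodesic, hsin, hcos, hab]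
  have hb0 : b = 0 := by
    refine hδb (by simpa using hbδ) ?_
    have h3 := H.geodesic p (Real.arcsin b)
    rw [hyg] at h3
    rw [h3, sub_eq_add_neg, ← neg_smul, hab, hin, ← hcos, ← hsin] at hlev
    rw [Real.arcsin_sin' ⟨Real.neg_pi_div_two_le_arcsin b, Real.arcsin_le_pi_div_two b⟩] at hlev
    rw [show 4 * Real.arcsin b - 4 * θ = 3 * Real.arcsin b - 4 * θ + Real.arcsin b by ring,
      Real.cos_add]
    linarith
  refine ⟨p, ?_⟩
  rw [← hyg, hb0]
  simp [normalGeodesic]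

end IsIsoparametric

end Hypersurfaces

/-! ### Unit normals of the focal submanifold and the swap -/

section Hypersurfaces

variable {d : ℕ} {X : Type*} [TopologicalSpace X]
  [ChartedSpace (EuclideanSpace ℝ (Fin d)) X] [IsManifold (𝓡 d) ∞ X]
  {f ν : X → EuclideanSpace ℝ (Fin (d + 2))} {K : Finset ℝ}
  {Θ : EuclideanSpace ℝ (Fin (d + 2)) →ₗ[ℝ] EuclideanSpace ℝ (Fin (d + 2)) →ₗ[ℝ]
    EuclideanSpace ℝ (Fin (d + 2)) →ₗ[ℝ] EuclideanSpace ℝ (Fin (d + 2))} {κ₀ θ : ℝ}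

namespace IsIsoparametric

variable (h : IsIsoparametric f ν K)
include h

theorem continuous_normalGeodesic (t : ℝ) : Continuous (normalGeodesic f ν t) := by
  have h1 := h.hypersurface.smooth.continuous
  have h2 := h.hypersurface.smooth_normal.continuous
  unfold normalGeodesic
  fun_prop

theorem continuous_normalVelocity (t : ℝ) : Continuous (normalVelocity f ν t) := by
  have h1 := h.hypersurface.smooth.continuous
  have h2 := h.hypersurface.smooth_normal.continuous
  unfold normalVelocity
  fun_prop

/-- The normal space of the focal submanifold has dimension at least two. -/
theorem exists_normal_pair (H : IsCartanMunzner Θ f ν θ) (hκ₀ : κ₀ ∈ K)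
    (hθ : Real.cos θ = κ₀ * Real.sin θ) (p : X) :
    ∃ y, y ≠ 0 ∧ inner ℝ (normalVelocity f ν θ p) y = 0 ∧
      Θ (normalGeodesic f ν θ p) (normalGeodesic f ν θ p) y = (-4 : ℝ) • y := by
  obtain ⟨g, O, u₀, hpatch, hu₀, rfl, -⟩ := h.exists_patch ⟨κ₀, hκ₀⟩ p
  have Hg : IsCartanMunzner Θ (f ∘ g) (ν ∘ g) θ :=
    ⟨H.symm, H.eikonal, fun u t => H.geodesic (g u) t⟩
  obtain ⟨e, he0, he⟩ := hpatch.exists_eigenvector hu₀ hκ₀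
  refine ⟨fderiv ℝ (f ∘ g) u₀ e, fun h0 => he0 ?_, hpatch.inner_normalVelocity_fderiv hu₀ θ e,
    hpatch.focal_leaf_eigenvector Hg hθ hu₀ he⟩
  exact (injective_iff_map_eq_zero _).mp (hpatch.immersion u₀ hu₀) e h0

/-- Every unit normal vector of the focal submanifold is the end velocity of a normal geodesic of
the hypersurface. -/
theorem exists_normalVelocity_eq [CompactSpace X] (H : IsCartanMunzner Θ f ν θ) (hκ₀ : κ₀ ∈ K)
    (hθ : Real.cos θ = κ₀ * Real.sin θ) (hs : Real.sin (4 * θ) ≠ 0) (p : X)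
    {n : EuclideanSpace ℝ (Fin (d + 2))} (hn : ‖n‖ = 1)
    (hΘn : Θ (normalGeodesic f ν θ p) (normalGeodesic f ν θ p) n = (-4 : ℝ) • n) :
    ∃ q, normalGeodesic f ν θ q = normalGeodesic f ν θ p ∧ normalVelocity f ν θ q = n := by
  obtain ⟨x, hx⟩ : ∃ x, x = normalGeodesic f ν θ p := ⟨_, rfl⟩
  rw [← hx] at hΘn ⊢
  have hνf : ∀ p, inner ℝ (ν p) (f p) = 0 := h.hypersurface.normal_perp_position
  have hxx : inner ℝ x x = 1 := by
    rw [hx]; exact inner_normalGeodesic_self (h.inner_self p) (h.inner_normal_self p) (hνf p) θ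
  have hZx : Θ x x x = (4 : ℝ) • x := by rw [hx]; exact H.focal_cube p
  obtain ⟨N, hN⟩ : ∃ N : Submodule ℝ (EuclideanSpace ℝ (Fin (d + 2))),
      N = LinearMap.ker (Θ x x + (4 : ℝ) • LinearMap.id) := ⟨_, rfl⟩
  have hmem : ∀ y, y ∈ N ↔ Θ x x y = (-4 : ℝ) • y := by
    intro y
    rw [hN, LinearMap.mem_ker, LinearMap.add_apply, LinearMap.smul_apply, LinearMap.id_apply,
      neg_smul, eq_neg_iff_add_eq_zero]
  have hvel : normalVelocity f ν θ p ∈ N := by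
    rw [hmem, hx]; exact H.focal_normalVelocity p
  have hvel1 : inner ℝ (normalVelocity f ν θ p) (normalVelocity f ν θ p) = 1 :=
    inner_normalVelocity_self (h.inner_self p) (h.inner_normal_self p) (hνf p) θ
  -- The unit sphere of `N` must be connected, which requires dimension at least two: the end
  -- velocity and a leaf vector are independent.
  have hrank : 1 < Module.rank ℝ N := by
    rw [← Module.finrank_eq_rank, ← Nat.cast_one, Nat.cast_lt]
    by_contra hle
    obtain ⟨w, hw⟩ := finrank_le_one_iff.mp (not_lt.mp hle)
    obtain ⟨y, hy0, hy1, hy2⟩ := h.exists_normal_pair H hκ₀ hθ p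
    rw [← hx] at hy2
    obtain ⟨a, ha⟩ := hw ⟨_, hvel⟩
    obtain ⟨c, hc⟩ := hw ⟨y, (hmem y).mpr hy2⟩
    have ha' : a • (w : EuclideanSpace ℝ (Fin (d + 2))) = normalVelocity f ν θ p :=
      congrArg Subtype.val ha
    have hc' : c • (w : EuclideanSpace ℝ (Fin (d + 2))) = y := congrArg Subtype.val hc
    have ha0 : a ≠ 0 := by
      rintro rfl
      rw [← ha'] at hvel1
      simp at hvel1
    have h1 : inner ℝ y y = 0 := by
      have h2 : y = (c / a) • normalVelocity f ν θ p := by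
        rw [← ha', smul_smul, div_mul_cancel₀ _ ha0, hc']
      nth_rewrite 1 [h2]
      rw [inner_smul_left, hy1, mul_zero]
    exact hy0 ((inner_self_eq_zero (𝕜 := ℝ)).mp h1)
  let T := Metric.sphere (0 : N) 1
  have hTpre : PreconnectedSpace T :=
    isPreconnected_iff_preconnectedSpace.mp (isPreconnected_sphere hrank 0 1)
  have hT1 : ∀ m : T, inner ℝ ((m : N) : EuclideanSpace ℝ (Fin (d + 2))) (m : N) = 1 := by
    intro m
    have h1 : ‖(m : N)‖ = 1 := mem_sphere_zero_iff_norm.mp m.2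
    rw [real_inner_self_eq_norm_sq, ← Submodule.coe_norm, h1]
    norm_num
  have hTx : ∀ m : T, inner ℝ ((m : N) : EuclideanSpace ℝ (Fin (d + 2))) x = 0 := fun m =>
    H.symm.inner_eq_zero_of_eigenvectors (by norm_num : (-4 : ℝ) ≠ 4) ((hmem _).mp (m : N).2) hZx
  have hval : Continuous fun m : T => ((m : N) : EuclideanSpace ℝ (Fin (d + 2))) :=
    continuous_subtype_val.comp continuous_subtype_val
  obtain ⟨S, hS⟩ : ∃ S : Set T, S = {m : T | ((m : N) : EuclideanSpace ℝ (Fin (d + 2))) ∈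
    normalVelocity f ν θ '' {q | normalGeodesic f ν θ q = x}} := ⟨_, rfl⟩
  have hSc : IsClosed S := by
    have h1 : IsClosed {q | normalGeodesic f ν θ q = x} :=
      isClosed_eq (h.continuous_normalGeodesic θ) continuous_const
    rw [hS]
    exact (h1.isCompact.image (h.continuous_normalVelocity θ)).isClosed.preimage hval
  -- For a unit vector `m'` of `N` close to `m`, the point `cos θ • x - sin θ • m'` lies on the same
  -- level of the quartic and close to `f q`. So it is a point of the hypersurface, and its normal
  -- geodesic must end at `x` with velocity `m'`.
  have hSo : IsOpen S := by
    rw [isOpen_iff_mem_nhds]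
    intro m hm
    rw [hS] at hm
    obtain ⟨q, hq, hqm⟩ := hm
    have hq' : normalGeodesic f ν θ q = x := hq
    have hc : Continuous fun m : T =>
        Real.cos θ • x - Real.sin θ • ((m : N) : EuclideanSpace ℝ (Fin (d + 2))) := by
      fun_prop
    have hcm : Filter.Tendsto (fun m : T =>
        Real.cos θ • x - Real.sin θ • ((m : N) : EuclideanSpace ℝ (Fin (d + 2)))) (nhds m)
        (nhds (f q)) := by
      rw [position_eq f ν θ q, hq', hqm]
      exact hc.tendsto m
    filter_upwards [hcm.eventually (h.eventually_mem_range ⟨κ₀, hκ₀⟩ H hs q)] with m' hm'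
    have hxm' : inner ℝ x ((m' : N) : EuclideanSpace ℝ (Fin (d + 2))) = 0 := by
      rw [real_inner_comm]; exact hTx m'
    have hZm' := (hmem _).mp (m' : N).2
    have hin : ∀ a b k l : ℝ, inner ℝ (a • x - b • ((m' : N) : EuclideanSpace ℝ (Fin (d + 2))))
        (k • x - l • ((m' : N) : EuclideanSpace ℝ (Fin (d + 2)))) = a * k + b * l := by
      intro a b k l
      simp only [inner_sub_left, inner_sub_right, inner_smul_left, inner_smul_right, hxx, hT1 m',
        hTx m', hxm', conj_trivial]
      ring
    have hcirc := H.symm.cube_normal_circle H.eikonal hxx (hT1 m') (hTx m') hZx hZm' (-θ)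
    rw [Real.cos_neg, Real.sin_neg, neg_smul, ← sub_eq_add_neg] at hcirc
    obtain ⟨p', hp'⟩ := hm' (by rw [hin]; linarith [Real.sin_sq_add_cos_sq θ]) (by
      rw [hcirc, hin, show 4 * θ = 3 * θ + θ by ring, Real.cos_add,
        show 3 * -θ = -(3 * θ) by ring, Real.cos_neg, Real.sin_neg]
      ring)
    rw [hS]
    obtain ⟨h1, h2⟩ := H.normalGeodesic_eq_of_position hs hxx (hT1 m') (hTx m') hZx hZm' hp'
    exact ⟨p', h1, h2⟩
  have hvelT : (⟨_, hvel⟩ : N) ∈ Metric.sphere (0 : N) 1 := by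
    rw [mem_sphere_zero_iff_norm, Submodule.coe_norm, norm_eq_sqrt_real_inner, hvel1]
    exact Real.sqrt_one
  have hSu : S = Set.univ := IsClopen.eq_univ ⟨hSc, hSo⟩
    ⟨⟨⟨_, hvel⟩, hvelT⟩, by rw [hS]; exact ⟨p, hx.symm, rfl⟩⟩
  have hnT : (⟨n, (hmem n).mpr hΘn⟩ : N) ∈ Metric.sphere (0 : N) 1 := by
    rw [mem_sphere_zero_iff_norm, Submodule.coe_norm]; exact hn
  have hnS : (⟨_, hnT⟩ : T) ∈ S := by rw [hSu]; trivial
  rw [hS] at hnS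
  obtain ⟨q, hq, hqn⟩ := hnS
  exact ⟨q, hq, hqn⟩

/-- Vectors normal to the focal submanifold are eigenvectors of the quartic form. -/
theorem normal_eigenvector (H : IsCartanMunzner Θ f ν θ) (hκ₀ : κ₀ ∈ K)
    (hθ : Real.cos θ = κ₀ * Real.sin θ) (hs : Real.sin θ ≠ 0) (p : X)
    {n : EuclideanSpace ℝ (Fin (d + 2))} (hn : inner ℝ n (normalGeodesic f ν θ p) = 0)
    (hn' : ∀ v ∈ tangentConeAt ℝ (Set.range (normalGeodesic f ν θ)) (normalGeodesic f ν θ p),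
      inner ℝ n v = 0) :
    Θ (normalGeodesic f ν θ p) (normalGeodesic f ν θ p) n = (-4 : ℝ) • n := by
  have hvel := H.focal_normalVelocity p
  obtain ⟨g, O, u₀, hpatch, hu₀, rfl, -⟩ := h.exists_patch ⟨κ₀, hκ₀⟩ p
  have Hg : IsCartanMunzner Θ (f ∘ g) (ν ∘ g) θ :=
    ⟨H.symm, H.eikonal, fun u t => H.geodesic (g u) t⟩
  -- Only one inclusion is needed: the image of the differential of the focal map lies in the
  -- tangent cone.
  obtain ⟨ρ, e, he, hne⟩ := hpatch.exists_eq_of_perp_focal hu₀ hκ₀ hθ hs (y := n) hn (fun v => by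
    apply hn'
    have h1 : HasFDerivWithinAt (normalGeodesic (f ∘ g) (ν ∘ g) θ) _ Set.univ u₀ :=
      ((hpatch.contDiffAt_normalGeodesic hu₀ θ).differentiableAt
        (by simp)).hasFDerivAt.hasFDerivWithinAt
    have h2 : v ∈ tangentConeAt ℝ Set.univ u₀ := by rw [tangentConeAt_univ]; trivial
    refine tangentConeAt_mono ?_ (h1.mapsTo_tangent_cone h2)
    rw [Set.image_univ]
    rintro _ ⟨u, rfl⟩
    exact ⟨g u, rfl⟩)
  have h2 := hpatch.focal_leaf_eigenvector Hg hθ hu₀ he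
  have h3 : normalGeodesic (f ∘ g) (ν ∘ g) θ u₀ = normalGeodesic f ν θ (g u₀) := rfl
  have h4 : normalVelocity (f ∘ g) (ν ∘ g) θ u₀ = normalVelocity f ν θ (g u₀) := rfl
  rw [h3] at h2
  rw [hne, h4, map_add, map_smul, hvel, h2]
  module

theorem swap_mem_unitNormalBundle [CompactSpace X] [ConnectedSpace X] (hK : K.card = 4)
    (hκ₀ : κ₀ ∈ K) (hθ : Real.cos θ = κ₀ * Real.sin θ)
    {x n : EuclideanSpace ℝ (Fin (d + 2))}
    (hxn : (x, n) ∈ unitNormalBundle (Set.range (normalGeodesic f ν θ))) :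
    (n, x) ∈ unitNormalBundle (Set.range (normalGeodesic f ν θ)) := by
  obtain ⟨⟨p, hp⟩, hn1, hnx, hcone⟩ := hxn
  simp only at hp hn1 hnx hcone
  subst hp
  have hs : Real.sin θ ≠ 0 := by
    intro h0
    have h1 := Real.sin_sq_add_cos_sq θ
    rw [hθ, h0] at h1
    norm_num at h1
  obtain ⟨Θ, hΘ, heik, hgeo⟩ := h.exists_quartic hK hκ₀ hθ
  have H : IsCartanMunzner Θ f ν θ := ⟨hΘ, heik, hgeo⟩
  obtain ⟨κ₁, κ₂, κ₃, hq⟩ : ∃ κ₁ κ₂ κ₃, IsQuarterSpaced K κ₀ κ₁ κ₂ κ₃ := by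
    obtain ⟨g, O, u₀, hpatch, hu₀, -, -⟩ := h.exists_patch ⟨κ₀, hκ₀⟩ p
    exact hpatch.exists_isQuarterSpaced hu₀ hK hκ₀
  have hs4 := hq.sin_four_mul_ne_zero hθ hs
  have hθ' := hq.angle1 hθ
  have hs4' : Real.sin (4 * (θ + Real.pi / 4)) ≠ 0 := by
    rw [show 4 * (θ + Real.pi / 4) = 4 * θ + Real.pi by ring, Real.sin_add_pi]
    exact neg_ne_zero.mpr hs4
  have hνf : ∀ p, inner ℝ (ν p) (f p) = 0 := h.hypersurface.normal_perp_position
  have hxx : inner ℝ (normalGeodesic f ν θ p) (normalGeodesic f ν θ p) = 1 :=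
    inner_normalGeodesic_self (h.inner_self p) (h.inner_normal_self p) (hνf p) θ
  have hΘn := h.normal_eigenvector H hκ₀ hθ hs p hnx hcone
  obtain ⟨hnn, hnnx⟩ := hΘ.swap_of_eikonal heik hxx
    (by rw [real_inner_self_eq_norm_sq, hn1]; norm_num) hnx (H.focal_cube p) hΘn
  obtain ⟨q, hq1, hq2⟩ := h.exists_normalVelocity_eq H hκ₀ hθ hs4 p hn1 hΘn
  -- The geodesic of `q` reaches the other focal submanifold at `θ + π/4` and the point `n` at `θ +
  -- π/2`. The reversed velocity at `θ + π/4` is a unit normal there, so it belongs to a geodesic of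
  -- some `q'`. Going back by `π/4` along the latter, to the parameter `θ`, arrives at `n`.
  have hmem : n ∈ Set.range (normalGeodesic f ν θ) := by
    have h1 : ‖-normalVelocity f ν (θ + Real.pi / 4) q‖ = 1 := by
      rw [norm_neg, norm_eq_sqrt_real_inner,
        inner_normalVelocity_self (h.inner_self q) (h.inner_normal_self q) (hνf q)]
      exact Real.sqrt_one
    obtain ⟨q', hq1', hq2'⟩ := h.exists_normalVelocity_eq H.rotate hq.mem.2.1 hθ' hs4' q h1
      (by rw [map_neg, H.rotate.focal_normalVelocity q, smul_neg])
    refine ⟨q', ?_⟩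
    have e1 := normalGeodesic_add f ν (θ + Real.pi / 4) (-(Real.pi / 4)) q'
    have e2 := normalGeodesic_add f ν (θ + Real.pi / 4) (Real.pi / 4) q
    have e3 : normalGeodesic f ν (θ + Real.pi / 4 + Real.pi / 4) q = n := by
      rw [← hq2, show θ + Real.pi / 4 + Real.pi / 4 = θ + Real.pi / 2 by ring, normalGeodesic_add]
      simp
    rw [add_neg_cancel_right, hq1', hq2', Real.cos_neg, Real.sin_neg, smul_neg, neg_smul,
      neg_neg, ← e2, e3] at e1
    exact e1
  refine ⟨hmem, ?_, ?_, ?_⟩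
  · simp only
    rw [norm_eq_sqrt_real_inner, hxx]
    exact Real.sqrt_one
  · simp only
    rw [real_inner_comm]
    exact hnx
  -- Tangent vectors at `n` have eigenvalue `4/3` for `Θ n n`, while `x` has eigenvalue `-4`.
  · intro v hv
    have h1 := hΘ.eigenvector_of_mem_tangentConeAt (M := Set.range (normalGeodesic f ν θ))
      (by rintro _ ⟨q, rfl⟩; exact H.focal_cube q) hmem hv
    exact hΘ.inner_eq_zero_of_eigenvectors (by norm_num : (-4 : ℝ) ≠ 4 / 3) hnnx h1

end IsIsoparametric

end Hypersurfaces

end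

theorem mainTheorem7 {d : ℕ} {X : Type*} [TopologicalSpace X] [T2Space X] [CompactSpace X]
    [ConnectedSpace X] [ChartedSpace (EuclideanSpace ℝ (Fin d)) X] [IsManifold (𝓡 d) ∞ X]
    (f ν : X → EuclideanSpace ℝ (Fin (d + 2))) (K : Finset ℝ)
    (hf : IsIsoparametric f ν K) (hK : K.card = 4)
    (M : Set (EuclideanSpace ℝ (Fin (d + 2)))) (hM : IsFocalSubmanifold f ν K M) :
    Prod.swap '' unitNormalBundle M = unitNormalBundle M ∧
      ∀ x n : EuclideanSpace ℝ (Fin (d + 2)),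
        (x, n) ∈ unitNormalBundle M → (n, x) ∈ unitNormalBundle M := by
  obtain ⟨θ, ⟨κ₀, hκ₀, hθ⟩, rfl⟩ := hM
  -- `parallelMap` and `normalGeodesic` agree by definition.
  have hswap : ∀ x n : EuclideanSpace ℝ (Fin (d + 2)),
      (x, n) ∈ unitNormalBundle (Set.range (parallelMap f ν θ)) →
      (n, x) ∈ unitNormalBundle (Set.range (parallelMap f ν θ)) := fun x n hxn =>
    hf.swap_mem_unitNormalBundle hK hκ₀ hθ hxn
  refine ⟨Set.Subset.antisymm ?_ ?_, hswap⟩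
  · rintro _ ⟨⟨x, n⟩, hxn, rfl⟩
    exact hswap x n hxn
  · rintro ⟨x, n⟩ hxn
    exact ⟨(n, x), hswap x n hxn, rfl⟩
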